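/- Let $q$ be a positive integer, $\epsilon=(-1)^q$, let $\Lambda$ be a unital ring with involution $a\mapsto\bar a$ for which the rank of finitely generated free modules is well defined, and let $Z\subseteq\widetilde K_1(\Lambda)=\operatorname{coker}(K_1(\mathbb Z)\to K_1(\Lambda))$ be a subgroup invariant under $[A]\mapsto[A^*]$ (conjugate transpose). **Based modules.** A *based module* is a stably finitely generated free left $\Lambda$-module $M$ with a preferred $s$-basis, i.e. a basis of $M\oplus\Lambda^m$ for some $m$. An isomorphism $f$ of based modules is *simple* if the class in $\widetilde K_1(\Lambda)$ of the matrix of $f\oplus\mathrm{id}$ with respect to (stabilised) preferred $s$-bases lies in $Z$; preferred $s$-bases matter only up to $Z$-equivalence, that is, up to $\mathrm{id}_M$ being simple. $M^*=\operatorname{Hom}_\Lambda(M,\Lambda)$, with $(af)(x)=f(x)\bar a$, carries the dual $s$-basis. **Forms.** Let $T_\epsilon$ be the involution $(T_\epsilon\phi)(x)(y)=\epsilon\,\overline{\phi(y)(x)}$ of $\operatorname{Hom}_\Lambda(M,M^*)$ and $Q_\epsilon(M)=\operatorname{coker}(1-T_\epsilon)$. An *$\epsilon$-quadratic form* $(M,\psi)$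 is a based module $M$ with $\psi\in Q_\epsilon(M)$; it is *simple* if $(1+T_\epsilon)\psi\colon M\to M^*$ is a simple isomorphism. Isometries are simple isomorphisms $f\colon M\to M'$ with $f^*\psi'f=\psi$. The hyperbolic form $H_\epsilon(L)$ is $L\oplus L^*$ with the class of $((x,f),(y,g))\mapsto f(y)$. Two forms $v,w$ define the same *$0$-stabilised form* $[v]=[w]$ if $v\oplus(P,0)\cong w\oplus(Q,0)$ for some based modules $P,Q$; $\mathcal F^{\rm zs}_{2q}(\Lambda)$ is the abelian monoid of $0$-stabilised forms under direct sum. **Lagrangians.** A *simple Lagrangian* of a simple form $(M,\psi)$ is a based direct summand $j\colon L\hookrightarrow M$ with $L=L^\perp:=\ker(j^*(1+T_\epsilon)\psi)$ and $j^*\psi j=0\in Q_\epsilon(L)$ such that the $s$-basis of $M$ obtained from those of $L$ and $L^*$ through the exact sequence $0\to L\to M\to L^*\to0$ is a preferred one. **The monoid $l_{2q+1}(\Lambda)$.** A *quasi-formation* $(M,\psi;L,V)$ is a simple form $(M,\psi)$ with a simple Lagrangian $L$ and a based direct summand $V\subseteq M$ of half rank. An isomorphism of quasi-formations is an isometry that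 carries $L$ to $L'$ and $V$ to $V'$ and induces simple isomorphisms $L\cong L'$ and $V\cong V'$. The *trivial formations* are $(H_\epsilon(P);P,P^*)$ for based modules $P$. The abelian monoid $l_{2q+1}(\Lambda)$ consists of the quasi-formations, with addition induced by direct sum, modulo the additive congruence generated by stable isomorphism (isomorphism after adding trivial formations) and $$(M,\psi;K,L)\oplus(M,\psi;L,V)\sim(M,\psi;K,V)\qquad(K,L\text{ simple Lagrangians}).$$ Its unit is the class of the trivial formations. **Elementary elements.** For a homomorphism $\rho\colon K\to K^*$ from a based module to its dual, the *boundary* $\delta(K,\rho)$ is the quasi-formation $(H_\epsilon(K);K,\{(x,\rho(x)):x\in K\})$, where the graph is based by $K$. An element of $l_{2q+1}(\Lambda)$ is *elementary* if it is the class of a boundary. The elementary elements form a submonoid $\mathcal El_{2q+1}(\Lambda)$. **Statement.** There is an isomorphism of monoids $$e\colon\mathcal F^{\rm zs}_{2q}(\Lambda)\xrightarrow{\ \cong\ }\mathcal El_{2q+1}(\Lambda),\qquad e([V,[\rho]])=[\delta(V,\rho)],$$ whose inverse sends an elementary class $[M,\psi;L,V]$ to $[V,j^*\psi j]$, where $j\colon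 V\hookrightarrow M$ is the inclusion. For every $[x]\in l_{2q+1}(\Lambda)$ there is a positive integer $k$ such that $[x]+e([H_\epsilon(\Lambda^k)])$ is elementary. The homomorphisms $$\mathcal F^{\rm zs}_{2q}(\Lambda)\xrightarrow{\ e\ }\mathcal El_{2q+1}(\Lambda)\hookrightarrow l_{2q+1}(\Lambda)$$ induce isomorphisms of Grothendieck groups $$\operatorname{Gr}(\mathcal F^{\rm zs}_{2q}(\Lambda))\cong\operatorname{Gr}(\mathcal El_{2q+1}(\Lambda))\cong\operatorname{Gr}(l_{2q+1}(\Lambda)).$$ -/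

import Mathlib

open Module

universe u

set_option linter.unusedSectionVars false

noncomputable section

namespace SurgeryMonoid

/-! ### Invertible matrices and the reduced group `K₁` -/

section KOne

variable (Λ : Type*) [Ring Λ]

/-- `GL_ι(Λ)` for a finite index set `ι`; the ring need not be commutative. -/
abbrev GLn (ι : Type) [Fintype ι] [DecidableEq ι] : Type _ := (Matrix ι ι Λ)ˣ

variable {Λ}

/-- Renaming of the index set of an invertible matrix. -/
def glReindex {ι κ : Type} [Fintype ι] [DecidableEq ι] [Fintype κ] [DecidableEq κ]
    (e : ι ≃ κ) : GLn Λ ι →* GLn Λ κ :=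
  Units.map (Matrix.reindexRingEquiv Λ e).toMonoidHom

/-- The block sum `A ⊕ B` of invertible matrices. -/
def glSum {ι κ : Type} [Fintype ι] [DecidableEq ι] [Fintype κ] [DecidableEq κ]
    (A : GLn Λ ι) (B : GLn Λ κ) : GLn Λ (ι ⊕ κ) where
  val := Matrix.fromBlocks (A : Matrix ι ι Λ) 0 0 (B : Matrix κ κ Λ)
  inv := Matrix.fromBlocks ((A⁻¹ : GLn Λ ι) : Matrix ι ι Λ) 0 0 ((B⁻¹ : GLn Λ κ) : Matrix κ κ Λ)
  val_inv := by simp [Matrix.fromBlocks_multiply, ← Matrix.fromBlocks_one]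
  inv_val := by simp [Matrix.fromBlocks_multiply, ← Matrix.fromBlocks_one]

variable (Λ)

/-- The relations `[AB] = [A] + [B]` and `[A ⊕ 1] = [A]`. -/
def kOneRelations : Set (FreeAbelianGroup (Σ n : ℕ, GLn Λ (Fin n))) :=
  {x | ∃ (n : ℕ) (A B : GLn Λ (Fin n)), x = FreeAbelianGroup.of ⟨n, A * B⟩
      - FreeAbelianGroup.of ⟨n, A⟩ - FreeAbelianGroup.of ⟨n, B⟩} ∪
  {x | ∃ (n : ℕ) (A : GLn Λ (Fin n)),
      x = FreeAbelianGroup.of ⟨n + 1, glReindex finSumFinEquiv (glSum A (1 : GLn Λ (Fin 1)))⟩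
        - FreeAbelianGroup.of ⟨n, A⟩}

/-- `K₁(Λ) = GL(Λ)^{ab}`, where `GL(Λ)` is the union of the groups `GL_n(Λ)` under `A ↦ A ⊕ 1`,
written additively: the abelian group generated by all invertible matrices, subject to
`[AB] = [A] + [B]` and `[A ⊕ 1] = [A]`. -/
abbrev KOne : Type _ :=
  FreeAbelianGroup (Σ n : ℕ, GLn Λ (Fin n)) ⧸ AddSubgroup.closure (kOneRelations Λ)

variable {Λ}

/-- The class in `K₁(Λ)` of an invertible matrix. -/
def KOne.mk {n : ℕ} (A : GLn Λ (Fin n)) : KOne Λ :=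
  QuotientAddGroup.mk (FreeAbelianGroup.of ⟨n, A⟩)

theorem KOne.mk_mul {n : ℕ} (A B : GLn Λ (Fin n)) :
    KOne.mk (A * B) = KOne.mk A + KOne.mk B := by
  have h : FreeAbelianGroup.of (⟨n, A * B⟩ : Σ n : ℕ, GLn Λ (Fin n))
      - FreeAbelianGroup.of ⟨n, A⟩ - FreeAbelianGroup.of ⟨n, B⟩ ∈
      AddSubgroup.closure (kOneRelations Λ) :=
    AddSubgroup.subset_closure (Or.inl ⟨n, A, B, rfl⟩)
  have h' := (QuotientAddGroup.eq_zero_iff _).2 h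
  rw [QuotientAddGroup.mk_sub, QuotientAddGroup.mk_sub, sub_sub, sub_eq_zero] at h'
  exact h'

theorem KOne.mk_stab {n : ℕ} (A : GLn Λ (Fin n)) :
    KOne.mk (glReindex finSumFinEquiv (glSum A (1 : GLn Λ (Fin 1)))) = KOne.mk A := by
  have h : FreeAbelianGroup.of (⟨n + 1, glReindex finSumFinEquiv
        (glSum A (1 : GLn Λ (Fin 1)))⟩ : Σ n : ℕ, GLn Λ (Fin n))
      - FreeAbelianGroup.of ⟨n, A⟩ ∈ AddSubgroup.closure (kOneRelations Λ) :=
    AddSubgroup.subset_closure (Or.inr ⟨n, A, rfl⟩)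
  have h' := (QuotientAddGroup.eq_zero_iff _).2 h
  rw [QuotientAddGroup.mk_sub, sub_eq_zero] at h'
  exact h'

/-- The map `GL_n(Λ) → GL_n(Γ)` induced by a ring homomorphism. -/
def glMap {Γ : Type*} [Ring Γ] (f : Λ →+* Γ) {ι : Type} [Fintype ι] [DecidableEq ι] :
    GLn Λ ι →* GLn Γ ι :=
  Units.map f.mapMatrix.toMonoidHom

/-- The homomorphism `K₁(Λ) → K₁(Γ)` induced by a ring homomorphism. -/
def KOne.map {Γ : Type*} [Ring Γ] (f : Λ →+* Γ) : KOne Λ →+ KOne Γ :=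
  QuotientAddGroup.lift _ (FreeAbelianGroup.lift fun A => KOne.mk (glMap f A.2)) (by
    rw [AddSubgroup.closure_le]
    rintro x (⟨n, A, B, rfl⟩ | ⟨n, A, rfl⟩)
    · simp [KOne.mk_mul]
    · have h : glMap f (glReindex finSumFinEquiv (glSum A (1 : GLn Λ (Fin 1))))
          = glReindex finSumFinEquiv (glSum (glMap f A) (1 : GLn Γ (Fin 1))) := by
        ext i j
        obtain ⟨i, rfl⟩ := finSumFinEquiv.surjective i
        obtain ⟨j, rfl⟩ := finSumFinEquiv.surjective j
        rcases i with i | i <;> rcases j with j | j <;>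
          simp [glMap, glReindex, glSum, Matrix.one_apply, Matrix.reindexRingEquiv,
            apply_ite f]
      simp [h, KOne.mk_stab])

variable (Λ)

/-- The reduced group `K̃₁(Λ) = coker (K₁(ℤ) → K₁(Λ))`. -/
abbrev KTilde : Type _ := KOne Λ ⧸ (KOne.map (Int.castRingHom Λ)).range

variable {Λ}

/-- The class in `K̃₁(Λ)` of an invertible matrix with an arbitrary finite index set
(enumerated in any way). -/
def KTilde.cls {ι : Type} [Fintype ι] [DecidableEq ι] (A : GLn Λ ι) : KTilde Λ :=
  QuotientAddGroup.mk (KOne.mk (glReindex (Fintype.equivFin ι) A))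

/-- The conjugate transpose of an invertible matrix. -/
def glStar [StarRing Λ] {ι : Type} [Fintype ι] [DecidableEq ι] (A : GLn Λ ι) : GLn Λ ι where
  val := (A : Matrix ι ι Λ).conjTranspose
  inv := ((A⁻¹ : GLn Λ ι) : Matrix ι ι Λ).conjTranspose
  val_inv := by rw [← Matrix.conjTranspose_mul]; simp
  inv_val := by rw [← Matrix.conjTranspose_mul]; simp

/-- A subgroup `Z ⊆ K̃₁(Λ)` is `*`-invariant if it is closed under `[A] ↦ [A*]`, the operation
induced by passing to the dual homomorphism. (Every element of `K̃₁(Λ)` is the class of a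
matrix.) -/
def IsStarInvariant [StarRing Λ] (Z : AddSubgroup (KTilde Λ)) : Prop :=
  ∀ (n : ℕ) (A : GLn Λ (Fin n)), KTilde.cls A ∈ Z → KTilde.cls (glStar A) ∈ Z

end KOne

section KOneFacts

variable {Λ : Type*} [Ring Λ]

theorem glReindex_apply {ι κ : Type} [Fintype ι] [DecidableEq ι] [Fintype κ] [DecidableEq κ]
    (e : ι ≃ κ) (A : GLn Λ ι) (i j : κ) :
    (glReindex e A : Matrix κ κ Λ) i j = (A : Matrix ι ι Λ) (e.symm i) (e.symm j) := rfl

theorem glReindex_trans {ι κ μ : Type} [Fintype ι] [DecidableEq ι] [Fintype κ] [DecidableEq κ]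
    [Fintype μ] [DecidableEq μ] (e : ι ≃ κ) (f : κ ≃ μ) (A : GLn Λ ι) :
    glReindex f (glReindex e A) = glReindex (e.trans f) A := by
  ext i j; rfl

/-- The permutation matrix as an invertible matrix. -/
def glPerm (Λ : Type*) [Ring Λ] {ι : Type} [Fintype ι] [DecidableEq ι] (π : ι ≃ ι) :
    GLn Λ ι where
  val := (1 : Matrix ι ι Λ).submatrix π.symm id
  inv := (1 : Matrix ι ι Λ).submatrix π id
  val_inv := by
    ext i j
    simp [Matrix.mul_apply, Matrix.one_apply, ← Equiv.eq_symm_apply]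
  inv_val := by
    ext i j
    simp [Matrix.mul_apply, Matrix.one_apply, Equiv.symm_apply_eq]

theorem glReindex_perm {ι : Type} [Fintype ι] [DecidableEq ι] (π : ι ≃ ι) (A : GLn Λ ι) :
    glReindex π A * glPerm Λ π = glPerm Λ π * A := by
  ext i j
  have h : ∀ x, (π.symm x = j) = (x = π j) := fun x => propext (Equiv.symm_apply_eq π)
  simp [Matrix.mul_apply, glPerm, glReindex_apply, Matrix.one_apply, h]

theorem KOne.mk_reindex {n : ℕ} (π : Fin n ≃ Fin n) (A : GLn Λ (Fin n)) :
    KOne.mk (glReindex π A) = KOne.mk A := by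
  have h := congrArg KOne.mk (glReindex_perm π A)
  rw [KOne.mk_mul, KOne.mk_mul, add_comm] at h
  exact add_left_cancel h

theorem KTilde.cls_eq {ι : Type} [Fintype ι] [DecidableEq ι] {n : ℕ} (e : ι ≃ Fin n)
    (A : GLn Λ ι) : KTilde.cls A = QuotientAddGroup.mk (KOne.mk (glReindex e A)) := by
  obtain rfl : Fintype.card ι = n := by simpa using Fintype.card_congr e
  rw [KTilde.cls, ← KOne.mk_reindex ((Fintype.equivFin ι).symm.trans e), glReindex_trans,
    ← Equiv.trans_assoc, Equiv.self_trans_symm, Equiv.refl_trans]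

theorem KTilde.cls_reindex {ι κ : Type} [Fintype ι] [DecidableEq ι] [Fintype κ] [DecidableEq κ]
    (e : ι ≃ κ) (A : GLn Λ ι) : KTilde.cls (glReindex e A) = KTilde.cls A := by
  rw [KTilde.cls_eq (Fintype.equivFin κ), KTilde.cls_eq (e.trans (Fintype.equivFin κ)),
    glReindex_trans]

theorem KTilde.cls_mul {ι : Type} [Fintype ι] [DecidableEq ι] (A B : GLn Λ ι) :
    KTilde.cls (A * B) = KTilde.cls A + KTilde.cls B := by
  simp [KTilde.cls, KOne.mk_mul]

theorem KTilde.cls_one {ι : Type} [Fintype ι] [DecidableEq ι] :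
    KTilde.cls (1 : GLn Λ ι) = 0 := by
  have h := KTilde.cls_mul (1 : GLn Λ ι) 1
  rw [mul_one] at h
  exact left_eq_add.1 h

theorem KTilde.cls_stab_fin (k : ℕ) : ∀ {n : ℕ} (A : GLn Λ (Fin n)),
    KTilde.cls (glSum A (1 : GLn Λ (Fin k))) = KTilde.cls A := by
  induction k with
  | zero =>
    intro n A
    rw [← KTilde.cls_reindex (Equiv.sumEmpty (Fin n) (Fin 0))]
    congr 1
  | succ k ih =>
    intro n A
    have h1 : KTilde.cls (glReindex finSumFinEquiv (glSum A (1 : GLn Λ (Fin 1))))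
        = KTilde.cls A := by
      rw [KTilde.cls_eq (Equiv.refl _), KTilde.cls_eq (Equiv.refl _)]
      exact congrArg _ (KOne.mk_stab A)
    rw [← h1, ← ih]
    let e : Fin n ⊕ Fin (k + 1) ≃ Fin (n + 1) ⊕ Fin k :=
      ((Equiv.sumCongr (Equiv.refl _) ((finCongr (add_comm k 1)).trans finSumFinEquiv.symm)).trans
        (Equiv.sumAssoc _ _ _).symm).trans (Equiv.sumCongr finSumFinEquiv (Equiv.refl _))
    rw [← KTilde.cls_reindex e]
    congr 1
    ext i j
    obtain ⟨i, rfl⟩ := ((Equiv.sumAssoc _ _ _).symm.trans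
      (Equiv.sumCongr finSumFinEquiv (Equiv.refl (Fin k)))).surjective i
    obtain ⟨j, rfl⟩ := ((Equiv.sumAssoc _ _ _).symm.trans
      (Equiv.sumCongr finSumFinEquiv (Equiv.refl (Fin k)))).surjective j
    rw [glReindex_apply]
    rcases i with i | i | i <;> rcases j with j | j | j <;>
      simp [e, glSum, glReindex_apply, Matrix.one_apply] <;> intro h <;> exfalso <;>
      simp [Fin.ext_iff] at h

theorem KTilde.cls_stab {ι κ : Type} [Fintype ι] [DecidableEq ι] [Fintype κ] [DecidableEq κ]
    (A : GLn Λ ι) : KTilde.cls (glSum A (1 : GLn Λ κ)) = KTilde.cls A := by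
  rw [← KTilde.cls_reindex (Fintype.equivFin ι) A, ← KTilde.cls_stab_fin (Fintype.card κ),
    ← KTilde.cls_reindex (Equiv.sumCongr (Fintype.equivFin ι) (Fintype.equivFin κ))]
  congr 1
  ext i j
  rcases i with i | i <;> rcases j with j | j <;>
    simp [glSum, glReindex_apply, Matrix.one_apply]

theorem KTilde.cls_stab' {ι κ : Type} [Fintype ι] [DecidableEq ι] [Fintype κ] [DecidableEq κ]
    (A : GLn Λ ι) : KTilde.cls (glSum (1 : GLn Λ κ) A) = KTilde.cls A := by
  rw [← KTilde.cls_stab (κ := κ) A, ← KTilde.cls_reindex (Equiv.sumComm κ ι)]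
  congr 1
  ext i j
  rcases i with i | i <;> rcases j with j | j <;> simp [glSum, glReindex_apply]

theorem KTilde.cls_glSum {ι κ : Type} [Fintype ι] [DecidableEq ι] [Fintype κ] [DecidableEq κ]
    (A : GLn Λ ι) (B : GLn Λ κ) :
    KTilde.cls (glSum A B) = KTilde.cls A + KTilde.cls B := by
  have h : glSum A B = glSum A 1 * glSum 1 B := by
    ext i j
    simp [glSum, Matrix.fromBlocks_multiply]
  rw [h, KTilde.cls_mul, KTilde.cls_stab, KTilde.cls_stab']

theorem KTilde.cls_int {ι : Type} [Fintype ι] [DecidableEq ι] (A : GLn ℤ ι) :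
    KTilde.cls (glMap (Int.castRingHom Λ) A) = 0 := by
  refine (QuotientAddGroup.eq_zero_iff _).2 ⟨KOne.mk (glReindex (Fintype.equivFin ι) A), ?_⟩
  simp only [KOne.mk, KOne.map, QuotientAddGroup.lift_mk, FreeAbelianGroup.lift_apply_of]
  rfl

end KOneFacts

/-! ### `s`-bases, based modules, simple isomorphisms -/

section Based

variable (Λ : Type u) [Ring Λ]

/-- An `s`-basis of a left module `M`: a finite basis of `M ⊕ Λ^m` for some `m`. It exists exactly
if `M` is stably finitely generated free. The numbers `n` and `m` are replaced by finite index
sets `idx` and `stab`. -/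
structure SBasis (M : Type u) [AddCommGroup M] [Module Λ M] where
  idx : Type
  stab : Type
  [fidx : Fintype idx]
  [didx : DecidableEq idx]
  [fstab : Fintype stab]
  [dstab : DecidableEq stab]
  basis : Basis idx Λ (M × (stab → Λ))

attribute [instance] SBasis.fidx SBasis.didx SBasis.fstab SBasis.dstab

variable {Λ}
variable {M : Type u} [AddCommGroup M] [Module Λ M] {N : Type u} [AddCommGroup N] [Module Λ N]
variable {M' : Type u} [AddCommGroup M'] [Module Λ M']
variable {N' : Type u} [AddCommGroup N'] [Module Λ N']

/-- The rank of a stably free module, read off from an `s`-basis. -/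
def SBasis.rank (b : SBasis Λ M) : ℤ := (Fintype.card b.idx : ℤ) - Fintype.card b.stab

/-- The identification `(M ⊕ Λ^κ) ⊕ Λ^α = M ⊕ Λ^{κ ⊔ α}`. -/
def stabEquiv (M : Type u) [AddCommGroup M] [Module Λ M] (κ α : Type) :
    ((M × (κ → Λ)) × (α → Λ)) ≃ₗ[Λ] (M × (κ ⊕ α → Λ)) :=
  (LinearEquiv.prodAssoc Λ M (κ → Λ) (α → Λ)).trans
    ((LinearEquiv.refl Λ M).prodCongr (LinearEquiv.sumArrowLequivProdArrow κ α Λ Λ).symm)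

/-- The stabilised `s`-basis `{b_1, …, b_n, e_{m+1}, …, e_k}` of `M ⊕ Λ^k`. -/
def stabBasis {ι κ : Type} (B : Basis ι Λ (M × (κ → Λ))) (α : Type) [Fintype α] [DecidableEq α] :
    Basis (ι ⊕ α) Λ (M × (κ ⊕ α → Λ)) :=
  (B.prod (Pi.basisFun Λ α)).map (stabEquiv M κ α)

/-- The map `f ⊕ id : M ⊕ Λ^κ → M' ⊕ Λ^κ'`, where `Λ^κ` and `Λ^κ'` are identified through a
bijection `θ` of the index sets. -/
def stabMap (f : M →ₗ[Λ] M') {κ κ' : Type} (θ : κ ≃ κ') :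
    (M × (κ → Λ)) →ₗ[Λ] (M' × (κ' → Λ)) :=
  f.prodMap (LinearEquiv.funCongrLeft Λ Λ θ.symm).toLinearMap

/-- The torsion of an isomorphism `f : M ≅ M'` with respect to `s`-bases `B` and `B'` lies in `Z`.
The torsion is the class in `K̃₁(Λ)` of the matrix of `f ⊕ id` with respect to stabilisations of the
two `s`-bases to the same cardinality. The enumerations `θ` and `σ` change the matrix only by
permutation matrices, which vanish in `K̃₁(Λ)`. -/
def TorsionIn (Z : AddSubgroup (KTilde Λ)) {ι κ ι' κ' : Type} [Fintype ι] [DecidableEq ι]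
    (B : Basis ι Λ (M × (κ → Λ))) (B' : Basis ι' Λ (M' × (κ' → Λ))) (f : M ≃ₗ[Λ] M') : Prop :=
  ∃ (α β : Type) (_ : Fintype α) (_ : DecidableEq α) (_ : Fintype β) (_ : DecidableEq β)
    (θ : κ ⊕ α ≃ κ' ⊕ β) (σ : ι ⊕ α ≃ ι' ⊕ β) (A : GLn Λ (ι ⊕ α)),
    (∀ i j, (A : Matrix _ _ Λ) i j =
      (stabBasis B' β).repr (stabMap f.toLinearMap θ (stabBasis B α i)) (σ j)) ∧
    KTilde.cls A ∈ Z

/-- `Z`-simple isomorphisms of modules with preferred `s`-bases. -/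
def IsSimple (Z : AddSubgroup (KTilde Λ)) (b : SBasis Λ M) (b' : SBasis Λ M')
    (f : M ≃ₗ[Λ] M') : Prop :=
  TorsionIn Z b.basis b'.basis f

/-- Transport of a basis of `M ⊕ Λ^κ` along an isomorphism `M ≅ M'`. -/
def mapBasis {ι κ : Type} (B : Basis ι Λ (M × (κ → Λ))) (f : M ≃ₗ[Λ] M') :
    Basis ι Λ (M' × (κ → Λ)) :=
  B.map (f.prodCongr (LinearEquiv.refl Λ _))

/-- Transport of an `s`-basis along an isomorphism. -/
def SBasis.map (b : SBasis Λ M) (f : M ≃ₗ[Λ] M') : SBasis Λ M' where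
  idx := b.idx
  stab := b.stab
  basis := mapBasis b.basis f

/-- The identification `(M ⊕ Λ^κ) ⊕ (N ⊕ Λ^κ') = (M ⊕ N) ⊕ Λ^{κ ⊔ κ'}`. -/
def sumEquiv (M N : Type u) [AddCommGroup M] [Module Λ M] [AddCommGroup N] [Module Λ N]
    (κ κ' : Type) : ((M × (κ → Λ)) × (N × (κ' → Λ))) ≃ₗ[Λ] ((M × N) × (κ ⊕ κ' → Λ)) :=
  (LinearEquiv.prodProdProdComm Λ M (κ → Λ) N (κ' → Λ)).trans
    ((LinearEquiv.refl Λ _).prodCongr (LinearEquiv.sumArrowLequivProdArrow κ κ' Λ Λ).symm)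

/-- The direct sum of two `s`-bases. -/
def sumBasis {ι κ ι' κ' : Type} (B : Basis ι Λ (M × (κ → Λ))) (C : Basis ι' Λ (N × (κ' → Λ))) :
    Basis (ι ⊕ ι') Λ ((M × N) × (κ ⊕ κ' → Λ)) :=
  (B.prod C).map (sumEquiv M N κ κ')

/-- The `s`-basis of a direct sum. -/
def SBasis.sum (b : SBasis Λ M) (c : SBasis Λ N) : SBasis Λ (M × N) where
  idx := b.idx ⊕ c.idx
  stab := b.stab ⊕ c.stab
  basis := sumBasis b.basis c.basis

/-- A finite basis is an `s`-basis. -/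
def SBasis.ofBasis {ι : Type} [Fintype ι] [DecidableEq ι] (b : Basis ι Λ M) : SBasis Λ M where
  idx := ι
  stab := Empty
  basis := b.map (LinearEquiv.prodUnique (R := Λ) (M := M) (M₂ := Empty → Λ)).symm

variable (Λ)

/-- A based module: a stably f.g. free left module with a preferred `s`-basis. Only the
`Z`-equivalence class of the preferred `s`-basis matters, since two of them are `Z`-equivalent iff
the identity is a `Z`-simple isomorphism and the basings are used below only through `IsSimple`
and ranks. -/
structure BasedModule where
  carrier : Type u
  [grp : AddCommGroup carrier]
  [mod : Module Λ carrier]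
  base : SBasis Λ carrier

attribute [instance] BasedModule.grp BasedModule.mod

variable {Λ}

/-- The direct sum of based modules. -/
def BasedModule.sum (P Q : BasedModule Λ) : BasedModule Λ where
  carrier := P.carrier × Q.carrier
  base := P.base.sum Q.base

variable (Λ)

/-- The based module `Λ^k`. -/
def BasedModule.std (k : ℕ) : BasedModule Λ where
  carrier := Fin k → Λ
  base := SBasis.ofBasis (Pi.basisFun Λ (Fin k))

end Based

section SimpleFacts

variable {Λ : Type u} [Ring Λ]
variable {M : Type u} [AddCommGroup M] [Module Λ M] {N : Type u} [AddCommGroup N] [Module Λ N]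
variable {M' : Type u} [AddCommGroup M'] [Module Λ M']
variable {N' : Type u} [AddCommGroup N'] [Module Λ N']
variable {ι κ ι' κ' μ ν μ' ν' : Type}

theorem stabMap_apply (f : M →ₗ[Λ] M') (θ : κ ≃ κ') (x : M × (κ → Λ)) :
    stabMap f θ x = (f x.1, fun k => x.2 (θ.symm k)) := rfl

theorem stabBasis_inl (B : Basis ι Λ (M × (κ → Λ))) (α : Type) [Fintype α] [DecidableEq α]
    (i : ι) : stabBasis B α (Sum.inl i) = ((B i).1, Sum.elim (B i).2 (0 : α → Λ)) := by
  simp [stabBasis, stabEquiv]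
  ext k
  rcases k with k | k <;> simp

theorem stabBasis_inr (B : Basis ι Λ (M × (κ → Λ))) (α : Type) [Fintype α] [DecidableEq α]
    (a : α) : stabBasis B α (Sum.inr a) = (0, Sum.elim (0 : κ → Λ) (Pi.single a 1)) := by
  simp [stabBasis, stabEquiv]
  ext k
  rcases k with k | k <;> simp

theorem sumBasis_inl (B : Basis ι Λ (M × (κ → Λ))) (C : Basis ι' Λ (N × (κ' → Λ))) (i : ι) :
    sumBasis B C (Sum.inl i) = (((B i).1, 0), Sum.elim (B i).2 (0 : κ' → Λ)) := by
  simp [sumBasis, sumEquiv]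
  ext k
  rcases k with k | k <;> simp

theorem sumBasis_inr (B : Basis ι Λ (M × (κ → Λ))) (C : Basis ι' Λ (N × (κ' → Λ))) (i : ι') :
    sumBasis B C (Sum.inr i) = ((0, (C i).1), Sum.elim (0 : κ → Λ) (C i).2) := by
  simp [sumBasis, sumEquiv]
  ext k
  rcases k with k | k <;> simp

theorem repr_of_matching {X Y : Type*} [AddCommGroup X] [Module Λ X] [AddCommGroup Y] [Module Λ Y]
    {ι κ : Type*} (B : Basis ι Λ X) (C : Basis κ Λ Y) (π : ι ≃ κ) (g : X →ₗ[Λ] Y)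
    (h : ∀ i, C (π i) = g (B i)) (x : X) (j : ι) : C.repr (g x) (π j) = B.repr x j := by
  classical
  have : (Finsupp.lapply (π j)).comp (C.repr.toLinearMap.comp g)
      = (Finsupp.lapply j).comp B.repr.toLinearMap := by
    refine B.ext fun i => ?_
    simp only [LinearMap.comp_apply, LinearEquiv.coe_coe, ← h, Basis.repr_self,
      Finsupp.lapply_apply, Finsupp.single_apply, EmbeddingLike.apply_eq_iff_eq]
  exact LinearMap.congr_fun this x

/-- The isomorphism `u` carries one `s`-basis to the other, up to enumeration. -/
def BasisMatches (B : Basis ι Λ (M × (κ → Λ))) (C : Basis ι' Λ (N × (κ' → Λ)))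
    (u : M ≃ₗ[Λ] N) : Prop :=
  ∃ (π : ι ≃ ι') (θ : κ ≃ κ'), ∀ i, C (π i) = stabMap u.toLinearMap θ (B i)

theorem BasisMatches.refl (B : Basis ι Λ (M × (κ → Λ))) :
    BasisMatches B B (LinearEquiv.refl Λ M) :=
  ⟨Equiv.refl _, Equiv.refl _, fun _ => rfl⟩

theorem basisMatches_map (B : Basis ι Λ (M × (κ → Λ))) (f : M ≃ₗ[Λ] N) :
    BasisMatches B (mapBasis B f) f :=
  ⟨Equiv.refl _, Equiv.refl _, fun i => by
    change mapBasis B f i = _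
    rw [mapBasis, Basis.map_apply]
    rfl⟩

theorem BasisMatches.trans {B : Basis ι Λ (M × (κ → Λ))} {C : Basis ι' Λ (N × (κ' → Λ))}
    {D : Basis μ Λ (M' × (ν → Λ))} {u : M ≃ₗ[Λ] N} {v : N ≃ₗ[Λ] M'} (h : BasisMatches B C u)
    (h' : BasisMatches C D v) : BasisMatches B D (u.trans v) := by
  obtain ⟨π, θ, h⟩ := h
  obtain ⟨π', θ', h'⟩ := h'
  refine ⟨π.trans π', θ.trans θ', fun i => ?_⟩
  rw [Equiv.trans_apply, h', h]
  rfl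

theorem BasisMatches.symm {B : Basis ι Λ (M × (κ → Λ))} {C : Basis ι' Λ (N × (κ' → Λ))}
    {u : M ≃ₗ[Λ] N} (h : BasisMatches B C u) : BasisMatches C B u.symm := by
  obtain ⟨π, θ, h⟩ := h
  refine ⟨π.symm, θ.symm, fun i => ?_⟩
  obtain ⟨i, rfl⟩ := π.surjective i
  rw [h]
  simp [stabMap_apply]

theorem BasisMatches.sum {B : Basis ι Λ (M × (κ → Λ))} {C : Basis ι' Λ (N × (κ' → Λ))}
    {B' : Basis μ Λ (M' × (ν → Λ))} {C' : Basis μ' Λ (N' × (ν' → Λ))} {u : M ≃ₗ[Λ] M'}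
    {v : N ≃ₗ[Λ] N'} (h : BasisMatches B B' u) (h' : BasisMatches C C' v) :
    BasisMatches (sumBasis B C) (sumBasis B' C') (u.prodCongr v) := by
  obtain ⟨π, θ, h⟩ := h
  obtain ⟨π', θ', h'⟩ := h'
  refine ⟨Equiv.sumCongr π π', Equiv.sumCongr θ θ', fun i => ?_⟩
  rcases i with i | i
  · rw [Equiv.sumCongr_apply, Sum.map_inl, sumBasis_inl, sumBasis_inl, h]
    simp only [stabMap_apply]
    ext k
    · simp
    · simp
    · rcases k with k | k <;> simp
  · rw [Equiv.sumCongr_apply, Sum.map_inr, sumBasis_inr, sumBasis_inr, h']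
    simp only [stabMap_apply]
    ext k
    · simp
    · simp
    · rcases k with k | k <;> simp

theorem basisMatches_comm (B : Basis ι Λ (M × (κ → Λ))) (C : Basis ι' Λ (N × (κ' → Λ))) :
    BasisMatches (sumBasis B C) (sumBasis C B) (LinearEquiv.prodComm Λ M N) := by
  refine ⟨Equiv.sumComm _ _, Equiv.sumComm _ _, fun i => ?_⟩
  rcases i with i | i <;>
  · simp only [Equiv.sumComm_apply, Sum.swap_inl, Sum.swap_inr, sumBasis_inl, sumBasis_inr,
      stabMap_apply]
    ext k
    · simp
    · simp
    · rcases k with k | k <;> simp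

theorem basisMatches_assoc (B : Basis ι Λ (M × (κ → Λ))) (C : Basis ι' Λ (N × (κ' → Λ)))
    (D : Basis μ Λ (M' × (ν → Λ))) :
    BasisMatches (sumBasis (sumBasis B C) D) (sumBasis B (sumBasis C D))
      (LinearEquiv.prodAssoc Λ M N M') := by
  refine ⟨Equiv.sumAssoc _ _ _, Equiv.sumAssoc _ _ _, fun i => ?_⟩
  rcases i with (i | i) | i <;>
  · simp only [Equiv.sumAssoc_apply_inl_inl, Equiv.sumAssoc_apply_inl_inr,
      Equiv.sumAssoc_apply_inr, sumBasis_inl, sumBasis_inr, stabMap_apply]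
    ext k
    · simp
    · simp
    · simp
    · rcases k with k | k | k <;> simp

theorem basisMatches_comm4 (B : Basis ι Λ (M × (κ → Λ))) (C : Basis ι' Λ (N × (κ' → Λ)))
    (D : Basis μ Λ (M' × (ν → Λ))) (E : Basis μ' Λ (N' × (ν' → Λ))) :
    BasisMatches (sumBasis (sumBasis B C) (sumBasis D E)) (sumBasis (sumBasis B D) (sumBasis C E))
      (LinearEquiv.prodProdProdComm Λ M N M' N') := by
  refine ⟨Equiv.sumSumSumComm _ _ _ _, Equiv.sumSumSumComm _ _ _ _, fun i => ?_⟩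
  rcases i with (i | i) | (i | i)
  · change sumBasis (sumBasis B D) (sumBasis C E) (Sum.inl (Sum.inl i)) = _
    simp only [sumBasis_inl, stabMap_apply]
    ext k
    iterate 4 simp
    rcases k with (k | k) | (k | k) <;> simp
  · change sumBasis (sumBasis B D) (sumBasis C E) (Sum.inr (Sum.inl i)) = _
    simp only [sumBasis_inl, sumBasis_inr, stabMap_apply]
    ext k
    iterate 4 simp
    rcases k with (k | k) | (k | k) <;> simp
  · change sumBasis (sumBasis B D) (sumBasis C E) (Sum.inl (Sum.inr i)) = _
    simp only [sumBasis_inl, sumBasis_inr, stabMap_apply]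
    ext k
    iterate 4 simp
    rcases k with (k | k) | (k | k) <;> simp
  · change sumBasis (sumBasis B D) (sumBasis C E) (Sum.inr (Sum.inr i)) = _
    simp only [sumBasis_inr, stabMap_apply]
    ext k
    iterate 4 simp
    rcases k with (k | k) | (k | k) <;> simp

theorem stabBasis_matching {B : Basis ι Λ (M × (κ → Λ))} {C : Basis ι' Λ (N × (κ' → Λ))}
    {u : M →ₗ[Λ] N} {π : ι ≃ ι'} {θ : κ ≃ κ'} (h : ∀ i, C (π i) = stabMap u θ (B i))
    (α : Type) [Fintype α] [DecidableEq α] (i : ι ⊕ α) :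
    stabBasis C α (Equiv.sumCongr π (Equiv.refl α) i)
      = stabMap u (Equiv.sumCongr θ (Equiv.refl α)) (stabBasis B α i) := by
  rcases i with i | i
  · rw [Equiv.sumCongr_apply, Sum.map_inl, stabBasis_inl, stabBasis_inl, h]
    simp only [stabMap_apply]
    ext k
    · simp
    · rcases k with k | k <;> simp
  · rw [Equiv.sumCongr_apply, Sum.map_inr, stabBasis_inr, stabBasis_inr]
    simp only [stabMap_apply]
    ext k
    · simp
    · rcases k with k | k <;> simp

/-- The interchange `(M ⊕ Λ^{κ ⊔ α}) ⊕ (N ⊕ Λ^{κ' ⊔ β}) → (M ⊕ N) ⊕ Λ^{(κ ⊔ κ') ⊔ (α ⊔ β)}`. -/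
def interchange (M N : Type u) [AddCommGroup M] [Module Λ M] [AddCommGroup N] [Module Λ N]
    (κ α κ' β : Type) : ((M × (κ ⊕ α → Λ)) × (N × (κ' ⊕ β → Λ))) →ₗ[Λ]
      ((M × N) × ((κ ⊕ κ') ⊕ (α ⊕ β) → Λ)) where
  toFun z := ((z.1.1, z.2.1), Sum.elim (Sum.elim (fun k => z.1.2 (Sum.inl k))
    (fun k => z.2.2 (Sum.inl k))) (Sum.elim (fun k => z.1.2 (Sum.inr k))
    (fun k => z.2.2 (Sum.inr k))))
  map_add' z w := by
    ext k
    · rfl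
    · rfl
    · rcases k with (k | k) | (k | k) <;> simp
  map_smul' r z := by
    ext k
    · rfl
    · rfl
    · rcases k with (k | k) | (k | k) <;> simp

theorem interchange_apply (α β : Type) (z : (M × (κ ⊕ α → Λ)) × (N × (κ' ⊕ β → Λ))) :
    interchange M N κ α κ' β z = ((z.1.1, z.2.1), Sum.elim (Sum.elim (fun k => z.1.2 (Sum.inl k))
    (fun k => z.2.2 (Sum.inl k))) (Sum.elim (fun k => z.1.2 (Sum.inr k))
    (fun k => z.2.2 (Sum.inr k)))) := rfl

theorem interchange_basis (B : Basis ι Λ (M × (κ → Λ))) (C : Basis ι' Λ (N × (κ' → Λ)))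
    (α β : Type) [Fintype α] [DecidableEq α] [Fintype β] [DecidableEq β]
    (i : (ι ⊕ α) ⊕ (ι' ⊕ β)) :
    stabBasis (sumBasis B C) (α ⊕ β) (Equiv.sumSumSumComm ι α ι' β i)
      = interchange M N κ α κ' β (((stabBasis B α).prod (stabBasis C β)) i) := by
  rcases i with (i | i) | (i | i)
  · change stabBasis (sumBasis B C) (α ⊕ β) (Sum.inl (Sum.inl i)) = _
    rw [stabBasis_inl, sumBasis_inl, interchange_apply]
    ext k
    · simp [stabBasis_inl]
    · simp
    · rcases k with (k | k) | (k | k) <;> simp [stabBasis_inl]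
  · change stabBasis (sumBasis B C) (α ⊕ β) (Sum.inr (Sum.inl i)) = _
    rw [stabBasis_inr, interchange_apply]
    ext k
    · simp [stabBasis_inr]
    · simp
    · rcases k with (k | k) | (k | k) <;> simp [stabBasis_inr, Pi.single_apply]
  · change stabBasis (sumBasis B C) (α ⊕ β) (Sum.inl (Sum.inr i)) = _
    rw [stabBasis_inl, sumBasis_inr, interchange_apply]
    ext k
    · simp
    · simp [stabBasis_inl]
    · rcases k with (k | k) | (k | k) <;> simp [stabBasis_inl]
  · change stabBasis (sumBasis B C) (α ⊕ β) (Sum.inr (Sum.inr i)) = _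
    rw [stabBasis_inr, interchange_apply]
    ext k
    · simp
    · simp [stabBasis_inr]
    · rcases k with (k | k) | (k | k) <;> simp [stabBasis_inr, Pi.single_apply]

theorem interchange_stabMap (f : M →ₗ[Λ] M') (g : N →ₗ[Λ] N') {α β α' β' : Type}
    (θ : κ ⊕ α ≃ κ' ⊕ β) (θ' : ν ⊕ α' ≃ ν' ⊕ β')
    (z : (M × (κ ⊕ α → Λ)) × (N × (ν ⊕ α' → Λ))) :
    stabMap (f.prodMap g) (((Equiv.sumSumSumComm κ α ν α').symm.trans (Equiv.sumCongr θ θ')).trans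
      (Equiv.sumSumSumComm κ' β ν' β')) (interchange M N κ α ν α' z)
      = interchange M' N' κ' β ν' β' (stabMap f θ z.1, stabMap g θ' z.2) := by
  simp only [stabMap_apply, interchange_apply]
  ext k
  · simp
  · simp
  · rcases k with (k | k) | (k | k) <;> simp
    · rcases θ.symm (Sum.inl k) with l | l <;> simp
    · rcases θ'.symm (Sum.inl k) with l | l <;> simp
    · rcases θ.symm (Sum.inr k) with l | l <;> simp
    · rcases θ'.symm (Sum.inr k) with l | l <;> simp

variable {Z : AddSubgroup (KTilde Λ)}
variable [Fintype ι] [DecidableEq ι] [Fintype ι'] [DecidableEq ι'] [Fintype μ] [DecidableEq μ]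

theorem TorsionIn.conj {B : Basis ι Λ (M × (κ → Λ))} {C : Basis ι' Λ (N × (κ' → Λ))}
    {B' : Basis μ Λ (M' × (ν → Λ))} {C' : Basis μ' Λ (N' × (ν' → Λ))}
    {f : M ≃ₗ[Λ] M'} {u : M ≃ₗ[Λ] N} {v : M' ≃ₗ[Λ] N'} (hf : TorsionIn Z B B' f)
    (hu : BasisMatches B C u) (hv : BasisMatches B' C' v) (g : N ≃ₗ[Λ] N')
    (hg : ∀ x, g (u x) = v (f x)) : TorsionIn Z C C' g := by
  obtain ⟨π, θ, hu⟩ := hu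
  obtain ⟨π', θ', hv⟩ := hv
  obtain ⟨α, β, _, _, _, _, τ, σ, A, hA, hZ⟩ := hf
  let P := Equiv.sumCongr π (Equiv.refl α)
  let T := Equiv.sumCongr θ (Equiv.refl α)
  let P' := Equiv.sumCongr π' (Equiv.refl β)
  let T' := Equiv.sumCongr θ' (Equiv.refl β)
  refine ⟨α, β, inferInstance, inferInstance, inferInstance, inferInstance,
    (T.symm.trans τ).trans T', (P.symm.trans σ).trans P', glReindex P A, ?_, ?_⟩
  · intro i j
    obtain ⟨i, rfl⟩ := P.surjective i
    obtain ⟨j, rfl⟩ := P.surjective j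
    have h1 := stabBasis_matching hu α i
    have h2 := repr_of_matching (stabBasis B' β) (stabBasis C' β) P' _ (stabBasis_matching hv β)
      (stabMap f.toLinearMap τ (stabBasis B α i)) (σ j)
    have h3 : stabMap g.toLinearMap ((T.symm.trans τ).trans T') (stabBasis C α (P i))
        = stabMap v.toLinearMap T' (stabMap f.toLinearMap τ (stabBasis B α i)) := by
      rw [show stabBasis C α (P i) = _ from h1]
      simp only [stabMap_apply, LinearEquiv.coe_coe, hg]
      ext k
      · simp
      · simp [T]
    rw [h3, glReindex_apply]
    simp only [Equiv.symm_apply_apply, Equiv.trans_apply]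
    rw [h2, hA]
  · rwa [KTilde.cls_reindex]

theorem BasisMatches.torsionIn {B : Basis ι Λ (M × (κ → Λ))} {C : Basis ι' Λ (N × (κ' → Λ))}
    {u : M ≃ₗ[Λ] N} (h : BasisMatches B C u) : TorsionIn Z B C u := by
  obtain ⟨π, θ, h⟩ := h
  refine ⟨Empty, Empty, inferInstance, inferInstance, inferInstance, inferInstance,
    Equiv.sumCongr θ (Equiv.refl _), Equiv.sumCongr π (Equiv.refl _), 1, ?_, ?_⟩
  · intro i j
    rw [← stabBasis_matching h, Basis.repr_self, Finsupp.single_apply, Units.val_one,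
      Matrix.one_apply]
    simp only [EmbeddingLike.apply_eq_iff_eq]
  · rw [KTilde.cls_one]
    exact Z.zero_mem

theorem TorsionIn.sum {B : Basis ι Λ (M × (κ → Λ))} {C : Basis ι' Λ (N × (κ' → Λ))}
    {B' : Basis μ Λ (M' × (ν → Λ))} {C' : Basis μ' Λ (N' × (ν' → Λ))}
    {f : M ≃ₗ[Λ] M'} {g : N ≃ₗ[Λ] N'} (hf : TorsionIn Z B B' f) (hg : TorsionIn Z C C' g) :
    TorsionIn Z (sumBasis B C) (sumBasis B' C') (f.prodCongr g) := by
  obtain ⟨α, β, _, _, _, _, θ, σ, A, hA, hZ⟩ := hf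
  obtain ⟨α', β', _, _, _, _, θ', σ', A', hA', hZ'⟩ := hg
  refine ⟨α ⊕ α', β ⊕ β', inferInstance, inferInstance, inferInstance, inferInstance,
    ((Equiv.sumSumSumComm κ α κ' α').symm.trans (Equiv.sumCongr θ θ')).trans
      (Equiv.sumSumSumComm ν β ν' β'),
    ((Equiv.sumSumSumComm ι α ι' α').symm.trans (Equiv.sumCongr σ σ')).trans
      (Equiv.sumSumSumComm μ β μ' β'),
    glReindex (Equiv.sumSumSumComm ι α ι' α') (glSum A A'), ?_, ?_⟩
  · intro i j
    obtain ⟨i, rfl⟩ := (Equiv.sumSumSumComm ι α ι' α').surjective i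
    obtain ⟨j, rfl⟩ := (Equiv.sumSumSumComm ι α ι' α').surjective j
    rw [glReindex_apply, interchange_basis]
    have h := interchange_stabMap f.toLinearMap g.toLinearMap θ θ'
      (((stabBasis B α).prod (stabBasis C α')) i)
    have h' := repr_of_matching _ _ (Equiv.sumSumSumComm μ β μ' β') (interchange M' N' ν β ν' β')
      (interchange_basis B' C' β β') (stabMap f.toLinearMap θ
        (((stabBasis B α).prod (stabBasis C α')) i).1, stabMap g.toLinearMap θ'
        (((stabBasis B α).prod (stabBasis C α')) i).2) (Equiv.sumCongr σ σ' j)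
    simp only [Equiv.symm_apply_apply, Equiv.trans_apply]
    refine Eq.trans ?_ ((congrArg (fun z => (stabBasis (sumBasis B' C') (β ⊕ β')).repr z _)
      h).trans h').symm
    rcases i with i | i <;> rcases j with j | j <;> simp [glSum, hA, hA']
  · rw [KTilde.cls_reindex, KTilde.cls_glSum]
    exact Z.add_mem hZ hZ'

end SimpleFacts

/-! ### Dual modules -/

section Dual

variable (Λ : Type u) [Ring Λ] [StarRing Λ]

/-- The dual `M* = Hom_Λ(M, Λ)`, a left module through `(a f)(x) = f(x) ā`. -/
def Dual (M : Type u) [AddCommGroup M] [Module Λ M] : Type u := M →ₗ[Λ] Λ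

variable {Λ}
variable {M : Type u} [AddCommGroup M] [Module Λ M] {N : Type u} [AddCommGroup N] [Module Λ N]
variable {M' : Type u} [AddCommGroup M'] [Module Λ M']

instance : AddCommGroup (Dual Λ M) := inferInstanceAs (AddCommGroup (M →ₗ[Λ] Λ))

instance : FunLike (Dual Λ M) M Λ := inferInstanceAs (FunLike (M →ₗ[Λ] Λ) M Λ)

instance : LinearMapClass (Dual Λ M) Λ M Λ :=
  inferInstanceAs (LinearMapClass (M →ₗ[Λ] Λ) Λ M Λ)

@[ext] theorem Dual.ext {f g : Dual Λ M} (h : ∀ x, f x = g x) : f = g := DFunLike.ext f g h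

@[simp] theorem Dual.add_apply (f g : Dual Λ M) (x : M) : (f + g) x = f x + g x := rfl
@[simp] theorem Dual.zero_apply (x : M) : (0 : Dual Λ M) x = 0 := rfl
@[simp] theorem Dual.neg_apply (f : Dual Λ M) (x : M) : (-f) x = -f x := rfl
@[simp] theorem Dual.sub_apply (f g : Dual Λ M) (x : M) : (f - g) x = f x - g x := rfl

/-- A linear map as an element of the dual module. -/
def Dual.of (f : M →ₗ[Λ] Λ) : Dual Λ M := f

@[simp] theorem Dual.of_apply (f : M →ₗ[Λ] Λ) (x : M) : Dual.of f x = f x := rfl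

instance : SMul Λ (Dual Λ M) where
  smul a f := Dual.of
    { toFun := fun x => f x * star a
      map_add' := fun x y => by rw [map_add, add_mul]
      map_smul' := fun c x => by simp [mul_assoc] }

@[simp] theorem Dual.smul_apply (a : Λ) (f : Dual Λ M) (x : M) : (a • f) x = f x * star a := rfl

instance : Module Λ (Dual Λ M) where
  one_smul f := by ext; simp
  mul_smul a b f := by ext; simp [mul_assoc]
  smul_zero a := by ext; simp
  smul_add a f g := by ext; simp [add_mul]
  add_smul a b f := by ext; simp [mul_add]
  zero_smul f := by ext; simp

/-- The dual homomorphism `f* : N* → M*`. -/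
def dualMap (f : M →ₗ[Λ] N) : Dual Λ N →ₗ[Λ] Dual Λ M where
  toFun g := Dual.of
    { toFun := fun x => g (f x)
      map_add' := fun x y => by simp
      map_smul' := fun c x => by simp }
  map_add' g h := by ext; simp
  map_smul' c g := by ext; simp

@[simp] theorem dualMap_apply (f : M →ₗ[Λ] N) (g : Dual Λ N) (x : M) :
    dualMap f g x = g (f x) := rfl

/-- The isomorphism of dual modules induced by an isomorphism. -/
def dualEquiv (f : M ≃ₗ[Λ] N) : Dual Λ N ≃ₗ[Λ] Dual Λ M :=
  LinearEquiv.ofLinearMap (dualMap f.toLinearMap) (dualMap f.symm.toLinearMap)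
    (by ext; simp) (by ext; simp)

/-- `M* ⊕ N* = (M ⊕ N)*`. -/
def dualProd (M N : Type u) [AddCommGroup M] [Module Λ M] [AddCommGroup N] [Module Λ N] :
    (Dual Λ M × Dual Λ N) ≃ₗ[Λ] Dual Λ (M × N) :=
  LinearEquiv.ofLinearMap
    ((dualMap (LinearMap.fst Λ M N)).coprod (dualMap (LinearMap.snd Λ M N)))
    ((dualMap (LinearMap.inl Λ M N)).prod (dualMap (LinearMap.inr Λ M N)))
    (by
      ext f x
      simp only [LinearMap.comp_apply, LinearMap.prod_apply, Function.prod, LinearMap.coprod_apply,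
        Dual.add_apply, dualMap_apply, LinearMap.id_apply, ← map_add]
      simp)
    (by ext <;> simp)

@[simp] theorem dualProd_apply (f : Dual Λ M) (g : Dual Λ N) (x : M × N) :
    dualProd M N (f, g) x = f x.1 + g x.2 := rfl

/-- The dual of a finite free module is free: the coordinates of `f` in the dual basis are
`star (f e_i)`. -/
def dualFree {ι : Type} [Fintype ι] [DecidableEq ι] (b : Basis ι Λ M) :
    Dual Λ M ≃ₗ[Λ] (ι → Λ) where
  toFun f i := star (f (b i))
  map_add' f g := by ext; simp
  map_smul' c f := by ext; simp
  invFun v := Dual.of (b.constr ℕ fun i => star (v i))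
  left_inv f := by
    change b.constr ℕ (fun i => star (star (f (b i)))) = (f : M →ₗ[Λ] Λ)
    refine b.ext fun i => ?_
    rw [Basis.constr_basis, star_star]; rfl
  right_inv v := by ext i; simp

/-- The dual basis. -/
def dualBasis {ι : Type} [Fintype ι] [DecidableEq ι] (b : Basis ι Λ M) : Basis ι Λ (Dual Λ M) :=
  Basis.ofEquivFun (dualFree b)

/-- The dual `s`-basis: the dual basis of `(M ⊕ Λ^m)* = M* ⊕ Λ^m`. -/
def dualSBasis {ι κ : Type} [Fintype ι] [DecidableEq ι] [Fintype κ] [DecidableEq κ]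
    (B : Basis ι Λ (M × (κ → Λ))) : Basis ι Λ (Dual Λ M × (κ → Λ)) :=
  (dualBasis B).map ((dualProd M (κ → Λ)).symm.trans
    ((LinearEquiv.refl Λ _).prodCongr (dualFree (Pi.basisFun Λ κ))))

/-- The `s`-basis of the dual module. -/
def SBasis.dual (b : SBasis Λ M) : SBasis Λ (Dual Λ M) where
  idx := b.idx
  stab := b.stab
  basis := dualSBasis b.basis

/-- The dual based module. -/
def BasedModule.dual (P : BasedModule Λ) : BasedModule Λ where
  carrier := Dual Λ P.carrier
  base := P.base.dual

end Dual

section DualFacts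

variable {Λ : Type u} [Ring Λ] [StarRing Λ]
variable {M : Type u} [AddCommGroup M] [Module Λ M] {N : Type u} [AddCommGroup N] [Module Λ N]
variable {ι κ ι' κ' : Type} [Fintype ι] [DecidableEq ι] [Fintype κ] [DecidableEq κ]
  [Fintype ι'] [DecidableEq ι'] [Fintype κ'] [DecidableEq κ']

theorem dualBasis_apply (B : Basis ι Λ M) (i : ι) (x : M) : dualBasis B i x = B.repr x i := by
  have h : (dualFree B).symm (Pi.single i 1) = Dual.of (B.coord i) := by
    rw [LinearEquiv.symm_apply_eq]
    ext j
    simp [dualFree, Finsupp.single_apply, Pi.single_apply, apply_ite star]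
  rw [dualBasis, Basis.coe_ofEquivFun]
  change (dualFree B).symm (Pi.single i 1) x = _
  rw [h]
  rfl

theorem dualSBasis_apply (B : Basis ι Λ (M × (κ → Λ))) (i : ι) :
    dualSBasis B i = (Dual.of ((B.coord i).comp (LinearMap.inl Λ M (κ → Λ))),
      fun k => star (B.repr (0, Pi.single k 1) i)) := by
  ext x
  · simp [dualSBasis, dualProd, dualBasis_apply]
  · simp [dualSBasis, dualProd, dualBasis_apply, dualFree]

theorem BasisMatches.dual {B : Basis ι Λ (M × (κ → Λ))} {C : Basis ι' Λ (N × (κ' → Λ))}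
    {u : M ≃ₗ[Λ] N} (h : BasisMatches B C u) :
    BasisMatches (dualSBasis B) (dualSBasis C) (dualEquiv u).symm := by
  obtain ⟨π, θ, h⟩ := h
  refine ⟨π, θ, fun i => ?_⟩
  have key := repr_of_matching B C π _ h
  simp only [dualSBasis_apply, stabMap_apply]
  refine Prod.ext (Dual.ext fun x => ?_) (funext fun k => ?_)
  · have h := key (u.symm x, 0) i
    simp only [stabMap_apply, LinearEquiv.coe_coe, LinearEquiv.apply_symm_apply] at h
    exact h
  · have h := key (0, Pi.single (θ.symm k) 1) i
    have e : (fun l => (Pi.single (θ.symm k) 1 : κ → Λ) (θ.symm l)) = Pi.single k 1 := by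
      ext l
      simp [Pi.single_apply]
    simp only [stabMap_apply, map_zero, e] at h
    exact congrArg star h

theorem basisMatches_dualProd (B : Basis ι Λ (M × (κ → Λ))) (C : Basis ι' Λ (N × (κ' → Λ))) :
    BasisMatches (sumBasis (dualSBasis B) (dualSBasis C)) (dualSBasis (sumBasis B C))
      (dualProd M N) := by
  refine ⟨Equiv.refl _, Equiv.refl _, fun i => ?_⟩
  have h1 : ∀ (x : M) (y : N) (s : κ → Λ) (t : κ' → Λ) (i : ι),
      (sumBasis B C).repr ((x, y), Sum.elim s t) (Sum.inl i) = B.repr (x, s) i := by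
    intro x y s t i
    simp [sumBasis, sumEquiv, LinearEquiv.trans_symm]
    rfl
  have h2 : ∀ (x : M) (y : N) (s : κ → Λ) (t : κ' → Λ) (i : ι'),
      (sumBasis B C).repr ((x, y), Sum.elim s t) (Sum.inr i) = C.repr (y, t) i := by
    intro x y s t i
    simp [sumBasis, sumEquiv, LinearEquiv.trans_symm]
    rfl
  have e0 : (0 : κ ⊕ κ' → Λ) = Sum.elim (0 : κ → Λ) (0 : κ' → Λ) := by
    ext k; rcases k with k | k <;> rfl
  have e1 : ∀ k : κ, (Pi.single (Sum.inl k) 1 : κ ⊕ κ' → Λ)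
      = Sum.elim (Pi.single k 1 : κ → Λ) (0 : κ' → Λ) := by
    intro k; ext l; rcases l with l | l <;> simp [Pi.single_apply]
  have e2 : ∀ k : κ', (Pi.single (Sum.inr k) 1 : κ ⊕ κ' → Λ)
      = Sum.elim (0 : κ → Λ) (Pi.single k 1 : κ' → Λ) := by
    intro k; ext l; rcases l with l | l <;> simp [Pi.single_apply]
  rcases i with i | i
  · simp only [Equiv.refl_apply, sumBasis_inl, dualSBasis_apply, stabMap_apply]
    refine Prod.ext (Dual.ext fun x => ?_) (funext fun k => ?_)
    · obtain ⟨x, y⟩ := x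
      change (sumBasis B C).repr ((x, y), 0) (Sum.inl i) = B.repr (x, 0) i + 0
      rw [e0, h1, add_zero]
    · rcases k with k | k
      · change star ((sumBasis B C).repr (0, Pi.single (Sum.inl k) 1) (Sum.inl i))
          = star (B.repr (0, Pi.single k 1) i)
        rw [e1, Prod.zero_eq_mk, h1]
      · change star ((sumBasis B C).repr (0, Pi.single (Sum.inr k) 1) (Sum.inl i)) = 0
        rw [e2, Prod.zero_eq_mk, h1, Prod.mk_zero_zero, map_zero, Finsupp.zero_apply, star_zero]
  · simp only [Equiv.refl_apply, sumBasis_inr, dualSBasis_apply, stabMap_apply]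
    refine Prod.ext (Dual.ext fun x => ?_) (funext fun k => ?_)
    · obtain ⟨x, y⟩ := x
      change (sumBasis B C).repr ((x, y), 0) (Sum.inr i) = 0 + C.repr (y, 0) i
      rw [e0, h2, zero_add]
    · rcases k with k | k
      · change star ((sumBasis B C).repr (0, Pi.single (Sum.inl k) 1) (Sum.inr i)) = 0
        rw [e1, Prod.zero_eq_mk, h2, Prod.mk_zero_zero, map_zero, Finsupp.zero_apply, star_zero]
      · change star ((sumBasis B C).repr (0, Pi.single (Sum.inr k) 1) (Sum.inr i))
          = star (C.repr (0, Pi.single k 1) i)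
        rw [e2, Prod.zero_eq_mk, h2]

end DualFacts

section DoubleDual

variable {Λ : Type u} [Ring Λ] [StarRing Λ]
variable {M : Type u} [AddCommGroup M] [Module Λ M] {N : Type u} [AddCommGroup N] [Module Λ N]
variable {ι κ : Type} [Fintype ι] [DecidableEq ι] [Fintype κ] [DecidableEq κ]

/-- The evaluation map `M → M**`, `x ↦ (g ↦ star (g x))`. -/
def evalMap (Λ : Type u) [Ring Λ] [StarRing Λ] (M : Type u) [AddCommGroup M] [Module Λ M] :
    M →ₗ[Λ] Dual Λ (Dual Λ M) where
  toFun x := Dual.of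
    { toFun := fun g => star (g x)
      map_add' := fun g h => by simp
      map_smul' := fun c g => by simp }
  map_add' x y := by ext g; simp
  map_smul' c x := by ext g; simp

@[simp] theorem evalMap_apply (x : M) (g : Dual Λ M) : evalMap Λ M x g = star (g x) := rfl

theorem dualSBasis_repr (B : Basis ι Λ (M × (κ → Λ))) (y : Dual Λ M × (κ → Λ)) (i : ι) :
    (dualSBasis B).repr y i = star (y.1 (B i).1 + ∑ k, (B i).2 k * star (y.2 k)) := by
  have h : (dualSBasis B).repr y i = star (y.1 (B i).1
      + (Pi.basisFun Λ κ).constr ℕ (fun k => star (y.2 k)) (B i).2) := rfl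
  rw [h, Basis.constr_apply_fintype]
  simp

theorem basisMatches_eval (B : Basis ι Λ (M × (κ → Λ))) (e : M ≃ₗ[Λ] Dual Λ (Dual Λ M))
    (he : ∀ x, e x = evalMap Λ M x) : BasisMatches B (dualSBasis (dualSBasis B)) e := by
  refine ⟨Equiv.refl _, Equiv.refl _, fun i => ?_⟩
  rw [dualSBasis_apply, stabMap_apply]
  refine Prod.ext (Dual.ext fun g => ?_) (funext fun k => ?_)
  · change (dualSBasis B).repr (g, 0) i = e (B i).1 g
    rw [he, dualSBasis_repr]
    simp
  · change star ((dualSBasis B).repr (0, Pi.single k 1) i) = (B i).2 k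
    rw [dualSBasis_repr]
    simp [Pi.single_apply, apply_ite star]

theorem evalMap_bijective_of_basis (B : Basis ι Λ M) : Function.Bijective (evalMap Λ M) := by
  have h : (dualFree (dualBasis B)).toLinearMap ∘ₗ evalMap Λ M = B.equivFun.toLinearMap := by
    ext x i
    change star (star (dualBasis B i x)) = _
    rw [star_star, dualBasis_apply]
    rfl
  have h' : ⇑(evalMap Λ M) = (dualFree (dualBasis B)).symm ∘ B.equivFun := by
    ext1 x
    rw [Function.comp_apply, LinearEquiv.eq_symm_apply]
    exact LinearMap.congr_fun h x
  rw [h']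
  exact (LinearEquiv.bijective _).comp (LinearEquiv.bijective _)

theorem evalMap_bijective (B : Basis ι Λ (M × (κ → Λ))) : Function.Bijective (evalMap Λ M) := by
  have hX := evalMap_bijective_of_basis B
  have nat : ∀ {X Y : Type u} [AddCommGroup X] [Module Λ X] [AddCommGroup Y] [Module Λ Y]
      (f : X →ₗ[Λ] Y) (x : X), dualMap (dualMap f) (evalMap Λ X x) = evalMap Λ Y (f x) :=
    fun f x => rfl
  constructor
  · intro x y hxy
    have h := congrArg (dualMap (dualMap (LinearMap.inl Λ M (κ → Λ)))) hxy
    rw [nat, nat] at h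
    exact (Prod.ext_iff.1 (hX.1 h)).1
  · intro F
    obtain ⟨z, hz⟩ := hX.2 (dualMap (dualMap (LinearMap.inl Λ M (κ → Λ))) F)
    refine ⟨z.1, ?_⟩
    have h := congrArg (dualMap (dualMap (LinearMap.fst Λ M (κ → Λ)))) hz
    rw [nat] at h
    exact h

/-- The evaluation isomorphism `M = M**` of a stably free module. -/
def evalEquiv (b : SBasis Λ M) : M ≃ₗ[Λ] Dual Λ (Dual Λ M) :=
  LinearEquiv.ofBijective (evalMap Λ M) (evalMap_bijective b.basis)

end DoubleDual

section Signs

variable {Λ : Type u} [Ring Λ]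
variable {M : Type u} [AddCommGroup M] [Module Λ M]
variable {ι κ : Type} [Fintype ι] [DecidableEq ι] [Fintype κ] [DecidableEq κ]

/-- The matrix of an automorphism with respect to a basis. -/
def glOf (B : Basis ι Λ M) (g : M ≃ₗ[Λ] M) : GLn Λ ι where
  val := Matrix.of fun i j => B.repr (g (B i)) j
  inv := Matrix.of fun i j => B.repr (g.symm (B i)) j
  val_inv := by
    ext i k
    have h := congrArg (fun x => B.repr (g.symm x) k) (B.sum_repr (g (B i)))
    simp only [map_sum, map_smul, Finsupp.coe_finsetSum, Finset.sum_apply, Finsupp.smul_apply,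
      smul_eq_mul, LinearEquiv.symm_apply_apply, Basis.repr_self,
      Finsupp.single_apply] at h
    simpa only [Matrix.mul_apply, Matrix.one_apply, Matrix.of_apply] using h
  inv_val := by
    ext i k
    have h := congrArg (fun x => B.repr (g x) k) (B.sum_repr (g.symm (B i)))
    simp only [map_sum, map_smul, Finsupp.coe_finsetSum, Finset.sum_apply, Finsupp.smul_apply,
      smul_eq_mul, LinearEquiv.apply_symm_apply, Basis.repr_self,
      Finsupp.single_apply] at h
    simpa only [Matrix.mul_apply, Matrix.one_apply, Matrix.of_apply] using h

theorem glOf_apply (B : Basis ι Λ M) (g : M ≃ₗ[Λ] M) (i j : ι) :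
    (glOf B g : Matrix ι ι Λ) i j = B.repr (g (B i)) j := rfl

theorem glOf_trans (B : Basis ι Λ M) (g h : M ≃ₗ[Λ] M) :
    glOf B (g.trans h) = glOf B g * glOf B h := by
  ext i k
  have h := congrArg (fun x => B.repr (h x) k) (B.sum_repr (g (B i)))
  simp only [map_sum, map_smul, Finsupp.coe_finsetSum, Finset.sum_apply, Finsupp.smul_apply,
    smul_eq_mul] at h
  rw [glOf_apply, Units.val_mul, Matrix.mul_apply]
  exact h.symm

/-- Multiplication by a sign. -/
def signEquiv (Λ : Type u) [Ring Λ] (M : Type u) [AddCommGroup M] [Module Λ M] (ε : ℤˣ) :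
    M ≃ₗ[Λ] M :=
  DistribMulAction.toLinearEquiv Λ M ε

theorem signEquiv_apply (ε : ℤˣ) (x : M) : signEquiv Λ M ε x = (ε : ℤ) • x := rfl

theorem cls_glOf_trans (B : Basis ι Λ M) (g h : M ≃ₗ[Λ] M) :
    KTilde.cls (glOf B (g.trans h)) = KTilde.cls (glOf B g) + KTilde.cls (glOf B h) := by
  rw [glOf_trans, KTilde.cls_mul]

/-- The diagonal integral matrix with one sign. -/
def glSign (ε : ℤˣ) (μ : Type) [Fintype μ] [DecidableEq μ] : GLn ℤ μ where
  val := Matrix.diagonal fun _ => (ε : ℤ)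
  inv := Matrix.diagonal fun _ => (ε : ℤ)
  val_inv := by simp [Matrix.diagonal_mul_diagonal, Int.units_coe_mul_self]
  inv_val := by simp [Matrix.diagonal_mul_diagonal, Int.units_coe_mul_self]

/-- Multiplication by three signs on `M ⊕ Λ^κ ⊕ Λ^κ`. -/
def threeSigns (M : Type u) [AddCommGroup M] [Module Λ M] (κ : Type) (a b c : ℤˣ) :
    (M × ((κ → Λ) × (κ → Λ))) ≃ₗ[Λ] (M × ((κ → Λ) × (κ → Λ))) :=
  (signEquiv Λ M a).prodCongr ((signEquiv Λ (κ → Λ) b).prodCongr (signEquiv Λ (κ → Λ) c))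

theorem threeSigns_apply (a b c : ℤˣ) (x : M × ((κ → Λ) × (κ → Λ))) :
    threeSigns M κ a b c x = ((a : ℤ) • x.1, ((b : ℤ) • x.2.1, (c : ℤ) • x.2.2)) := rfl

/-- The stabilised basis of `M ⊕ Λ^κ ⊕ Λ^κ`. -/
def threeBasis (B : Basis ι Λ (M × (κ → Λ))) :
    Basis (ι ⊕ κ) Λ (M × ((κ → Λ) × (κ → Λ))) :=
  (stabBasis B κ).map
    ((LinearEquiv.refl Λ M).prodCongr (LinearEquiv.sumArrowLequivProdArrow κ κ Λ Λ))

theorem threeBasis_inl (B : Basis ι Λ (M × (κ → Λ))) (i : ι) :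
    threeBasis B (Sum.inl i) = ((B i).1, ((B i).2, 0)) := by
  rw [threeBasis, Basis.map_apply, stabBasis_inl]
  rfl

theorem threeBasis_inr (B : Basis ι Λ (M × (κ → Λ))) (a : κ) :
    threeBasis B (Sum.inr a) = (0, (0, Pi.single a 1)) := by
  rw [threeBasis, Basis.map_apply, stabBasis_inr]
  rfl

theorem cls_threeSigns_three (B : Basis ι Λ (M × (κ → Λ))) (ε : ℤˣ) :
    KTilde.cls (glOf (threeBasis B) (threeSigns M κ 1 1 ε)) = 0 := by
  have : glOf (threeBasis B) (threeSigns M κ 1 1 ε)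
      = glMap (Int.castRingHom Λ) (glSum 1 (glSign ε κ)) := by
    ext i j
    rw [glOf_apply]
    rcases i with i | i
    · have h : threeSigns M κ 1 1 ε (threeBasis B (Sum.inl i)) = threeBasis B (Sum.inl i) := by
        rw [threeBasis_inl, threeSigns_apply]
        simp
      rw [h, Basis.repr_self]
      rcases j with j | j <;> simp [glMap, glSum, Finsupp.single_apply, Matrix.one_apply]
    · have h : threeSigns M κ 1 1 ε (threeBasis B (Sum.inr i))
          = (ε : ℤ) • threeBasis B (Sum.inr i) := by
        rw [threeBasis_inr, threeSigns_apply]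
        simp
      rw [h, map_zsmul, Basis.repr_self]
      rcases j with j | j <;>
        simp [glMap, glSum, Finsupp.single_apply, Matrix.diagonal_apply, glSign,
          apply_ite (Int.cast : ℤ → Λ)]
  rw [this, KTilde.cls_int]

theorem cls_threeSigns_onetwo (B : Basis ι Λ (M × (κ → Λ))) (ε : ℤˣ) :
    KTilde.cls (glOf (threeBasis B) (threeSigns M κ ε ε 1)) = 0 := by
  have : glOf (threeBasis B) (threeSigns M κ ε ε 1)
      = glMap (Int.castRingHom Λ) (glSum (glSign ε ι) 1) := by
    ext i j
    rw [glOf_apply]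
    rcases i with i | i
    · have h : threeSigns M κ ε ε 1 (threeBasis B (Sum.inl i))
          = (ε : ℤ) • threeBasis B (Sum.inl i) := by
        rw [threeBasis_inl, threeSigns_apply]
        simp
      rw [h, map_zsmul, Basis.repr_self]
      rcases j with j | j <;>
        simp [glMap, glSum, Finsupp.single_apply, Matrix.diagonal_apply, glSign,
          apply_ite (Int.cast : ℤ → Λ)]
    · have h : threeSigns M κ ε ε 1 (threeBasis B (Sum.inr i)) = threeBasis B (Sum.inr i) := by
        rw [threeBasis_inr, threeSigns_apply]
        simp
      rw [h, Basis.repr_self]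
      rcases j with j | j <;> simp [glMap, glSum, Finsupp.single_apply, Matrix.one_apply]
  rw [this, KTilde.cls_int]

theorem cls_threeSigns_one (B : Basis ι Λ (M × (κ → Λ))) (ε : ℤˣ) :
    KTilde.cls (glOf (threeBasis B) (threeSigns M κ ε 1 1)) = 0 := by
  let S : (M × ((κ → Λ) × (κ → Λ))) ≃ₗ[Λ] (M × ((κ → Λ) × (κ → Λ))) :=
    (LinearEquiv.refl Λ M).prodCongr (LinearEquiv.prodComm Λ (κ → Λ) (κ → Λ))
  have h : (threeSigns M κ 1 1 ε).trans S = S.trans (threeSigns M κ 1 ε 1) :=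
    LinearEquiv.ext fun _ => rfl
  have h' := congrArg (fun g => KTilde.cls (glOf (threeBasis B) g)) h
  simp only [cls_glOf_trans, cls_threeSigns_three, zero_add] at h'
  have h2 : KTilde.cls (glOf (threeBasis B) (threeSigns M κ 1 ε 1)) = 0 :=
    left_eq_add.1 h'
  have h3 : (threeSigns M κ ε 1 1).trans (threeSigns M κ 1 ε 1) = threeSigns (Λ := Λ) M κ ε ε 1 :=
    LinearEquiv.ext fun x => by
      rw [LinearEquiv.trans_apply, threeSigns_apply, threeSigns_apply, threeSigns_apply]
      simp
  have h4 := cls_threeSigns_onetwo B ε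
  rwa [← h3, cls_glOf_trans, h2, add_zero] at h4

theorem torsionIn_sign (Z : AddSubgroup (KTilde Λ)) (B : Basis ι Λ (M × (κ → Λ))) (ε : ℤˣ) :
    TorsionIn Z B B (signEquiv Λ M ε) := by
  refine ⟨κ, κ, inferInstance, inferInstance, inferInstance, inferInstance, Equiv.refl _,
    Equiv.refl _, glOf (threeBasis B) (threeSigns M κ ε 1 1), fun i j => ?_, ?_⟩
  · rw [glOf_apply]
    change (stabBasis B κ).repr _ j = _
    congr 2
    refine Prod.ext rfl (funext fun k => ?_)
    rcases k with k | k <;> exact one_smul ℤ _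
  · rw [cls_threeSigns_one]
    exact Z.zero_mem

end Signs

/-! ### `ε`-quadratic forms -/

section QuadraticGroups

variable {Λ : Type u} [Ring Λ] [StarRing Λ]
variable {M : Type u} [AddCommGroup M] [Module Λ M] {N : Type u} [AddCommGroup N] [Module Λ N]
variable {P : Type u} [AddCommGroup P] [Module Λ P]

/-- The `ε`-duality involution `T_ε` on `Hom_Λ(M, M*)`: `(T_ε φ)(x)(y) = ε · star (φ(y)(x))`. -/
def dualityInv (ε : ℤˣ) (M : Type u) [AddCommGroup M] [Module Λ M] :
    (M →ₗ[Λ] Dual Λ M) →+ (M →ₗ[Λ] Dual Λ M) where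
  toFun φ :=
    { toFun := fun x => Dual.of
        { toFun := fun y => (ε : ℤ) • star (φ y x)
          map_add' := fun y z => by simp
          map_smul' := fun c y => by simp only [map_smul, Dual.smul_apply, star_mul, star_star,
            smul_eq_mul, RingHom.id_apply, mul_smul_comm] }
      map_add' := fun x y => by ext z; simp
      map_smul' := fun c x => by
        ext z
        change (ε : ℤ) • star (φ z (c • x)) = ((ε : ℤ) • star (φ z x)) * star c
        rw [map_smul, smul_eq_mul, star_mul, smul_mul_assoc] }
  map_zero' := by ext x y; simp
  map_add' φ ψ := by ext x y; simp

@[simp] theorem dualityInv_apply (ε : ℤˣ) (φ : M →ₗ[Λ] Dual Λ M) (x y : M) :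
    dualityInv ε M φ x y = (ε : ℤ) • star (φ y x) := rfl

theorem dualityInv_dualityInv (ε : ℤˣ) (φ : M →ₗ[Λ] Dual Λ M) :
    dualityInv ε M (dualityInv ε M φ) = φ := by
  ext x y
  rw [dualityInv_apply, dualityInv_apply, star_zsmul, star_star, smul_smul,
    Int.units_coe_mul_self, one_smul]

/-- `Q_ε(M) = coker (1 - T_ε)`. -/
abbrev QuadGroup (Λ : Type u) [Ring Λ] [StarRing Λ] (ε : ℤˣ) (M : Type u) [AddCommGroup M]
    [Module Λ M] : Type u :=
  (M →ₗ[Λ] Dual Λ M) ⧸ (AddMonoidHom.id (M →ₗ[Λ] Dual Λ M) - dualityInv ε M).range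

/-- The class in `Q_ε(M)` of an asymmetric form. -/
def QuadGroup.mk (ε : ℤˣ) (ρ : M →ₗ[Λ] Dual Λ M) : QuadGroup Λ ε M := QuotientAddGroup.mk ρ

/-- The symmetrisation `1 + T_ε : Q_ε(M) → Hom_Λ(M, M*)`. -/
def QuadGroup.symm (ε : ℤˣ) (M : Type u) [AddCommGroup M] [Module Λ M] :
    QuadGroup Λ ε M →+ (M →ₗ[Λ] Dual Λ M) :=
  QuotientAddGroup.lift _ (AddMonoidHom.id (M →ₗ[Λ] Dual Λ M) + dualityInv ε M) (by
    rintro _ ⟨φ, rfl⟩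
    rw [AddMonoidHom.mem_ker]
    simp [dualityInv_dualityInv])

theorem QuadGroup.symm_mk (ε : ℤˣ) (ρ : M →ₗ[Λ] Dual Λ M) :
    QuadGroup.symm ε M (QuadGroup.mk ε ρ) = ρ + dualityInv ε M ρ := rfl

/-- `ρ ↦ f* ρ f` on asymmetric forms. -/
def pullHom (f : M →ₗ[Λ] N) : (N →ₗ[Λ] Dual Λ N) →+ (M →ₗ[Λ] Dual Λ M) where
  toFun ρ := (dualMap f).comp (ρ.comp f)
  map_zero' := by ext; simp
  map_add' ρ σ := by ext; simp

@[simp] theorem pullHom_apply (f : M →ₗ[Λ] N) (ρ : N →ₗ[Λ] Dual Λ N) (x y : M) :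
    pullHom f ρ x y = ρ (f x) (f y) := rfl

/-- The induced homomorphism `ψ ↦ f* ψ f`, `Q_ε(N) → Q_ε(M)`. -/
def QuadGroup.pull (ε : ℤˣ) (f : M →ₗ[Λ] N) : QuadGroup Λ ε N →+ QuadGroup Λ ε M :=
  QuotientAddGroup.map _ _ (pullHom f) (by
    rintro _ ⟨φ, rfl⟩
    exact ⟨pullHom f φ, by ext x y; simp⟩)

theorem QuadGroup.pull_mk (ε : ℤˣ) (f : M →ₗ[Λ] N) (ρ : N →ₗ[Λ] Dual Λ N) :
    QuadGroup.pull ε f (QuadGroup.mk ε ρ) = QuadGroup.mk ε (pullHom f ρ) := rfl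

theorem QuadGroup.pull_pull (ε : ℤˣ) (f : M →ₗ[Λ] N) (g : N →ₗ[Λ] P) (ψ : QuadGroup Λ ε P) :
    QuadGroup.pull ε f (QuadGroup.pull ε g ψ) = QuadGroup.pull ε (g.comp f) ψ := by
  obtain ⟨ρ, rfl⟩ := QuotientAddGroup.mk_surjective ψ
  rfl

theorem QuadGroup.symm_pull (ε : ℤˣ) (f : M →ₗ[Λ] N) (ψ : QuadGroup Λ ε N) (x y : M) :
    QuadGroup.symm ε M (QuadGroup.pull ε f ψ) x y = QuadGroup.symm ε N ψ (f x) (f y) := by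
  obtain ⟨ρ, rfl⟩ := QuotientAddGroup.mk_surjective ψ
  rfl

/-- The direct sum `ψ ⊕ ψ'` in `Q_ε(M ⊕ N)`. -/
def QuadGroup.sum {ε : ℤˣ} (ψ : QuadGroup Λ ε M) (ψ' : QuadGroup Λ ε N) :
    QuadGroup Λ ε (M × N) :=
  QuadGroup.pull ε (LinearMap.fst Λ M N) ψ + QuadGroup.pull ε (LinearMap.snd Λ M N) ψ'

theorem QuadGroup.symm_sum {ε : ℤˣ} (ψ : QuadGroup Λ ε M) (ψ' : QuadGroup Λ ε N) (x y : M × N) :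
    QuadGroup.symm ε (M × N) (QuadGroup.sum ψ ψ') x y
      = QuadGroup.symm ε M ψ x.1 y.1 + QuadGroup.symm ε N ψ' x.2 y.2 := by
  rw [QuadGroup.sum, map_add, LinearMap.add_apply, Dual.add_apply, QuadGroup.symm_pull,
    QuadGroup.symm_pull]
  rfl

/-- The asymmetric form `((x, f), (y, g)) ↦ f y` on `M ⊕ M*`. -/
def hypHom (Λ : Type u) [Ring Λ] [StarRing Λ] (M : Type u) [AddCommGroup M] [Module Λ M] :
    (M × Dual Λ M) →ₗ[Λ] Dual Λ (M × Dual Λ M) :=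
  (dualMap (LinearMap.fst Λ M (Dual Λ M))).comp (LinearMap.snd Λ M (Dual Λ M))

@[simp] theorem hypHom_apply (x y : M × Dual Λ M) : hypHom Λ M x y = x.2 y.1 := rfl

end QuadraticGroups

section Forms

variable (Λ : Type u) [Ring Λ] [StarRing Λ] (ε : ℤˣ)

/-- An `ε`-quadratic form `(M, ψ)` on a based module. -/
structure QForm where
  mod : BasedModule.{u} Λ
  ψ : QuadGroup Λ ε mod.carrier

variable {Λ ε}

/-- The underlying module of a form. -/
abbrev QForm.carrier (v : QForm Λ ε) : Type u := v.mod.carrier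

/-- The symmetrisation `(1 + T_ε)ψ`. -/
abbrev QForm.symm (v : QForm Λ ε) : v.carrier →ₗ[Λ] Dual Λ v.carrier := QuadGroup.symm ε _ v.ψ

/-- The direct sum of forms. -/
def QForm.sum (v w : QForm Λ ε) : QForm Λ ε where
  mod := v.mod.sum w.mod
  ψ := QuadGroup.sum v.ψ w.ψ

instance : Add (QForm Λ ε) := ⟨QForm.sum⟩

/-- A form is simple if its symmetrisation is a simple isomorphism. -/
def QForm.IsSimple (Z : AddSubgroup (KTilde Λ)) (v : QForm Λ ε) : Prop :=
  ∃ f : v.carrier ≃ₗ[Λ] Dual Λ v.carrier, f.toLinearMap = v.symm ∧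
    SurgeryMonoid.IsSimple Z v.mod.base v.mod.base.dual f

/-- Simple isometries of `ε`-quadratic forms. -/
def QForm.IsSimpleIsometry (Z : AddSubgroup (KTilde Λ)) (v w : QForm Λ ε)
    (f : v.carrier ≃ₗ[Λ] w.carrier) : Prop :=
  QuadGroup.pull ε f.toLinearMap w.ψ = v.ψ ∧ SurgeryMonoid.IsSimple Z v.mod.base w.mod.base f

variable (ε)

/-- The zero form on a based module. -/
def QForm.zero (P : BasedModule.{u} Λ) : QForm Λ ε where
  mod := P
  ψ := 0

/-- The hyperbolic form `H_ε(L) = (L ⊕ L*, (0, id; 0, 0))`. -/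
def QForm.hyp (L : BasedModule.{u} Λ) : QForm Λ ε where
  mod := L.sum L.dual
  ψ := QuadGroup.mk ε (hypHom Λ L.carrier)

/-- The form `(K, [ρ])` of an asymmetric form `(K, ρ)`. -/
def QForm.ofHom (K : BasedModule.{u} Λ) (ρ : K.carrier →ₗ[Λ] Dual Λ K.carrier) : QForm Λ ε where
  mod := K
  ψ := QuadGroup.mk ε ρ

variable {ε}

/-- Two forms `v`, `w` define the same `0`-stabilised form if `v ⊕ (P, 0) ≅ w ⊕ (Q, 0)` for some
based modules `P` and `Q`. -/
def QForm.ZeroStablyIsometric (Z : AddSubgroup (KTilde Λ)) (v w : QForm Λ ε) : Prop :=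
  ∃ (P Q : BasedModule.{u} Λ)
    (f : (v + QForm.zero ε P).carrier ≃ₗ[Λ] (w + QForm.zero ε Q).carrier),
    QForm.IsSimpleIsometry Z (v + QForm.zero ε P) (w + QForm.zero ε Q) f

/-- The monoid `F^{zs}_{2q}(Λ)` of `0`-stabilised forms. (The relation is already a congruence, so
passing to the congruence that it generates adds nothing.) -/
abbrev ZeroStabForms (ε : ℤˣ) (Z : AddSubgroup (KTilde Λ)) : Type (u + 1) :=
  (addConGen (QForm.ZeroStablyIsometric (ε := ε) Z)).Quotient

/-- The `0`-stabilised form `[v]`. -/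
def QForm.cls (Z : AddSubgroup (KTilde Λ)) (v : QForm Λ ε) : ZeroStabForms ε Z := Quotient.mk'' v

variable {Z : AddSubgroup (KTilde Λ)}

theorem QForm.cls_add (v w : QForm Λ ε) : (v + w).cls Z = v.cls Z + w.cls Z := rfl

theorem QForm.cls_eq {v w : QForm Λ ε} (h : v.ZeroStablyIsometric Z w) : v.cls Z = w.cls Z :=
  (AddCon.eq _).2 (AddConGen.Rel.of _ _ h)

/-- The zero module with its empty basis. -/
def BasedModule.zero (Λ : Type u) [Ring Λ] : BasedModule.{u} Λ where
  carrier := PUnit.{u + 1}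
  base := SBasis.ofBasis (Basis.empty PUnit.{u + 1} (ι := Empty))

theorem QForm.zeroStablyIsometric_of {v w : QForm Λ ε} (f : v.carrier ≃ₗ[Λ] w.carrier)
    (hf : QuadGroup.pull ε f.toLinearMap w.ψ = v.ψ)
    (hb : BasisMatches v.mod.base.basis w.mod.base.basis f) : v.ZeroStablyIsometric Z w := by
  refine ⟨BasedModule.zero Λ, BasedModule.zero Λ, f.prodCongr (LinearEquiv.refl Λ _), ?_,
    (hb.sum (BasisMatches.refl _)).torsionIn⟩
  change QuadGroup.pull ε _ (QuadGroup.sum w.ψ 0) = QuadGroup.sum v.ψ 0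
  rw [QuadGroup.sum, QuadGroup.sum, map_zero, map_zero, add_zero, add_zero, ← hf,
    QuadGroup.pull_pull, QuadGroup.pull_pull]
  rfl

theorem QuadGroup.pull_comm {M N : Type u} [AddCommGroup M] [Module Λ M] [AddCommGroup N]
    [Module Λ N] (ψ : QuadGroup Λ ε M) (ψ' : QuadGroup Λ ε N) :
    QuadGroup.pull ε (LinearEquiv.prodComm Λ M N).toLinearMap (QuadGroup.sum ψ' ψ)
      = QuadGroup.sum ψ ψ' := by
  rw [QuadGroup.sum, map_add, QuadGroup.pull_pull, QuadGroup.pull_pull, add_comm]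
  rfl

theorem QuadGroup.pull_assoc {M N P : Type u} [AddCommGroup M] [Module Λ M] [AddCommGroup N]
    [Module Λ N] [AddCommGroup P] [Module Λ P] (ψ : QuadGroup Λ ε M) (ψ' : QuadGroup Λ ε N)
    (ψ'' : QuadGroup Λ ε P) :
    QuadGroup.pull ε (LinearEquiv.prodAssoc Λ M N P).toLinearMap
      (QuadGroup.sum ψ (QuadGroup.sum ψ' ψ'')) = QuadGroup.sum (QuadGroup.sum ψ ψ') ψ'' := by
  simp only [QuadGroup.sum, map_add, QuadGroup.pull_pull, add_assoc]
  rfl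

/-- The reordering `(N ⊕ M) ⊕ P = M ⊕ (P ⊕ N)`. -/
def shiftEquiv (Λ : Type u) [Ring Λ] (N M P : Type u) [AddCommGroup M] [Module Λ M]
    [AddCommGroup N] [Module Λ N] [AddCommGroup P] [Module Λ P] :
    ((N × M) × P) ≃ₗ[Λ] (M × (P × N)) :=
  (LinearEquiv.prodAssoc Λ N M P).trans ((LinearEquiv.prodComm Λ N (M × P)).trans
    (LinearEquiv.prodAssoc Λ M P N))

theorem basisMatches_shift {M N P : Type u} [AddCommGroup M] [Module Λ M] [AddCommGroup N]
    [Module Λ N] [AddCommGroup P] [Module Λ P] {ι κ ι' κ' μ ν : Type}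
    (B : Basis ι Λ (N × (κ → Λ))) (C : Basis ι' Λ (M × (κ' → Λ))) (D : Basis μ Λ (P × (ν → Λ))) :
    BasisMatches (sumBasis (sumBasis B C) D) (sumBasis C (sumBasis D B))
      (shiftEquiv Λ N M P) :=
  (basisMatches_assoc _ _ _).trans ((basisMatches_comm _ _).trans (basisMatches_assoc _ _ _))

theorem QuadGroup.pull_shift {M N P : Type u} [AddCommGroup M] [Module Λ M] [AddCommGroup N]
    [Module Λ N] [AddCommGroup P] [Module Λ P] (ψ : QuadGroup Λ ε N) (ψ' : QuadGroup Λ ε M)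
    (ψ'' : QuadGroup Λ ε P) :
    QuadGroup.pull ε (shiftEquiv Λ N M P).toLinearMap
      (QuadGroup.sum ψ' (QuadGroup.sum ψ'' ψ)) = QuadGroup.sum (QuadGroup.sum ψ ψ') ψ'' := by
  simp only [QuadGroup.sum, map_add, QuadGroup.pull_pull]
  rw [← add_assoc, add_comm, ← add_assoc]
  rfl

instance : Zero (ZeroStabForms ε Z) := ⟨(QForm.zero ε (BasedModule.zero Λ)).cls Z⟩

/-- Addition in `F^{zs}_{2q}(Λ)` is induced by the direct sum; the unit is the class of a zero
form. -/
instance : AddCommMonoid (ZeroStabForms ε Z) :=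
  have zero_add : ∀ x : ZeroStabForms ε Z, 0 + x = x := by
    intro x
    induction x using Quotient.inductionOn' with | h v => ?_
    change (QForm.zero ε (BasedModule.zero Λ) + v).cls Z = v.cls Z
    refine QForm.cls_eq ⟨BasedModule.zero Λ, (BasedModule.zero Λ).sum (BasedModule.zero Λ),
      shiftEquiv Λ _ _ _, ?_, (basisMatches_shift _ _ _).torsionIn⟩
    have h := QuadGroup.pull_shift (ε := ε) (0 : QuadGroup Λ ε (BasedModule.zero Λ).carrier) v.ψ
      (0 : QuadGroup Λ ε (BasedModule.zero Λ).carrier)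
    have h0 : QuadGroup.sum (0 : QuadGroup Λ ε (BasedModule.zero Λ).carrier)
        (0 : QuadGroup Λ ε (BasedModule.zero Λ).carrier) = 0 := by
      rw [QuadGroup.sum, map_zero, map_zero, add_zero]
    rw [h0] at h
    exact h
  have add_comm : ∀ x y : ZeroStabForms ε Z, x + y = y + x := by
    intro x y
    induction x using Quotient.inductionOn' with | h v => ?_
    induction y using Quotient.inductionOn' with | h w => ?_
    exact QForm.cls_eq (QForm.zeroStablyIsometric_of (v := v + w) (w := w + v)
      (LinearEquiv.prodComm Λ _ _) (QuadGroup.pull_comm _ _) (basisMatches_comm _ _))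
  { add_assoc := by
      intro x y z
      induction x using Quotient.inductionOn' with | h v => ?_
      induction y using Quotient.inductionOn' with | h w => ?_
      induction z using Quotient.inductionOn' with | h t => ?_
      exact QForm.cls_eq (QForm.zeroStablyIsometric_of (v := v + w + t) (w := v + (w + t))
        (LinearEquiv.prodAssoc Λ _ _ _) (QuadGroup.pull_assoc _ _ _) (basisMatches_assoc _ _ _))
    zero_add := zero_add
    add_zero := fun x => (add_comm x _).trans (zero_add x)
    add_comm := add_comm
    nsmul := nsmulRec }

end Forms

/-! ### Quasi-formations -/

section Lagrangians

variable {Λ : Type u} [Ring Λ] [StarRing Λ] {ε : ℤˣ}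
variable {M : Type u} [AddCommGroup M] [Module Λ M] {N : Type u} [AddCommGroup N] [Module Λ N]

/-- The annihilator `L^⊥ = ker (j* (1 + T_ε)ψ : M → L*)` of a submodule `j : L → M`. -/
def annihilator (ψ : QuadGroup Λ ε M) (L : Submodule Λ M) : Submodule Λ M :=
  LinearMap.ker ((dualMap L.subtype).comp (QuadGroup.symm ε M ψ))

theorem mem_annihilator (ψ : QuadGroup Λ ε M) (L : Submodule Λ M) (x : M) :
    x ∈ annihilator ψ L ↔ ∀ y ∈ L, QuadGroup.symm ε M ψ x y = 0 := by
  rw [annihilator, LinearMap.mem_ker]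
  refine ⟨fun h y hy => ?_, fun h => Dual.ext fun y => h y y.2⟩
  exact congrArg (fun g : Dual Λ L => g ⟨y, hy⟩) h

/-- A simple Lagrangian of a form `(M, ψ)` on a module with preferred `s`-basis `b`: a direct
summand `L = L^⊥` with a preferred `s`-basis such that `j* ψ j = 0` and such that the Hamiltonian
`s`-basis defined by `L` is a preferred `s`-basis of `M`. The Hamiltonian `s`-basis comes from an
identification `h : L ⊕ L* ≅ M` which splits the exact sequence `0 → L → M → L* → 0`. Two
splittings differ by a unipotent automorphism of `L ⊕ L*`, whose torsion vanishes, so it does not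
matter which one is used. -/
structure SimpleLagrangian (Z : AddSubgroup (KTilde Λ)) (b : SBasis Λ M)
    (ψ : QuadGroup Λ ε M) where
  sub : Submodule Λ M
  base : SBasis Λ sub
  summand : ∃ W : Submodule Λ M, IsCompl sub W
  eq_annihilator : sub = annihilator ψ sub
  isotropic : QuadGroup.pull ε sub.subtype ψ = 0
  hamiltonian : ∃ h : (sub × Dual Λ sub) ≃ₗ[Λ] M,
    (∀ x : sub, h (x, 0) = x) ∧
    (∀ f : Dual Λ sub, dualMap sub.subtype (QuadGroup.symm ε M ψ (h (0, f))) = f) ∧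
    IsSimple Z (base.sum base.dual) b h

/-- A based direct summand of half rank. -/
structure HalfSummand (b : SBasis Λ M) where
  sub : Submodule Λ M
  base : SBasis Λ sub
  summand : ∃ W : Submodule Λ M, IsCompl sub W
  half_rank : 2 * base.rank = b.rank

variable {Z : AddSubgroup (KTilde Λ)}

theorem IsSimple.rank_eq {b : SBasis Λ M} {c : SBasis Λ N} {f : M ≃ₗ[Λ] N}
    (h : IsSimple Z b c f) : b.rank = c.rank := by
  obtain ⟨α, β, _, _, _, _, θ, σ, -⟩ := h
  have h1 := Fintype.card_congr θ
  have h2 := Fintype.card_congr σ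
  simp only [Fintype.card_sum] at h1 h2
  simp only [SBasis.rank]
  omega

theorem SBasis.rank_sum (b : SBasis Λ M) (c : SBasis Λ N) :
    (b.sum c).rank = b.rank + c.rank := by
  have h1 : Fintype.card (b.sum c).idx = Fintype.card b.idx + Fintype.card c.idx :=
    Fintype.card_sum
  have h2 : Fintype.card (b.sum c).stab = Fintype.card b.stab + Fintype.card c.stab :=
    Fintype.card_sum
  simp only [SBasis.rank, h1, h2]
  push_cast
  ring

theorem SBasis.rank_dual (b : SBasis Λ M) : b.dual.rank = b.rank := rfl

theorem SBasis.rank_map (b : SBasis Λ M) (f : M ≃ₗ[Λ] N) : (b.map f).rank = b.rank := rfl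

/-- A simple Lagrangian is a half rank direct summand. -/
def SimpleLagrangian.toHalf {b : SBasis Λ M} {ψ : QuadGroup Λ ε M} (L : SimpleLagrangian Z b ψ) :
    HalfSummand b where
  sub := L.sub
  base := L.base
  summand := L.summand
  half_rank := by
    obtain ⟨h, -, -, hs⟩ := L.hamiltonian
    have := hs.rank_eq
    rw [SBasis.rank_sum, SBasis.rank_dual] at this
    omega

/-- `L ⊕ L'` as a submodule of `M ⊕ N`. -/
def prodSub (L : Submodule Λ M) (L' : Submodule Λ N) : (L × L') ≃ₗ[Λ] (L.prod L') where
  toFun x := ⟨(x.1, x.2), x.1.2, x.2.2⟩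
  map_add' _ _ := rfl
  map_smul' _ _ := rfl
  invFun x := (⟨x.1.1, x.2.1⟩, ⟨x.1.2, x.2.2⟩)
  left_inv _ := rfl
  right_inv _ := rfl

theorem isCompl_prod {L W : Submodule Λ M} {L' W' : Submodule Λ N} (h : IsCompl L W)
    (h' : IsCompl L' W') : IsCompl (L.prod L') (W.prod W') := by
  constructor
  · rw [disjoint_iff, Submodule.prod_inf_prod, h.inf_eq_bot, h'.inf_eq_bot, Submodule.prod_bot]
  · rw [codisjoint_iff, Submodule.prod_sup_prod, h.sup_eq_top, h'.sup_eq_top, Submodule.prod_top]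

/-- The direct sum of half rank summands. -/
def HalfSummand.sum {b : SBasis Λ M} {c : SBasis Λ N} (V : HalfSummand b) (W : HalfSummand c) :
    HalfSummand (b.sum c) where
  sub := V.sub.prod W.sub
  base := (V.base.sum W.base).map (prodSub V.sub W.sub)
  summand := by
    obtain ⟨A, hA⟩ := V.summand
    obtain ⟨B, hB⟩ := W.summand
    exact ⟨A.prod B, isCompl_prod hA hB⟩
  half_rank := by
    have h1 := V.half_rank
    have h2 := W.half_rank
    rw [SBasis.rank_sum, SBasis.rank_map, SBasis.rank_sum]
    omega

/-- The direct sum of simple Lagrangians. -/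
def SimpleLagrangian.sum {b : SBasis Λ M} {ψ : QuadGroup Λ ε M} {c : SBasis Λ N}
    {χ : QuadGroup Λ ε N} (L : SimpleLagrangian Z b ψ) (K : SimpleLagrangian Z c χ) :
    SimpleLagrangian Z (b.sum c) (QuadGroup.sum ψ χ) where
  sub := L.sub.prod K.sub
  base := (L.base.sum K.base).map (prodSub L.sub K.sub)
  summand := by
    obtain ⟨A, hA⟩ := L.summand
    obtain ⟨B, hB⟩ := K.summand
    exact ⟨A.prod B, isCompl_prod hA hB⟩
  eq_annihilator := by
    ext x
    rw [mem_annihilator]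
    have hL : ∀ z, z ∈ L.sub ↔ ∀ y ∈ L.sub, QuadGroup.symm ε M ψ z y = 0 := fun z => by
      rw [← mem_annihilator, ← L.eq_annihilator]
    have hK : ∀ z, z ∈ K.sub ↔ ∀ y ∈ K.sub, QuadGroup.symm ε N χ z y = 0 := fun z => by
      rw [← mem_annihilator, ← K.eq_annihilator]
    constructor
    · rintro ⟨h1, h2⟩ y ⟨h3, h4⟩
      rw [QuadGroup.symm_sum, (hL _).1 h1 _ h3, (hK _).1 h2 _ h4, add_zero]
    · intro h
      refine ⟨(hL _).2 fun y hy => ?_, (hK _).2 fun y hy => ?_⟩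
      · have := h (y, 0) ⟨hy, K.sub.zero_mem⟩
        rw [QuadGroup.symm_sum] at this
        simpa using this
      · have := h (0, y) ⟨L.sub.zero_mem, hy⟩
        rw [QuadGroup.symm_sum] at this
        simpa using this
  isotropic := by
    have h1 := congrArg (QuadGroup.pull ε ((LinearMap.fst Λ L.sub K.sub).comp
      (prodSub L.sub K.sub).symm.toLinearMap)) L.isotropic
    have h2 := congrArg (QuadGroup.pull ε ((LinearMap.snd Λ L.sub K.sub).comp
      (prodSub L.sub K.sub).symm.toLinearMap)) K.isotropic
    rw [QuadGroup.pull_pull, map_zero] at h1 h2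
    rw [QuadGroup.sum, map_add, QuadGroup.pull_pull, QuadGroup.pull_pull]
    exact (congrArg₂ (· + ·) h1 h2).trans (add_zero 0)
  hamiltonian := by
    obtain ⟨h, h1, h2, h3⟩ := L.hamiltonian
    obtain ⟨k, k1, k2, k3⟩ := K.hamiltonian
    let H := (((prodSub L.sub K.sub).symm.prodCongr ((dualEquiv (prodSub L.sub K.sub)).trans
      (dualProd L.sub K.sub).symm)).trans (LinearEquiv.prodProdProdComm Λ L.sub K.sub
        (Dual Λ L.sub) (Dual Λ K.sub))).trans (h.prodCongr k)
    refine ⟨H, ?_, ?_, ?_⟩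
    · intro x
      exact Prod.ext (h1 ⟨x.1.1, x.2.1⟩) (k1 ⟨x.1.2, x.2.2⟩)
    · intro f
      refine Dual.ext fun y => ?_
      obtain ⟨⟨y1, y2⟩, hy1, hy2⟩ := y
      change QuadGroup.symm ε (M × N) (QuadGroup.sum ψ χ) (H (0, f)) (y1, y2) = _
      rw [QuadGroup.symm_sum]
      have e1 := congrArg (fun g : Dual Λ L.sub => g ⟨y1, hy1⟩)
        (h2 (dualMap (LinearMap.inl Λ L.sub K.sub) (dualEquiv (prodSub L.sub K.sub) f)))
      have e2 := congrArg (fun g : Dual Λ K.sub => g ⟨y2, hy2⟩)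
        (k2 (dualMap (LinearMap.inr Λ L.sub K.sub) (dualEquiv (prodSub L.sub K.sub) f)))
      refine (congrArg₂ (· + ·) e1 e2).trans ?_
      change f (prodSub L.sub K.sub (⟨y1, hy1⟩, 0)) + f (prodSub L.sub K.sub (0, ⟨y2, hy2⟩)) = _
      rw [← map_add, ← map_add, Prod.mk_add_mk, add_zero, zero_add]
      rfl
    · have hm := basisMatches_map (sumBasis L.base.basis K.base.basis) (prodSub L.sub K.sub)
      have hd := (basisMatches_dualProd L.base.basis K.base.basis).trans hm.dual
      have hh := (basisMatches_comm4 L.base.basis (dualSBasis L.base.basis) K.base.basis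
        (dualSBasis K.base.basis)).trans (hm.sum hd)
      refine TorsionIn.conj (TorsionIn.sum h3 k3) hh (BasisMatches.refl _) H ?_
      intro x
      obtain ⟨⟨x1, x2⟩, ⟨x3, x4⟩⟩ := x
      change (h (x1, _), k (x3, _)) = (h (x1, x2), k (x3, x4))
      have e : (dualProd L.sub K.sub).symm (dualEquiv (prodSub L.sub K.sub)
        ((dualEquiv (prodSub L.sub K.sub)).symm (dualProd L.sub K.sub (x2, x4)))) = (x2, x4) := by
        rw [LinearEquiv.apply_symm_apply, LinearEquiv.symm_apply_apply]
      exact congrArg₂ (fun a b => (h (x1, a), k (x3, b))) (congrArg Prod.fst e)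
        (congrArg Prod.snd e)

end Lagrangians

section Hyperbolic

variable {Λ : Type u} [Ring Λ] [StarRing Λ] (ε : ℤˣ)
variable {M : Type u} [AddCommGroup M] [Module Λ M] {N : Type u} [AddCommGroup N] [Module Λ N]

theorem symm_hyp (x y : M × Dual Λ M) :
    QuadGroup.symm ε _ (QuadGroup.mk ε (hypHom Λ M)) x y = x.2 y.1 + (ε : ℤ) • star (y.2 x.1) :=
  rfl

/-- The image of a based module under an injective homomorphism, with the `s`-basis carried over. -/
def rangeBase (b : SBasis Λ N) (f : N →ₗ[Λ] M) (hf : Function.Injective f) :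
    SBasis Λ (LinearMap.range f) :=
  b.map (LinearEquiv.ofInjective f hf)

theorem isCompl_inl_inr : IsCompl (LinearMap.range (LinearMap.inl Λ M N))
    (LinearMap.range (LinearMap.inr Λ M N)) :=
  LinearMap.isCompl_range_inl_inr

variable (Z : AddSubgroup (KTilde Λ)) (b : SBasis Λ M)

theorem hyp_isSimple (P : BasedModule.{u} Λ) : (QForm.hyp ε P).IsSimple Z := by
  let b := P.base
  let f1 := (signEquiv Λ P.carrier ε).prodCongr (LinearEquiv.refl Λ (Dual Λ P.carrier))
  let v := ((LinearEquiv.prodComm Λ P.carrier (Dual Λ P.carrier)).trans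
    ((LinearEquiv.refl Λ (Dual Λ P.carrier)).prodCongr (evalEquiv b))).trans
    (dualProd P.carrier (Dual Λ P.carrier))
  have h1 : TorsionIn Z (sumBasis b.basis (dualSBasis b.basis))
      (sumBasis b.basis (dualSBasis b.basis)) f1 :=
    TorsionIn.sum (torsionIn_sign Z b.basis ε) (BasisMatches.refl _).torsionIn
  have hv : BasisMatches (sumBasis b.basis (dualSBasis b.basis))
      (dualSBasis (sumBasis b.basis (dualSBasis b.basis))) v :=
    ((basisMatches_comm _ _).trans ((BasisMatches.refl _).sum
      (basisMatches_eval b.basis (evalEquiv b) fun _ => rfl))).trans (basisMatches_dualProd _ _)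
  refine ⟨f1.trans v, ?_, TorsionIn.conj h1 (BasisMatches.refl _) hv (f1.trans v) fun _ => rfl⟩
  refine LinearMap.ext fun x => Dual.ext fun y => ?_
  obtain ⟨x, (f : Dual Λ P.carrier)⟩ := x
  obtain ⟨y, (g : Dual Λ P.carrier)⟩ := y
  change f y + star (g (signEquiv Λ P.carrier ε x)) = f y + (ε : ℤ) • star (g x)
  rw [signEquiv_apply, map_zsmul, star_zsmul]

/-- The simple Lagrangian `P` of `H_ε(P) = P ⊕ P*`. -/
def hypLagrangian : SimpleLagrangian Z (b.sum b.dual) (QuadGroup.mk ε (hypHom Λ M)) where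
  sub := LinearMap.range (LinearMap.inl Λ M (Dual Λ M))
  base := rangeBase b (LinearMap.inl Λ M (Dual Λ M)) LinearMap.inl_injective
  summand := ⟨_, isCompl_inl_inr⟩
  eq_annihilator := by
    ext ⟨x, f⟩
    rw [mem_annihilator]
    constructor
    · rintro ⟨x', hx⟩ _ ⟨y, rfl⟩
      have hf : f = 0 := (congrArg Prod.snd hx).symm
      rw [symm_hyp, hf]
      simp
    · intro h
      refine ⟨x, Prod.ext rfl (Dual.ext fun y => ?_)⟩
      have := h (y, 0) ⟨y, rfl⟩
      rw [symm_hyp] at this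
      simpa using this.symm
  isotropic := by
    rw [QuadGroup.pull_mk]
    have : pullHom (LinearMap.range (LinearMap.inl Λ M (Dual Λ M))).subtype (hypHom Λ M) = 0 := by
      refine LinearMap.ext fun x => Dual.ext fun y => ?_
      obtain ⟨_, x, rfl⟩ := x
      rfl
    rw [this]
    rfl
  hamiltonian := by
    let e := LinearEquiv.ofInjective (LinearMap.inl Λ M (Dual Λ M)) LinearMap.inl_injective
    have hm : BasisMatches b.basis (mapBasis b.basis e) e := basisMatches_map b.basis e
    refine ⟨e.symm.prodCongr (dualEquiv e), ?_, ?_, ?_⟩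
    · intro x
      obtain ⟨x, rfl⟩ := e.surjective x
      exact Prod.ext (e.symm_apply_apply x) (map_zero (dualEquiv e))
    · intro f
      refine Dual.ext fun y => ?_
      obtain ⟨y, rfl⟩ := e.surjective y
      change f (e y) + (ε : ℤ) • star ((0 : Dual Λ M) (e.symm 0)) = f (e y)
      simp
    · exact (hm.symm.sum hm.dual.symm).torsionIn

/-- The half rank summand `P*` of `H_ε(P) = P ⊕ P*`. -/
def hypDual : HalfSummand (b.sum b.dual) where
  sub := LinearMap.range (LinearMap.inr Λ M (Dual Λ M))
  base := rangeBase b.dual (LinearMap.inr Λ M (Dual Λ M)) LinearMap.inr_injective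
  summand := ⟨_, isCompl_inl_inr.symm⟩
  half_rank := by
    change 2 * b.rank = _
    rw [SBasis.rank_sum, SBasis.rank_dual]
    ring

/-- The graph `{(x, ρ x)} ⊆ K ⊕ K*` of an asymmetric form `(K, ρ)`, based by `K`. -/
def hypGraph (ρ : M →ₗ[Λ] Dual Λ M) : HalfSummand (b.sum b.dual) where
  sub := LinearMap.range (LinearMap.id.prod ρ)
  base := rangeBase b (LinearMap.id.prod ρ) fun _ _ h => congrArg Prod.fst h
  summand := by
    refine ⟨LinearMap.range (LinearMap.inr Λ M (Dual Λ M)), ?_, ?_⟩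
    · rw [Submodule.disjoint_def]
      rintro _ ⟨x, rfl⟩ ⟨y, hy⟩
      have h : (0 : M) = x := congrArg Prod.fst hy
      rw [← h, map_zero]
    · rw [codisjoint_iff, eq_top_iff]
      rintro ⟨x, f⟩ -
      refine Submodule.mem_sup.2 ⟨_, ⟨x, rfl⟩, _, ⟨f - ρ x, rfl⟩, ?_⟩
      exact Prod.ext (add_zero x) (add_sub_cancel (ρ x) f)
  half_rank := by
    change 2 * b.rank = _
    rw [SBasis.rank_sum, SBasis.rank_dual]
    ring

end Hyperbolic

section SubMatches

variable {Λ : Type u} [Ring Λ]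
variable {M : Type u} [AddCommGroup M] [Module Λ M] {N : Type u} [AddCommGroup N] [Module Λ N]
variable {P : Type u} [AddCommGroup P] [Module Λ P]
variable {M' : Type u} [AddCommGroup M'] [Module Λ M'] {N' : Type u} [AddCommGroup N']
  [Module Λ N']

/-- The isomorphism `f` carries one based submodule to the other, including the bases. -/
def SubMatches {L : Submodule Λ M} (b : SBasis Λ L) {L' : Submodule Λ M'} (b' : SBasis Λ L')
    (f : M ≃ₗ[Λ] M') : Prop :=
  ∃ g : L ≃ₗ[Λ] L', (∀ x : L, (g x : M') = f x) ∧ BasisMatches b.basis b'.basis g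

/-- The `s`-basis of `L ⊕ L' ⊆ M ⊕ N`. -/
def prodBase {L : Submodule Λ M} (b : SBasis Λ L) {L' : Submodule Λ N} (b' : SBasis Λ L') :
    SBasis Λ (L.prod L') :=
  (b.sum b').map (prodSub L L')

theorem prodBase_matches {L : Submodule Λ M} (b : SBasis Λ L) {L' : Submodule Λ N}
    (b' : SBasis Λ L') :
    BasisMatches (sumBasis b.basis b'.basis) (prodBase b b').basis (prodSub L L') :=
  basisMatches_map _ _

theorem SubMatches.refl {L : Submodule Λ M} (b : SBasis Λ L) :
    SubMatches b b (LinearEquiv.refl Λ M) :=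
  ⟨LinearEquiv.refl Λ L, fun _ => rfl, BasisMatches.refl _⟩

theorem SubMatches.sum {L : Submodule Λ M} {b : SBasis Λ L} {L' : Submodule Λ M'}
    {b' : SBasis Λ L'} {f : M ≃ₗ[Λ] M'} (h : SubMatches b b' f) {K : Submodule Λ N}
    {c : SBasis Λ K} {K' : Submodule Λ N'} {c' : SBasis Λ K'} {f' : N ≃ₗ[Λ] N'}
    (h' : SubMatches c c' f') : SubMatches (prodBase b c) (prodBase b' c') (f.prodCongr f') := by
  obtain ⟨g, hg, hb⟩ := h
  obtain ⟨g', hg', hb'⟩ := h'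
  refine ⟨(prodSub L K).symm.trans ((g.prodCongr g').trans (prodSub L' K')), fun x => ?_,
    (prodBase_matches b c).symm.trans ((hb.sum hb').trans (prodBase_matches b' c'))⟩
  exact Prod.ext (hg _) (hg' _)

theorem SubMatches.trans {L : Submodule Λ M} {b : SBasis Λ L} {L' : Submodule Λ M'}
    {b' : SBasis Λ L'} {f : M ≃ₗ[Λ] M'} (h : SubMatches b b' f) {K : Submodule Λ N}
    {c : SBasis Λ K} {f' : M' ≃ₗ[Λ] N} (h' : SubMatches b' c f') :
    SubMatches b c (f.trans f') := by
  obtain ⟨g, hg, hb⟩ := h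
  obtain ⟨g', hg', hb'⟩ := h'
  refine ⟨g.trans g', fun x => ?_, hb.trans hb'⟩
  rw [LinearEquiv.trans_apply, hg', hg, LinearEquiv.trans_apply]

theorem subMatches_comm {L : Submodule Λ M} (b : SBasis Λ L) {K : Submodule Λ N}
    (c : SBasis Λ K) : SubMatches (prodBase b c) (prodBase c b) (LinearEquiv.prodComm Λ M N) :=
  ⟨(prodSub L K).symm.trans ((LinearEquiv.prodComm Λ L K).trans (prodSub K L)), fun _ => rfl,
    (prodBase_matches b c).symm.trans ((basisMatches_comm _ _).trans (prodBase_matches c b))⟩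

theorem subMatches_assoc {L : Submodule Λ M} (b : SBasis Λ L) {K : Submodule Λ N}
    (c : SBasis Λ K) {J : Submodule Λ P} (d : SBasis Λ J) :
    SubMatches (prodBase (prodBase b c) d) (prodBase b (prodBase c d))
      (LinearEquiv.prodAssoc Λ M N P) :=
  ⟨(prodSub (L.prod K) J).symm.trans ((((prodSub L K).symm.prodCongr (LinearEquiv.refl Λ J)).trans
    ((LinearEquiv.prodAssoc Λ L K J).trans ((LinearEquiv.refl Λ L).prodCongr (prodSub K J)))).trans
      (prodSub L (K.prod J))), fun _ => rfl,
    (prodBase_matches _ d).symm.trans ((((prodBase_matches b c).symm.sum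
      (BasisMatches.refl _)).trans ((basisMatches_assoc _ _ _).trans
        ((BasisMatches.refl _).sum (prodBase_matches c d)))).trans (prodBase_matches b _))⟩

theorem subMatches_range {P' : Type u} [AddCommGroup P'] [Module Λ P'] {b : SBasis Λ P}
    {c : SBasis Λ P'} {j : P →ₗ[Λ] M} (hj : Function.Injective j) {k : P' →ₗ[Λ] N}
    (hk : Function.Injective k) {Q : Type u} [AddCommGroup Q] [Module Λ Q] {d : SBasis Λ Q}
    {l : Q →ₗ[Λ] M'} (hl : Function.Injective l) (f : (M × N) ≃ₗ[Λ] M') (e : (P × P') ≃ₗ[Λ] Q)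
    (h : ∀ x y, f (j x, k y) = l (e (x, y)))
    (hb : BasisMatches (sumBasis b.basis c.basis) d.basis e) :
    SubMatches (prodBase (rangeBase b j hj) (rangeBase c k hk)) (rangeBase d l hl) f := by
  let ej := LinearEquiv.ofInjective j hj
  let ek := LinearEquiv.ofInjective k hk
  let el := LinearEquiv.ofInjective l hl
  have mj : BasisMatches b.basis (rangeBase b j hj).basis ej := basisMatches_map _ _
  have mk : BasisMatches c.basis (rangeBase c k hk).basis ek := basisMatches_map _ _
  have ml : BasisMatches d.basis (rangeBase d l hl).basis el := basisMatches_map _ _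
  let p := prodSub (LinearMap.range j) (LinearMap.range k)
  refine ⟨((ej.prodCongr ek).trans p).symm.trans (e.trans el), fun x => ?_,
    ((mj.sum mk).trans (prodBase_matches _ _)).symm.trans (hb.trans ml)⟩
  obtain ⟨⟨x, y⟩, rfl⟩ := ((ej.prodCongr ek).trans p).surjective x
  rw [LinearEquiv.trans_apply, LinearEquiv.symm_apply_apply]
  exact (h x y).symm

theorem subMatches_subsingleton [Subsingleton M] [Subsingleton M'] {L : Submodule Λ M}
    (b : SBasis Λ L) {L' : Submodule Λ M'} (b' : SBasis Λ L') (f : M ≃ₗ[Λ] M') [IsEmpty b.idx]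
    [IsEmpty b.stab] [IsEmpty b'.idx] [IsEmpty b'.stab] : SubMatches b b' f := by
  refine ⟨{ toFun := fun _ => 0, map_add' := fun _ _ => (add_zero 0).symm,
            map_smul' := fun c _ => (smul_zero c).symm, invFun := fun _ => 0,
            left_inv := fun _ => Subsingleton.elim _ _,
            right_inv := fun _ => Subsingleton.elim _ _ },
    fun _ => Subsingleton.elim _ _, Equiv.equivOfIsEmpty _ _, Equiv.equivOfIsEmpty _ _,
    fun i => isEmptyElim i⟩

end SubMatches

section QuasiFormations

variable {Λ : Type u} [Ring Λ] [StarRing Λ] {ε : ℤˣ} {Z : AddSubgroup (KTilde Λ)}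

theorem QForm.IsSimple.sum {v w : QForm Λ ε} (hv : v.IsSimple Z) (hw : w.IsSimple Z) :
    (v.sum w).IsSimple Z := by
  obtain ⟨f, hf, tf⟩ := hv
  obtain ⟨g, hg, tg⟩ := hw
  refine ⟨(f.prodCongr g).trans (dualProd v.carrier w.carrier), ?_, TorsionIn.conj
    (TorsionIn.sum tf tg) (BasisMatches.refl _) (basisMatches_dualProd _ _) _ fun _ => rfl⟩
  refine LinearMap.ext fun x => Dual.ext fun y => ?_
  refine Eq.trans ?_ (QuadGroup.symm_sum v.ψ w.ψ x y).symm
  exact congrArg₂ (· + ·) (congrArg (fun t : Dual Λ v.carrier => t y.1) (LinearMap.congr_fun hf x.1))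
    (congrArg (fun t : Dual Λ w.carrier => t y.2) (LinearMap.congr_fun hg x.2))

variable (Λ ε Z)

/-- An `ε`-quadratic quasi-formation `(M, ψ; L, V)`: a simple form `(M, ψ)` with a simple
Lagrangian `L` and a based half rank direct summand `V`. -/
structure QuasiFormation where
  form : QForm.{u} Λ ε
  simple : form.IsSimple Z
  lag : SimpleLagrangian Z form.mod.base form.ψ
  half : HalfSummand form.mod.base

variable {Λ ε Z}

/-- The direct sum of quasi-formations. -/
def QuasiFormation.sum (x y : QuasiFormation Λ ε Z) : QuasiFormation Λ ε Z where
  form := x.form.sum y.form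
  simple := x.simple.sum y.simple
  lag := x.lag.sum y.lag
  half := x.half.sum y.half

instance : Add (QuasiFormation Λ ε Z) := ⟨QuasiFormation.sum⟩

/-- Isomorphic quasi-formations: there is a simple isometry `f` with `f(L) = L'` and `f(V) = V'`
such that the induced isomorphisms `L ≅ L'` and `V ≅ V'` are simple. -/
def QuasiFormation.IsIso (x y : QuasiFormation Λ ε Z) : Prop :=
  ∃ f : x.form.carrier ≃ₗ[Λ] y.form.carrier, QForm.IsSimpleIsometry Z x.form y.form f ∧
    (∃ g : x.lag.sub ≃ₗ[Λ] y.lag.sub, (∀ l : x.lag.sub, (g l : y.form.carrier) = f l) ∧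
      IsSimple Z x.lag.base y.lag.base g) ∧
    (∃ g : x.half.sub ≃ₗ[Λ] y.half.sub, (∀ v : x.half.sub, (g v : y.form.carrier) = f v) ∧
      IsSimple Z x.half.base y.half.base g)

variable (ε Z)

/-- The trivial formation `(H_ε(P); P, P*)`. -/
def QuasiFormation.trivial (P : BasedModule.{u} Λ) : QuasiFormation Λ ε Z where
  form := QForm.hyp ε P
  simple := hyp_isSimple ε Z P
  lag := hypLagrangian ε Z P.base
  half := hypDual P.base

/-- The boundary `δ(K, ρ) = (H_ε(K); K, {(x, ρ x)})` of an asymmetric form `(K, ρ)`. -/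
def QuasiFormation.boundary (K : BasedModule.{u} Λ) (ρ : K.carrier →ₗ[Λ] Dual Λ K.carrier) :
    QuasiFormation Λ ε Z where
  form := QForm.hyp ε K
  simple := hyp_isSimple ε Z K
  lag := hypLagrangian ε Z K.base
  half := hypGraph K.base ρ

variable {ε Z}

/-- The induced form `(V, j* ψ j)` of a quasi-formation `(M, ψ; L, V)`, `j : V → M`. -/
def QuasiFormation.induced (x : QuasiFormation Λ ε Z) : QForm Λ ε where
  mod := { carrier := x.half.sub, base := x.half.base }
  ψ := QuadGroup.pull ε x.half.sub.subtype x.form.ψ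

/-- The relations that define `l_{2q+1}(Λ)`: stable isomorphism, and
`(M, ψ; K, L) ⊕ (M, ψ; L, V) ∼ (M, ψ; K, V)` for simple Lagrangians `K` and `L`. -/
inductive QuasiFormation.Rel : QuasiFormation Λ ε Z → QuasiFormation Λ ε Z → Prop
  | stableIso (x y : QuasiFormation Λ ε Z) (P Q : BasedModule.{u} Λ)
      (h : (x + trivial ε Z P).IsIso (y + trivial ε Z Q)) : Rel x y
  | shift (v : QForm.{u} Λ ε) (hv : v.IsSimple Z) (K L : SimpleLagrangian Z v.mod.base v.ψ)
      (V : HalfSummand v.mod.base) : Rel (⟨v, hv, K, L.toHalf⟩ + ⟨v, hv, L, V⟩) ⟨v, hv, K, V⟩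

/-- The monoid `l_{2q+1}(Λ)`: quasi-formations modulo the additive congruence generated by the
above relations. -/
abbrev LMonoid (ε : ℤˣ) (Z : AddSubgroup (KTilde Λ)) : Type (u + 1) :=
  (addConGen (QuasiFormation.Rel (Λ := Λ) (ε := ε) (Z := Z))).Quotient

/-- The class `[x] ∈ l_{2q+1}(Λ)` of a quasi-formation. -/
def QuasiFormation.cls (x : QuasiFormation Λ ε Z) : LMonoid ε Z := Quotient.mk'' x

theorem QuasiFormation.cls_add (x y : QuasiFormation Λ ε Z) : (x + y).cls = x.cls + y.cls := rfl

theorem QuasiFormation.cls_eq {x y : QuasiFormation Λ ε Z} (h : Rel x y) : x.cls = y.cls :=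
  (AddCon.eq _).2 (AddConGen.Rel.of _ _ h)

/-- An isomorphism that also respects the chosen representatives of the `s`-bases. -/
def QuasiFormation.StrictIso (x y : QuasiFormation Λ ε Z) : Prop :=
  ∃ f : x.form.carrier ≃ₗ[Λ] y.form.carrier,
    QuadGroup.pull ε f.toLinearMap y.form.ψ = x.form.ψ ∧
    BasisMatches x.form.mod.base.basis y.form.mod.base.basis f ∧
    SubMatches x.lag.base y.lag.base f ∧ SubMatches x.half.base y.half.base f

theorem QuasiFormation.StrictIso.isIso {x y : QuasiFormation Λ ε Z} (h : x.StrictIso y) :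
    x.IsIso y := by
  obtain ⟨f, h1, h2, ⟨g, hg, mg⟩, ⟨k, hk, mk⟩⟩ := h
  exact ⟨f, ⟨h1, h2.torsionIn⟩, ⟨g, hg, mg.torsionIn⟩, ⟨k, hk, mk.torsionIn⟩⟩

theorem QuasiFormation.StrictIso.refl (x : QuasiFormation Λ ε Z) : x.StrictIso x :=
  ⟨LinearEquiv.refl Λ _, by
    obtain ⟨ρ, hρ⟩ := QuotientAddGroup.mk_surjective x.form.ψ
    rw [← hρ]
    rfl, BasisMatches.refl _, SubMatches.refl _, SubMatches.refl _⟩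

theorem QuasiFormation.StrictIso.trans {x y z : QuasiFormation Λ ε Z} (h : x.StrictIso y)
    (h' : y.StrictIso z) : x.StrictIso z := by
  obtain ⟨f, h1, h2, h3, h4⟩ := h
  obtain ⟨f', h1', h2', h3', h4'⟩ := h'
  refine ⟨f.trans f', ?_, h2.trans h2', h3.trans h3', h4.trans h4'⟩
  rw [← h1, ← h1', QuadGroup.pull_pull]
  rfl

theorem QuasiFormation.StrictIso.sum {x y x' y' : QuasiFormation Λ ε Z} (h : x.StrictIso y)
    (h' : x'.StrictIso y') : (x + x').StrictIso (y + y') := by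
  obtain ⟨f, h1, h2, h3, h4⟩ := h
  obtain ⟨f', h1', h2', h3', h4'⟩ := h'
  refine ⟨f.prodCongr f', ?_, h2.sum h2', h3.sum h3', h4.sum h4'⟩
  change QuadGroup.pull ε _ (QuadGroup.sum y.form.ψ y'.form.ψ)
    = QuadGroup.sum x.form.ψ x'.form.ψ
  rw [← h1, ← h1', QuadGroup.sum, QuadGroup.sum, map_add]
  simp only [QuadGroup.pull_pull]
  rfl

theorem QuasiFormation.strictIso_comm (x y : QuasiFormation Λ ε Z) :
    (x + y).StrictIso (y + x) :=
  ⟨LinearEquiv.prodComm Λ _ _, QuadGroup.pull_comm x.form.ψ y.form.ψ, basisMatches_comm _ _,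
    subMatches_comm x.lag.base y.lag.base, subMatches_comm x.half.base y.half.base⟩

theorem QuasiFormation.strictIso_assoc (x y z : QuasiFormation Λ ε Z) :
    (x + y + z).StrictIso (x + (y + z)) :=
  ⟨LinearEquiv.prodAssoc Λ _ _ _, QuadGroup.pull_assoc x.form.ψ y.form.ψ z.form.ψ,
    basisMatches_assoc _ _ _, subMatches_assoc x.lag.base y.lag.base z.lag.base,
    subMatches_assoc x.half.base y.half.base z.half.base⟩

theorem QuasiFormation.StrictIso.rel {x y : QuasiFormation Λ ε Z} (h : x.StrictIso y) :
    Rel x y :=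
  Rel.stableIso x y (BasedModule.zero Λ) (BasedModule.zero Λ)
    (h.sum (StrictIso.refl _)).isIso

/-- The trivial formation on the zero module. -/
abbrev QuasiFormation.empty (ε : ℤˣ) (Z : AddSubgroup (KTilde Λ)) : QuasiFormation Λ ε Z :=
  trivial ε Z (BasedModule.zero Λ)

/-- Data that make a quasi-formation vanish. -/
structure QuasiFormation.IsNull (x : QuasiFormation Λ ε Z) : Prop where
  sub : Subsingleton x.form.carrier
  idx : IsEmpty x.form.mod.base.idx
  stab : IsEmpty x.form.mod.base.stab
  lidx : IsEmpty x.lag.base.idx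
  lstab : IsEmpty x.lag.base.stab
  hidx : IsEmpty x.half.base.idx
  hstab : IsEmpty x.half.base.stab

theorem QuasiFormation.IsNull.strictIso {x y : QuasiFormation Λ ε Z} (hx : x.IsNull)
    (hy : y.IsNull) : x.StrictIso y := by
  obtain ⟨a1, a2, a3, a4, a5, a6, a7⟩ := hx
  obtain ⟨b1, b2, b3, b4, b5, b6, b7⟩ := hy
  let f : x.form.carrier ≃ₗ[Λ] y.form.carrier :=
    { toFun := fun _ => 0, map_add' := fun _ _ => (add_zero 0).symm,
      map_smul' := fun c _ => (smul_zero c).symm, invFun := fun _ => 0,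
      left_inv := fun _ => Subsingleton.elim _ _,
      right_inv := fun _ => Subsingleton.elim _ _ }
  refine ⟨f, ?_, ⟨Equiv.equivOfIsEmpty _ _, Equiv.equivOfIsEmpty _ _, fun i => isEmptyElim i⟩,
    subMatches_subsingleton _ _ f, subMatches_subsingleton _ _ f⟩
  obtain ⟨ρ, hρ⟩ := QuotientAddGroup.mk_surjective x.form.ψ
  obtain ⟨σ, hσ⟩ := QuotientAddGroup.mk_surjective y.form.ψ
  have : pullHom f.toLinearMap σ = ρ := by
    refine LinearMap.ext fun a => ?_
    rw [Subsingleton.elim a 0, map_zero, map_zero]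
  rw [← hρ, ← hσ, ← this]
  rfl

theorem QuasiFormation.isNull_empty : (empty (Λ := Λ) ε Z).IsNull := by
  constructor
  · exact inferInstanceAs (Subsingleton (PUnit.{u + 1} × (PUnit.{u + 1} →ₗ[Λ] Λ)))
  · exact inferInstanceAs (IsEmpty (Empty ⊕ Empty))
  · exact inferInstanceAs (IsEmpty (Empty ⊕ Empty))
  iterate 4 exact inferInstanceAs (IsEmpty Empty)

theorem QuasiFormation.isNull_boundary_zero
    (ρ : (BasedModule.zero Λ).carrier →ₗ[Λ] Dual Λ (BasedModule.zero Λ).carrier) :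
    (boundary ε Z (BasedModule.zero Λ) ρ).IsNull := by
  constructor
  · exact inferInstanceAs (Subsingleton (PUnit.{u + 1} × (PUnit.{u + 1} →ₗ[Λ] Λ)))
  · exact inferInstanceAs (IsEmpty (Empty ⊕ Empty))
  · exact inferInstanceAs (IsEmpty (Empty ⊕ Empty))
  iterate 4 exact inferInstanceAs (IsEmpty Empty)

theorem QuasiFormation.IsNull.sum {x y : QuasiFormation Λ ε Z} (hx : x.IsNull)
    (hy : y.IsNull) : (x + y).IsNull := by
  obtain ⟨a1, a2, a3, a4, a5, a6, a7⟩ := hx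
  obtain ⟨b1, b2, b3, b4, b5, b6, b7⟩ := hy
  constructor
  · exact inferInstanceAs (Subsingleton (x.form.carrier × y.form.carrier))
  · exact inferInstanceAs (IsEmpty (x.form.mod.base.idx ⊕ y.form.mod.base.idx))
  · exact inferInstanceAs (IsEmpty (x.form.mod.base.stab ⊕ y.form.mod.base.stab))
  · exact inferInstanceAs (IsEmpty (x.lag.base.idx ⊕ y.lag.base.idx))
  · exact inferInstanceAs (IsEmpty (x.lag.base.stab ⊕ y.lag.base.stab))
  · exact inferInstanceAs (IsEmpty (x.half.base.idx ⊕ y.half.base.idx))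
  · exact inferInstanceAs (IsEmpty (x.half.base.stab ⊕ y.half.base.stab))

instance : Zero (LMonoid (Λ := Λ) ε Z) := ⟨(QuasiFormation.empty ε Z).cls⟩

/-- Addition in `l_{2q+1}(Λ)` is induced by the direct sum; the unit is the class of the trivial
formations. -/
instance : AddCommMonoid (LMonoid (Λ := Λ) ε Z) :=
  have zero_add : ∀ x : LMonoid (Λ := Λ) ε Z, 0 + x = x := by
    intro x
    induction x using Quotient.inductionOn' with | h x => ?_
    change (QuasiFormation.empty ε Z + x).cls = x.cls
    refine QuasiFormation.cls_eq (QuasiFormation.Rel.stableIso _ _ (BasedModule.zero Λ)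
      (BasedModule.zero Λ) (QuasiFormation.StrictIso.isIso ?_))
    have h1 := ((QuasiFormation.strictIso_comm (QuasiFormation.empty ε Z) x).sum
      (QuasiFormation.StrictIso.refl (QuasiFormation.empty ε Z))).trans
        (QuasiFormation.strictIso_assoc _ _ _)
    exact h1.trans ((QuasiFormation.StrictIso.refl x).sum
      ((QuasiFormation.isNull_empty.sum QuasiFormation.isNull_empty).strictIso
        QuasiFormation.isNull_empty))
  have add_comm : ∀ x y : LMonoid (Λ := Λ) ε Z, x + y = y + x := by
    intro x y
    induction x using Quotient.inductionOn' with | h x => ?_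
    induction y using Quotient.inductionOn' with | h y => ?_
    exact QuasiFormation.cls_eq (QuasiFormation.strictIso_comm x y).rel
  { add_assoc := by
      intro x y z
      induction x using Quotient.inductionOn' with | h x => ?_
      induction y using Quotient.inductionOn' with | h y => ?_
      induction z using Quotient.inductionOn' with | h z => ?_
      exact QuasiFormation.cls_eq (QuasiFormation.strictIso_assoc x y z).rel
    zero_add := zero_add
    add_zero := fun x => (add_comm x _).trans (zero_add x)
    add_comm := add_comm
    nsmul := nsmulRec }

theorem QuasiFormation.cls_trivial (P : BasedModule.{u} Λ) : (trivial ε Z P).cls = 0 :=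
  QuasiFormation.cls_eq (Rel.stableIso _ _ (BasedModule.zero Λ) P (strictIso_comm _ _).isIso)

theorem QuasiFormation.strictIso_boundary (K K' : BasedModule.{u} Λ)
    (ρ : K.carrier →ₗ[Λ] Dual Λ K.carrier) (ρ' : K'.carrier →ₗ[Λ] Dual Λ K'.carrier) :
    (boundary ε Z K ρ + boundary ε Z K' ρ').StrictIso (boundary ε Z (K.sum K')
      (pullHom (LinearMap.fst Λ K.carrier K'.carrier) ρ
        + pullHom (LinearMap.snd Λ K.carrier K'.carrier) ρ')) := by
  let f := (LinearEquiv.prodProdProdComm Λ K.carrier (Dual Λ K.carrier) K'.carrier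
    (Dual Λ K'.carrier)).trans ((LinearEquiv.refl Λ (K.carrier × K'.carrier)).prodCongr
      (dualProd K.carrier K'.carrier))
  refine ⟨f, rfl, (basisMatches_comm4 _ _ _ _).trans ((BasisMatches.refl _).sum
    (basisMatches_dualProd _ _)), ?_, ?_⟩
  · exact subMatches_range _ _ _ f (LinearEquiv.refl Λ _)
      (fun x y => Prod.ext rfl (map_zero (dualProd _ _))) (BasisMatches.refl _)
  · exact subMatches_range _ _ _ f (LinearEquiv.refl Λ _) (fun x y => rfl) (BasisMatches.refl _)

/-- The submonoid `E l_{2q+1}(Λ)` of elementary elements, i.e. of the elements that are represented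
by a boundary. -/
def Elementary (ε : ℤˣ) (Z : AddSubgroup (KTilde Λ)) : AddSubmonoid (LMonoid ε Z) where
  carrier := {x | ∃ (K : BasedModule.{u} Λ) (ρ : K.carrier →ₗ[Λ] Dual Λ K.carrier),
    x = (QuasiFormation.boundary ε Z K ρ).cls}
  zero_mem' := ⟨BasedModule.zero Λ, 0, QuasiFormation.cls_eq
    (QuasiFormation.isNull_empty.strictIso (QuasiFormation.isNull_boundary_zero 0)).rel⟩
  add_mem' := by
    rintro _ _ ⟨K, ρ, rfl⟩ ⟨K', ρ', rfl⟩
    exact ⟨K.sum K', _, QuasiFormation.cls_eq (QuasiFormation.strictIso_boundary K K' ρ ρ').rel⟩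

end QuasiFormations

/-! ### Grothendieck groups -/

section Grothendieck

/-- The homomorphism `Gr(A) → Gr(B)` of Grothendieck groups induced by a homomorphism of abelian
monoids. -/
def grMap {A B : Type*} [AddCommMonoid A] [AddCommMonoid B] (f : A →+ B) :
    Algebra.GrothendieckAddGroup A →+ Algebra.GrothendieckAddGroup B :=
  Algebra.GrothendieckAddGroup.lift (Algebra.GrothendieckAddGroup.of.comp f)

end Grothendieck

end SurgeryMonoid

end

/-! Two maps run in opposite directions: a form goes to its boundary, and a quasi-formation goes to
the form induced on its half rank summand. Restriction to the graph of `ρ` returns the class of `ρ`.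
So, once both maps are well defined, the first is injective with the second as left inverse, and its
image consists of the elementary classes by definition.

The induced form respects the relations because a Lagrangian induces the zero form, which is trivial
among `0`-stabilised forms (`inducedHom`). The boundary needs more work. The relation between
Lagrangians replaces K by K* in (H_ε(K); K, graph), at the cost of the trivial formation (H_ε(K); K,
K*); this is `QuasiFormation.cls_boundary_eq_cls_dualBoundary`. The shears (x, f) ↦ (x, f + (φ - T_ε
φ)x) are isometries that fix K* and move the graph of ρ to that of ρ + φ - T_ε φ, so that only [ρ]
matters (`QuasiFormation.cls_boundary_congr`). For ρ = 0 one obtains (H_ε(K); K*, K), which is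
isomorphic to a trivial formation (`QuasiFormation.cls_boundary_zero`); hence adding a zero form
changes nothing. Simple isometries f act through f ⊕ (f*)⁻¹, which is simple because Z is invariant
under conjugate transpose.

For stable elementarity, choose an isometry M ≅ L ⊕ L* extending the inclusion of L
(`SimpleLagrangian.exists_hyp_isometry`) and write v = (αv, βv) for v in V. A quasi-formation is
isomorphic to a boundary if V projects to L by a simple isomorphism
(`QuasiFormation.isIso_boundary_of_graph`). In general α is not invertible. But V is a direct
summand of the same rank as L, so for a suitable F and t₀ : F → L the map v ↦ (αv, t₀*βv) extends to
a simple isomorphism G : V ⊕ F* ≅ L ⊕ F* (`exists_completion`). Now add the boundary of H_ε(F). On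
its graph the coordinate f in F* also occurs as a functional on F, so a shear from (L ⊕ F ⊕ F*)* to
L ⊕ F ⊕ F* can turn the projection (αv, x, f) into one governed by G(v, f). A shear by s - t is an
isometry if t is the ε-dual of s (`exists_hyp_shear`); the correction t only adds to x a term
depending on v, which affects neither invertibility nor torsion (`exists_stable_hyp_iso`).

Thus elementary classes are cofinal, and a cofinal submonoid of this kind has the same Grothendieck
group (`grMap_subtype_bijective`). Simplicity is controlled throughout by a few facts: torsion is
additive under composition, vanishes on shears and signs, and turns into the conjugate transpose
under duality. -/

noncomputable section

namespace SurgeryMonoid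

/-! ### Torsion of isomorphisms: composition, inverses, shears. -/

section TorsionCalculus

variable {Λ : Type u} [Ring Λ]
variable {X : Type u} [AddCommGroup X] [Module Λ X] {Y : Type u} [AddCommGroup Y] [Module Λ Y]
variable {W : Type u} [AddCommGroup W] [Module Λ W] {V : Type u} [AddCommGroup V] [Module Λ V]
variable {M : Type u} [AddCommGroup M] [Module Λ M] {N : Type u} [AddCommGroup N] [Module Λ N]
variable {P : Type u} [AddCommGroup P] [Module Λ P]
variable {ι κ ι' κ' μ ν μ' ν' : Type} [Fintype ι] [DecidableEq ι] [Fintype ι'] [DecidableEq ι']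
  [Fintype μ] [DecidableEq μ] [Fintype μ'] [DecidableEq μ']

/-- The matrix of an isomorphism with respect to two bases whose index sets are identified. -/
def isoMatrix (B : Basis ι Λ X) (C : Basis ι' Λ Y) (σ : ι ≃ ι') (g : X ≃ₗ[Λ] Y) : GLn Λ ι :=
  glOf B (g.trans (C.equiv B σ.symm))

theorem isoMatrix_apply (B : Basis ι Λ X) (C : Basis ι' Λ Y) (σ : ι ≃ ι') (g : X ≃ₗ[Λ] Y)
    (i j : ι) : (isoMatrix B C σ g : Matrix ι ι Λ) i j = C.repr (g (B i)) (σ j) := by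
  rw [isoMatrix, glOf_apply, LinearEquiv.trans_apply]
  have h := repr_of_matching C B σ.symm (C.equiv B σ.symm).toLinearMap
    (fun i => by simp) (g (B i)) (σ j)
  rwa [Equiv.symm_apply_apply] at h

/-- Rows hold the coordinates of the images of basis vectors, so the matrix of `g` followed by `h`
is the product in that order, once the second matrix is reindexed along `σ`. -/
theorem cls_isoMatrix_trans (B : Basis ι Λ X) (C : Basis ι' Λ Y) (D : Basis μ Λ W) (σ : ι ≃ ι')
    (τ : ι' ≃ μ) (g : X ≃ₗ[Λ] Y) (h : Y ≃ₗ[Λ] W) :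
    KTilde.cls (isoMatrix B D (σ.trans τ) (g.trans h))
      = KTilde.cls (isoMatrix B C σ g) + KTilde.cls (isoMatrix C D τ h) := by
  rw [← KTilde.cls_reindex σ.symm (isoMatrix C D τ h), ← KTilde.cls_mul]
  congr 1
  ext i j
  rw [Units.val_mul, Matrix.mul_apply]
  simp only [glReindex_apply, isoMatrix_apply, Equiv.symm_symm]
  have e := congrArg (fun x => D.repr (h x) (τ (σ j))) (C.sum_repr (g (B i)))
  simp only [map_sum, map_smul, Finsupp.coe_finsetSum, Finset.sum_apply, Finsupp.smul_apply,
    smul_eq_mul] at e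
  rw [Equiv.sum_comp σ (fun k => C.repr (g (B i)) k * D.repr (h (C k)) (τ (σ j)))]
  exact e.symm

theorem cls_isoMatrix_of_matching (B : Basis ι Λ X) (C : Basis ι' Λ Y) (σ : ι ≃ ι')
    (g : X ≃ₗ[Λ] Y) (h : ∀ i, C (σ i) = g (B i)) : KTilde.cls (isoMatrix B C σ g) = 0 := by
  have : isoMatrix B C σ g = 1 := by
    ext i j
    rw [isoMatrix_apply, ← h, Basis.repr_self, Finsupp.single_apply, Units.val_one,
      Matrix.one_apply]
    simp only [EmbeddingLike.apply_eq_iff_eq]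
  rw [this, KTilde.cls_one]

theorem cls_isoMatrix_prodCongr (B : Basis ι Λ X) (C : Basis ι' Λ Y) (σ : ι ≃ ι') (g : X ≃ₗ[Λ] Y)
    (B' : Basis μ Λ W) (C' : Basis μ' Λ V) (τ : μ ≃ μ') (h : W ≃ₗ[Λ] V) :
    KTilde.cls (isoMatrix (B.prod B') (C.prod C') (Equiv.sumCongr σ τ) (g.prodCongr h))
      = KTilde.cls (isoMatrix B C σ g) + KTilde.cls (isoMatrix B' C' τ h) := by
  rw [← KTilde.cls_glSum]
  congr 1
  ext i j
  rw [isoMatrix_apply]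
  rcases i with i | i <;> rcases j with j | j <;> simp [glSum, isoMatrix_apply]

/-- The isomorphism `f ⊕ id : M ⊕ Λ^κ ≅ N ⊕ Λ^κ'`, where `Λ^κ` and `Λ^κ'` are identified through
a bijection of the index sets. -/
def stabIso (f : M ≃ₗ[Λ] N) (θ : κ ≃ κ') : (M × (κ → Λ)) ≃ₗ[Λ] (N × (κ' → Λ)) :=
  f.prodCongr (LinearEquiv.funCongrLeft Λ Λ θ.symm)

theorem stabIso_apply (f : M ≃ₗ[Λ] N) (θ : κ ≃ κ') (x : M × (κ → Λ)) :
    stabIso f θ x = (f x.1, fun k => x.2 (θ.symm k)) := rfl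

variable {Z : AddSubgroup (KTilde Λ)}

/-- Trades an entrywise condition on some matrix for the class of `isoMatrix`, to which the rules
for composites and block sums apply. -/
theorem torsionIn_iff {B : Basis ι Λ (M × (κ → Λ))} {C : Basis ι' Λ (N × (κ' → Λ))}
    {f : M ≃ₗ[Λ] N} : TorsionIn Z B C f ↔
    ∃ (α β : Type) (_ : Fintype α) (_ : DecidableEq α) (_ : Fintype β) (_ : DecidableEq β)
      (θ : κ ⊕ α ≃ κ' ⊕ β) (σ : ι ⊕ α ≃ ι' ⊕ β),
      KTilde.cls (isoMatrix (stabBasis B α) (stabBasis C β) σ (stabIso f θ)) ∈ Z := by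
  constructor
  · rintro ⟨α, β, _, _, _, _, θ, σ, A, hA, hZ⟩
    refine ⟨α, β, inferInstance, inferInstance, inferInstance, inferInstance, θ, σ, ?_⟩
    have : isoMatrix (stabBasis B α) (stabBasis C β) σ (stabIso f θ) = A := by
      ext i j
      rw [isoMatrix_apply, hA]
      rfl
    rwa [this]
  · rintro ⟨α, β, _, _, _, _, θ, σ, hZ⟩
    exact ⟨α, β, inferInstance, inferInstance, inferInstance, inferInstance, θ, σ, _,
      fun i j => isoMatrix_apply _ _ _ _ _ _, hZ⟩

theorem TorsionIn.symm {B : Basis ι Λ (M × (κ → Λ))} {C : Basis ι' Λ (N × (κ' → Λ))}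
    {f : M ≃ₗ[Λ] N} (h : TorsionIn Z B C f) : TorsionIn Z C B f.symm := by
  obtain ⟨α, β, _, _, _, _, θ, σ, hZ⟩ := torsionIn_iff.1 h
  refine torsionIn_iff.2 ⟨β, α, inferInstance, inferInstance, inferInstance, inferInstance,
    θ.symm, σ.symm, ?_⟩
  -- The composite of the two stabilised maps is the identity and matches the basis with itself, so
  -- the two classes are opposite.
  have h1 := cls_isoMatrix_trans (stabBasis B α) (stabBasis C β) (stabBasis B α) σ σ.symm
    (stabIso f θ) (stabIso f.symm θ.symm)
  rw [cls_isoMatrix_of_matching] at h1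
  · rw [← neg_eq_of_add_eq_zero_right h1.symm]
    exact Z.neg_mem hZ
  · intro i
    rw [LinearEquiv.trans_apply, stabIso_apply, stabIso_apply]
    simp

/-- The identification `(M ⊕ Λ^{κ ⊔ α}) ⊕ Λ^γ = M ⊕ Λ^{κ ⊔ (α ⊔ γ)}`. -/
def stabAssoc (Λ : Type u) [Ring Λ] (M : Type u) [AddCommGroup M] [Module Λ M] (κ α γ : Type) :
    ((M × (κ ⊕ α → Λ)) × (γ → Λ)) ≃ₗ[Λ] (M × (κ ⊕ (α ⊕ γ) → Λ)) :=
  (stabEquiv M (κ ⊕ α) γ).trans (stabIso (LinearEquiv.refl Λ M) (Equiv.sumAssoc κ α γ))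

theorem stabAssoc_apply (α γ : Type) (x : (M × (κ ⊕ α → Λ)) × (γ → Λ)) :
    stabAssoc Λ M κ α γ x = (x.1.1, Sum.elim (fun k => x.1.2 (Sum.inl k))
      (Sum.elim (fun k => x.1.2 (Sum.inr k)) x.2)) := by
  refine Prod.ext rfl (funext fun k => ?_)
  rcases k with k | k | k <;> rfl

theorem stabAssoc_basis (B : Basis ι Λ (M × (κ → Λ))) (α γ : Type) [Fintype α] [DecidableEq α]
    [Fintype γ] [DecidableEq γ] (i : (ι ⊕ α) ⊕ γ) :
    stabBasis B (α ⊕ γ) (Equiv.sumAssoc ι α γ i)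
      = stabAssoc Λ M κ α γ ((stabBasis B α).prod (Pi.basisFun Λ γ) i) := by
  rw [stabAssoc_apply]
  rcases i with (i | i) | i
  · rw [Equiv.sumAssoc_apply_inl_inl, stabBasis_inl]
    refine Prod.ext (by simp [stabBasis_inl]) (funext fun k => ?_)
    rcases k with k | k | k <;> simp [stabBasis_inl]
  · rw [Equiv.sumAssoc_apply_inl_inr, stabBasis_inr]
    refine Prod.ext (by simp [stabBasis_inr]) (funext fun k => ?_)
    rcases k with k | k | k <;> simp [stabBasis_inr, Pi.single_apply]
  · rw [Equiv.sumAssoc_apply_inr, stabBasis_inr]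
    refine Prod.ext (by simp) (funext fun k => ?_)
    rcases k with k | k | k <;> simp [Pi.single_apply]

/-- The interchange `(M ⊕ Λ^{κ ⊔ β}) ⊕ Λ^γ = (M ⊕ Λ^{κ ⊔ γ}) ⊕ Λ^β`. -/
def stabSwap (Λ : Type u) [Ring Λ] (M : Type u) [AddCommGroup M] [Module Λ M] (κ β γ : Type) :
    ((M × (κ ⊕ β → Λ)) × (γ → Λ)) ≃ₗ[Λ] ((M × (κ ⊕ γ → Λ)) × (β → Λ)) :=
  (stabAssoc Λ M κ β γ).trans ((stabIso (LinearEquiv.refl Λ M)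
    (Equiv.sumCongr (Equiv.refl κ) (Equiv.sumComm β γ))).trans (stabAssoc Λ M κ γ β).symm)

/-- Lets an already stabilised isomorphism be stabilised further, up to reassociating index sets;
this brings two isomorphisms stabilised by different amounts to a common size. -/
theorem stabIso_prodCongr (f : M ≃ₗ[Λ] N) {α β : Type} (θ : κ ⊕ α ≃ κ' ⊕ β) (γ : Type) :
    (stabIso f θ).prodCongr (LinearEquiv.refl Λ (γ → Λ)) = (stabAssoc Λ M κ α γ).trans
      ((stabIso f ((Equiv.sumAssoc κ α γ).symm.trans ((Equiv.sumCongr θ (Equiv.refl γ)).trans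
        (Equiv.sumAssoc κ' β γ)))).trans (stabAssoc Λ N κ' β γ).symm) := by
  ext1 x
  rw [LinearEquiv.trans_apply, LinearEquiv.trans_apply, LinearEquiv.eq_symm_apply, stabAssoc_apply,
    stabAssoc_apply, stabIso_apply]
  refine Prod.ext rfl (funext fun k => ?_)
  rcases k with k | k | k
  · change x.1.2 (θ.symm (Sum.inl k)) = Sum.elim _ _ (Equiv.sumAssoc κ α γ
      (Sum.inl (θ.symm (Sum.inl k))))
    rcases θ.symm (Sum.inl k) with l | l <;> rfl
  · change x.1.2 (θ.symm (Sum.inr k)) = Sum.elim _ _ (Equiv.sumAssoc κ α γ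
      (Sum.inl (θ.symm (Sum.inr k))))
    rcases θ.symm (Sum.inr k) with l | l <;> rfl
  · rfl

theorem stabSwap_basis (B : Basis ι Λ (M × (κ → Λ))) (β γ : Type) [Fintype β] [DecidableEq β]
    [Fintype γ] [DecidableEq γ] (i : (ι ⊕ β) ⊕ γ) :
    (stabBasis B γ).prod (Pi.basisFun Λ β) ((Equiv.sumAssoc ι γ β).symm
      (Equiv.sumCongr (Equiv.refl ι) (Equiv.sumComm β γ) (Equiv.sumAssoc ι β γ i)))
      = stabSwap Λ M κ β γ ((stabBasis B β).prod (Pi.basisFun Λ γ) i) := by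
  rw [stabSwap, LinearEquiv.trans_apply, LinearEquiv.trans_apply, LinearEquiv.eq_symm_apply,
    ← stabAssoc_basis, ← stabAssoc_basis, Equiv.apply_symm_apply, stabIso_apply]
  rcases i with (i | i) | i <;>
  · simp only [Equiv.sumAssoc_apply_inl_inl, Equiv.sumAssoc_apply_inl_inr,
      Equiv.sumAssoc_apply_inr, Equiv.sumCongr_apply, Sum.map_inl, Sum.map_inr,
      Equiv.sumComm_apply, Sum.swap_inl, Sum.swap_inr, Equiv.refl_apply, stabBasis_inl,
      stabBasis_inr]
    refine Prod.ext rfl (funext fun k => ?_)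
    rcases k with k | k | k <;> simp [Pi.single_apply]

/-- The two witnesses stabilise the middle basis `C` by `β` and by `α'`. Enlarging the first by `α'`
and the second by `β` makes them composable. The identifications in between carry basis vectors to
basis vectors, so only the classes of `f` and `g` contribute. -/
theorem TorsionIn.trans {B : Basis ι Λ (M × (κ → Λ))} {C : Basis ι' Λ (N × (κ' → Λ))}
    {D : Basis μ Λ (P × (ν → Λ))} {f : M ≃ₗ[Λ] N} {g : N ≃ₗ[Λ] P} (hf : TorsionIn Z B C f)
    (hg : TorsionIn Z C D g) : TorsionIn Z B D (f.trans g) := by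
  obtain ⟨α, β, _, _, _, _, θ, σ, hf⟩ := torsionIn_iff.1 hf
  obtain ⟨α', β', _, _, _, _, θ', σ', hg⟩ := torsionIn_iff.1 hg
  let sw : ∀ ω : Type, (ω ⊕ β) ⊕ α' ≃ (ω ⊕ α') ⊕ β := fun ω =>
    (Equiv.sumAssoc ω β α').trans ((Equiv.sumCongr (Equiv.refl ω) (Equiv.sumComm β α')).trans
      (Equiv.sumAssoc ω α' β).symm)
  let Θ : κ ⊕ (α ⊕ α') ≃ ν ⊕ (β' ⊕ β) := (Equiv.sumAssoc κ α α').symm.trans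
    ((Equiv.sumCongr θ (Equiv.refl α')).trans ((sw κ').trans
      ((Equiv.sumCongr θ' (Equiv.refl β)).trans (Equiv.sumAssoc ν β' β))))
  refine torsionIn_iff.2 ⟨α ⊕ α', β' ⊕ β, inferInstance, inferInstance, inferInstance,
    inferInstance, Θ, (Equiv.sumAssoc ι α α').symm.trans
    ((Equiv.sumCongr σ (Equiv.refl α')).trans ((sw ι').trans
      ((Equiv.sumCongr σ' (Equiv.refl β)).trans (Equiv.sumAssoc μ β' β)))), ?_⟩
  have key : stabIso (f.trans g) Θ = (stabAssoc Λ M κ α α').symm.trans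
      (((stabIso f θ).prodCongr (LinearEquiv.refl Λ (α' → Λ))).trans ((stabSwap Λ N κ' β α').trans
        (((stabIso g θ').prodCongr (LinearEquiv.refl Λ (β → Λ))).trans
          (stabAssoc Λ P ν β' β)))) := by
    rw [stabIso_prodCongr, stabIso_prodCongr, stabSwap]
    ext1 x
    simp only [LinearEquiv.trans_apply, LinearEquiv.apply_symm_apply]
    rfl
  rw [key, cls_isoMatrix_trans _ ((stabBasis B α).prod (Pi.basisFun Λ α')),
    cls_isoMatrix_trans _ ((stabBasis C β).prod (Pi.basisFun Λ α')),
    cls_isoMatrix_trans _ ((stabBasis C α').prod (Pi.basisFun Λ β)),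
    cls_isoMatrix_trans _ ((stabBasis D β').prod (Pi.basisFun Λ β)),
    cls_isoMatrix_prodCongr, cls_isoMatrix_prodCongr,
    cls_isoMatrix_of_matching (Pi.basisFun Λ α') _ (Equiv.refl α') _ fun _ => rfl,
    cls_isoMatrix_of_matching (Pi.basisFun Λ β) _ (Equiv.refl β) _ fun _ => rfl,
    cls_isoMatrix_of_matching _ _ (Equiv.sumAssoc ι α α').symm,
    cls_isoMatrix_of_matching _ _ (Equiv.sumAssoc μ β' β) _ (stabAssoc_basis D β' β),
    cls_isoMatrix_of_matching _ _ (sw ι') _ (stabSwap_basis C β α')]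
  · simpa using Z.add_mem hf hg
  · intro i
    rw [LinearEquiv.eq_symm_apply, ← stabAssoc_basis, Equiv.apply_symm_apply]

theorem glOf_map (B : Basis ι Λ X) (e : X ≃ₗ[Λ] Y) (g : Y ≃ₗ[Λ] Y) :
    glOf (B.map e) g = glOf B ((e.trans g).trans e.symm) := by
  ext i j
  rw [glOf_apply, glOf_apply, Basis.map_apply]
  rfl

theorem cls_glOf_prodCongr (B : Basis ι Λ X) (C : Basis ι' Λ Y) (g : X ≃ₗ[Λ] X)
    (h : Y ≃ₗ[Λ] Y) : KTilde.cls (glOf (B.prod C) (g.prodCongr h))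
      = KTilde.cls (glOf B g) + KTilde.cls (glOf C h) := by
  rw [← KTilde.cls_glSum]
  congr 1
  ext i j
  rw [glOf_apply]
  rcases i with i | i <;> rcases j with j | j <;> simp [glSum, glOf_apply]

theorem cls_glOf_refl (B : Basis ι Λ X) :
    KTilde.cls (glOf B (LinearEquiv.refl Λ X)) = 0 := by
  have h := cls_glOf_trans B (LinearEquiv.refl Λ X) (LinearEquiv.refl Λ X)
  exact left_eq_add.1 h

/-- The unipotent automorphism `(x, y) ↦ (x + a y, y)`. -/
def shear (a : Y →ₗ[Λ] X) : (X × Y) ≃ₗ[Λ] (X × Y) where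
  toFun z := (z.1 + a z.2, z.2)
  map_add' z w := by
    refine Prod.ext ?_ rfl
    simp only [Prod.fst_add, Prod.snd_add, map_add]
    abel
  map_smul' c z := by
    refine Prod.ext ?_ rfl
    simp
  invFun z := (z.1 - a z.2, z.2)
  left_inv z := by simp
  right_inv z := by simp

@[simp] theorem shear_apply (a : Y →ₗ[Λ] X) (z : X × Y) : shear a z = (z.1 + a z.2, z.2) := rfl

/-- After adding a second copy of `Y`, the shear becomes a commutator: with `s` the shear along the
second copy and `t` the map `(y, y') ↦ (y, y' + y)`, the relation `h` exhibits the shear `s'` along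
the first copy as the discrepancy between the two orders of composition. The group `K̃₁` is abelian,
so the classes of `s` and `t` cancel. -/
theorem cls_glOf_shear (B : Basis ι Λ X) (C : Basis ι' Λ Y) (a : Y →ₗ[Λ] X) :
    KTilde.cls (glOf (B.prod C) (shear a)) = 0 := by
  let D := ((B.prod C).prod C).map (LinearEquiv.prodAssoc Λ X Y Y)
  let s : (X × (Y × Y)) ≃ₗ[Λ] (X × (Y × Y)) := shear (a ∘ₗ LinearMap.snd Λ Y Y)
  let s' : (X × (Y × Y)) ≃ₗ[Λ] (X × (Y × Y)) := shear (a ∘ₗ LinearMap.fst Λ Y Y)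
  let t : (X × (Y × Y)) ≃ₗ[Λ] (X × (Y × Y)) := (LinearEquiv.refl Λ X).prodCongr
    (((LinearEquiv.prodComm Λ Y Y).trans (shear LinearMap.id)).trans (LinearEquiv.prodComm Λ Y Y))
  have h : t.trans s = (s.trans t).trans s' := by
    ext1 x
    obtain ⟨x, y, y'⟩ := x
    change (x + a (y' + y), (y, y' + y)) = ((x + a y') + a y, (y, y' + y))
    rw [map_add, add_assoc]
  have h1 := congrArg (fun g => KTilde.cls (glOf D g)) h
  simp only [cls_glOf_trans] at h1
  rw [add_comm (KTilde.cls (glOf D t))] at h1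
  have h2 : KTilde.cls (glOf D s') = 0 := left_eq_add.1 h1
  rw [glOf_map] at h2
  have h3 : ((LinearEquiv.prodAssoc Λ X Y Y).trans s').trans (LinearEquiv.prodAssoc Λ X Y Y).symm
      = (shear a).prodCongr (LinearEquiv.refl Λ Y) := rfl
  rwa [h3, cls_glOf_prodCongr, cls_glOf_refl, add_zero] at h2

/-- Both stabilising index sets can be taken empty, so the stabilised matrix differs from that of `f
⊕ id` only by an empty block. -/
theorem torsionIn_of_glOf {B : Basis ι Λ (M × (κ → Λ))} {f : M ≃ₗ[Λ] M}
    (h : KTilde.cls (glOf B (f.prodCongr (LinearEquiv.refl Λ (κ → Λ)))) ∈ Z) :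
    TorsionIn Z B B f := by
  refine torsionIn_iff.2 ⟨Empty, Empty, inferInstance, inferInstance, inferInstance,
    inferInstance, Equiv.refl _, Equiv.refl _, ?_⟩
  have : isoMatrix (stabBasis B Empty) (stabBasis B Empty) (Equiv.refl _)
      (stabIso f (Equiv.refl _)) = glSum (glOf B (f.prodCongr (LinearEquiv.refl Λ (κ → Λ)))) 1 := by
    ext i j
    rcases i with i | i
    · rcases j with j | j
      · rw [isoMatrix_apply, stabIso_apply, stabBasis_inl]
        have hx : ∀ x : M × (κ → Λ), (stabBasis B Empty).repr (x.1, Sum.elim x.2 0) (Sum.inl j)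
            = B.repr x j := fun x => by
          simp [stabBasis, stabEquiv, LinearEquiv.trans_symm]
          rfl
        refine Eq.trans ?_ (hx (f (B i).1, (B i).2))
        rfl
      · exact j.elim
    · exact i.elim
  rwa [this, KTilde.cls_stab]

theorem torsionIn_shear (B : Basis ι Λ (M × (κ → Λ))) (C : Basis ι' Λ (N × (κ' → Λ)))
    (a : N →ₗ[Λ] M) : TorsionIn Z (sumBasis B C) (sumBasis B C) (shear a) := by
  refine torsionIn_of_glOf ?_
  rw [sumBasis, glOf_map]
  -- Regrouped, the stabilised map is again a shear, from `N ⊕ Λ^κ'` into `M ⊕ Λ^κ`, that ignores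
  -- the stabilising coordinates.
  have : ((sumEquiv M N κ κ').trans ((shear a).prodCongr
      (LinearEquiv.refl Λ (κ ⊕ κ' → Λ)))).trans (sumEquiv M N κ κ').symm
      = shear (LinearMap.inl Λ M (κ → Λ) ∘ₗ a ∘ₗ LinearMap.fst Λ N (κ' → Λ)) := by
    ext1 x
    rw [LinearEquiv.trans_apply, LinearEquiv.symm_apply_eq]
    refine Prod.ext rfl (funext fun k => ?_)
    rcases k with k | k
    · exact (add_zero _).symm
    · rfl
  rw [this, cls_glOf_shear]
  exact Z.zero_mem

end TorsionCalculus

/-! ### Torsion of dual isomorphisms. -/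

section TorsionDual

variable {Λ : Type u} [Ring Λ] [StarRing Λ]
variable {M : Type u} [AddCommGroup M] [Module Λ M] {N : Type u} [AddCommGroup N] [Module Λ N]
variable {ι κ ι' κ' : Type} [Fintype ι] [DecidableEq ι] [Fintype κ] [DecidableEq κ]
  [Fintype ι'] [DecidableEq ι'] [Fintype κ'] [DecidableEq κ']
variable {Z : AddSubgroup (KTilde Λ)}

theorem IsStarInvariant.cls_glStar_mem (hZ : IsStarInvariant Z) (A : GLn Λ ι)
    (hA : KTilde.cls A ∈ Z) : KTilde.cls (glStar A) ∈ Z := by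
  have h := hZ _ (glReindex (Fintype.equivFin ι) A) (by rwa [KTilde.cls_reindex])
  have e : glStar (glReindex (Fintype.equivFin ι) A)
      = glReindex (Fintype.equivFin ι) (glStar A) := by
    ext i j
    rfl
  rwa [e, KTilde.cls_reindex] at h

/-- Stabilisation commutes with dualisation because the standard basis of a free module is its own
dual; this lets a matrix in stabilised bases be dualised. -/
theorem stabBasis_dualSBasis (B : Basis ι Λ (M × (κ → Λ))) (α : Type) [Fintype α]
    [DecidableEq α] (i : ι ⊕ α) :
    stabBasis (dualSBasis B) α i = dualSBasis (stabBasis B α) i := by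
  have h1 : ∀ (x : M) (s : κ ⊕ α → Λ) (i : ι), (stabBasis B α).repr (x, s) (Sum.inl i)
      = B.repr (x, fun k => s (Sum.inl k)) i := by
    intro x s i
    simp [stabBasis, stabEquiv, LinearEquiv.trans_symm]
    rfl
  have h2 : ∀ (x : M) (s : κ ⊕ α → Λ) (a : α), (stabBasis B α).repr (x, s) (Sum.inr a)
      = s (Sum.inr a) := by
    intro x s a
    simp [stabBasis, stabEquiv, LinearEquiv.trans_symm]
    rfl
  have e1 : ∀ k : κ, (fun l => (Pi.single (Sum.inl k) 1 : κ ⊕ α → Λ) (Sum.inl l))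
      = Pi.single k 1 := fun k => by ext l; simp [Pi.single_apply]
  have e2 : ∀ k : α, (fun l : κ => (Pi.single (Sum.inr k) 1 : κ ⊕ α → Λ) (Sum.inl l))
      = 0 := fun k => by ext l; simp
  rw [dualSBasis_apply]
  rcases i with i | i
  · rw [stabBasis_inl, dualSBasis_apply]
    refine Prod.ext (Dual.ext fun x => ?_) (funext fun k => ?_)
    · exact (h1 x 0 i).symm
    · rcases k with k | k
      · simp only [h1, e1]
        rfl
      · simp only [h1, e2, Prod.mk_zero_zero, map_zero, Finsupp.zero_apply, star_zero]
        rfl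
  · rw [stabBasis_inr]
    refine Prod.ext (Dual.ext fun x => ?_) (funext fun k => ?_)
    · exact (h2 x 0 i).symm
    · rcases k with k | k
      · simp only [h2]
        simp
      · simp only [h2]
        simp [Pi.single_apply, apply_ite star, eq_comm]

/-- The left side evaluates a dual basis functional at `x`; the star undoes the conjugation in the
identification of `(Λ^κ)*` with `Λ^κ`. -/
theorem dualSBasis_pairing (B : Basis ι Λ (M × (κ → Λ))) (i : ι) (x : M × (κ → Λ)) :
    (dualSBasis B i).1 x.1 + ∑ k, x.2 k * star ((dualSBasis B i).2 k) = B.repr x i := by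
  rw [dualSBasis_apply]
  simp only [star_star]
  have : x = (x.1, 0) + ∑ k, x.2 k • (0, Pi.single k 1) := by
    refine Prod.ext (by simp [Prod.fst_sum]) (funext fun l => ?_)
    simp [Prod.snd_sum, Pi.single_apply]
  conv_rhs => rw [this]
  simp only [map_add, map_sum, map_smul, Finsupp.add_apply, Finsupp.coe_finsetSum,
    Finset.sum_apply, Finsupp.smul_apply, smul_eq_mul]
  rfl

/-- In dual bases the dual map has the conjugate transpose matrix, so the invariance of `Z` is
exactly what is required. -/
theorem TorsionIn.dual (hZ : IsStarInvariant Z) {B : Basis ι Λ (M × (κ → Λ))}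
    {C : Basis ι' Λ (N × (κ' → Λ))} {f : M ≃ₗ[Λ] N} (h : TorsionIn Z B C f) :
    TorsionIn Z (dualSBasis C) (dualSBasis B) (dualEquiv f) := by
  obtain ⟨α, β, _, _, _, _, θ, σ, A, hA, hm⟩ := h
  refine ⟨β, α, inferInstance, inferInstance, inferInstance, inferInstance, θ.symm, σ.symm,
    glReindex σ (glStar A), fun i j => ?_, ?_⟩
  · have e : (stabBasis (dualSBasis B) α) = dualSBasis (stabBasis B α) :=
      Basis.eq_of_apply_eq (stabBasis_dualSBasis B α)
    rw [e, stabBasis_dualSBasis, dualSBasis_repr, glReindex_apply]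
    change star ((A : Matrix _ _ Λ) (σ.symm j) (σ.symm i)) = _
    rw [hA, Equiv.apply_symm_apply, ← dualSBasis_pairing]
    congr 2
    -- The two pairings differ only in which stabilising index set is summed over.
    refine (Equiv.sum_comp θ _).symm.trans ?_
    simp [stabMap_apply]
  · rw [KTilde.cls_reindex]
    exact hZ.cls_glStar_mem A hm

end TorsionDual

/-! ### Simple isomorphisms of based modules. -/

section SimpleIsos

variable {Λ : Type u} [Ring Λ] {Z : AddSubgroup (KTilde Λ)}
variable {M : Type u} [AddCommGroup M] [Module Λ M] {N : Type u} [AddCommGroup N] [Module Λ N]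
variable {P : Type u} [AddCommGroup P] [Module Λ P] {Q : Type u} [AddCommGroup Q] [Module Λ Q]

theorem IsSimple.refl (b : SBasis Λ M) : IsSimple Z b b (LinearEquiv.refl Λ M) :=
  (BasisMatches.refl _).torsionIn

theorem IsSimple.trans {b : SBasis Λ M} {c : SBasis Λ N} {d : SBasis Λ P} {f : M ≃ₗ[Λ] N}
    {g : N ≃ₗ[Λ] P} (hf : IsSimple Z b c f) (hg : IsSimple Z c d g) :
    IsSimple Z b d (f.trans g) :=
  TorsionIn.trans hf hg

theorem IsSimple.symm {b : SBasis Λ M} {c : SBasis Λ N} {f : M ≃ₗ[Λ] N}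
    (hf : IsSimple Z b c f) : IsSimple Z c b f.symm :=
  TorsionIn.symm hf

theorem IsSimple.prodCongr {b : SBasis Λ M} {c : SBasis Λ N} {b' : SBasis Λ P} {c' : SBasis Λ Q}
    {f : M ≃ₗ[Λ] N} {g : P ≃ₗ[Λ] Q} (hf : IsSimple Z b c f) (hg : IsSimple Z b' c' g) :
    IsSimple Z (b.sum b') (c.sum c') (f.prodCongr g) :=
  TorsionIn.sum hf hg

theorem isSimple_comm (b : SBasis Λ M) (c : SBasis Λ N) :
    IsSimple Z (b.sum c) (c.sum b) (LinearEquiv.prodComm Λ M N) :=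
  (basisMatches_comm _ _).torsionIn

theorem isSimple_assoc (b : SBasis Λ M) (c : SBasis Λ N) (d : SBasis Λ P) :
    IsSimple Z ((b.sum c).sum d) (b.sum (c.sum d)) (LinearEquiv.prodAssoc Λ M N P) :=
  (basisMatches_assoc _ _ _).torsionIn

theorem isSimple_comm4 (b : SBasis Λ M) (c : SBasis Λ N) (d : SBasis Λ P) (e : SBasis Λ Q) :
    IsSimple Z ((b.sum c).sum (d.sum e)) ((b.sum d).sum (c.sum e))
      (LinearEquiv.prodProdProdComm Λ M N P Q) :=
  (basisMatches_comm4 _ _ _ _).torsionIn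

theorem isSimple_shear (b : SBasis Λ M) (c : SBasis Λ N) (a : N →ₗ[Λ] M) :
    IsSimple Z (b.sum c) (b.sum c) (shear a) :=
  torsionIn_shear _ _ _

/-- The unipotent automorphism `(x, y) ↦ (x, y + a x)`. -/
def shearSnd (a : M →ₗ[Λ] N) : (M × N) ≃ₗ[Λ] (M × N) :=
  (LinearEquiv.prodComm Λ M N).trans ((shear a).trans (LinearEquiv.prodComm Λ N M))

@[simp] theorem shearSnd_apply (a : M →ₗ[Λ] N) (z : M × N) :
    shearSnd a z = (z.1, z.2 + a z.1) := rfl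

theorem isSimple_shearSnd (b : SBasis Λ M) (c : SBasis Λ N) (a : M →ₗ[Λ] N) :
    IsSimple Z (b.sum c) (b.sum c) (shearSnd a) :=
  (isSimple_comm _ _).trans ((isSimple_shear _ _ a).trans (isSimple_comm _ _))

theorem isSimple_sign (b : SBasis Λ M) (ε : ℤˣ) : IsSimple Z b b (signEquiv Λ M ε) :=
  torsionIn_sign Z b.basis ε

theorem isSimple_map (b : SBasis Λ M) (f : M ≃ₗ[Λ] N) : IsSimple Z b (b.map f) f :=
  (basisMatches_map _ _).torsionIn

theorem isSimple_rangeBase (b : SBasis Λ N) (f : N →ₗ[Λ] M) (hf : Function.Injective f) :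
    IsSimple Z b (rangeBase b f hf) (LinearEquiv.ofInjective f hf) :=
  isSimple_map _ _

/-- The ranges carry transported bases, so the induced map is `e` in disguise. It supplies the
isomorphisms of Lagrangians and of half rank summands demanded of an isomorphism of
quasi-formations. -/
theorem IsSimple.range {b : SBasis Λ P} {c : SBasis Λ Q} {e : P ≃ₗ[Λ] Q}
    (he : IsSimple Z b c e) {j : P →ₗ[Λ] M} (hj : Function.Injective j) {k : Q →ₗ[Λ] N}
    (hk : Function.Injective k) (f : M ≃ₗ[Λ] N) (h : ∀ x, f (j x) = k (e x)) :
    ∃ g : LinearMap.range j ≃ₗ[Λ] LinearMap.range k, (∀ l : LinearMap.range j, (g l : N) = f l) ∧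
      IsSimple Z (rangeBase b j hj) (rangeBase c k hk) g := by
  refine ⟨((LinearEquiv.ofInjective j hj).symm.trans e).trans (LinearEquiv.ofInjective k hk),
    fun l => ?_, ((isSimple_rangeBase b j hj).symm.trans he).trans (isSimple_rangeBase c k hk)⟩
  obtain ⟨x, rfl⟩ := (LinearEquiv.ofInjective j hj).surjective l
  rw [LinearEquiv.trans_apply, LinearEquiv.trans_apply, LinearEquiv.symm_apply_apply]
  exact (h x).symm

end SimpleIsos

/-! ### Simple isomorphisms and double duals. -/

section SimpleDuals

variable {Λ : Type u} [Ring Λ] [StarRing Λ] {Z : AddSubgroup (KTilde Λ)}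
variable {M : Type u} [AddCommGroup M] [Module Λ M] {N : Type u} [AddCommGroup N] [Module Λ N]

theorem IsSimple.dual (hZ : IsStarInvariant Z) {b : SBasis Λ M} {c : SBasis Λ N} {f : M ≃ₗ[Λ] N}
    (hf : IsSimple Z b c f) : IsSimple Z c.dual b.dual (dualEquiv f) :=
  TorsionIn.dual hZ hf

theorem isSimple_dualProd (b : SBasis Λ M) (c : SBasis Λ N) :
    IsSimple Z (b.dual.sum c.dual) (b.sum c).dual (dualProd M N) :=
  (basisMatches_dualProd _ _).torsionIn

theorem isSimple_evalEquiv (b : SBasis Λ M) : IsSimple Z b b.dual.dual (evalEquiv b) :=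
  (basisMatches_eval b.basis (evalEquiv b) fun _ => rfl).torsionIn

theorem evalEquiv_apply (b : SBasis Λ M) (x : M) (g : Dual Λ M) :
    evalEquiv b x g = star (g x) := rfl

theorem evalEquiv_symm_apply (b : SBasis Λ M) (F : Dual Λ (Dual Λ M)) (g : Dual Λ M) :
    g ((evalEquiv b).symm F) = star (F g) := by
  obtain ⟨x, rfl⟩ := (evalEquiv b).surjective F
  rw [LinearEquiv.symm_apply_apply, evalEquiv_apply, star_star]

/-- The evaluation map into the double dual is injective for stably free modules, so elements can be
tested by functionals. -/
theorem SBasis.eq_zero_of_dual (b : SBasis Λ M) {x : M} (h : ∀ g : Dual Λ M, g x = 0) : x = 0 := by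
  refine (evalEquiv b).injective (Dual.ext fun g => ?_)
  rw [evalEquiv_apply, h, map_zero, star_zero, Dual.zero_apply]

end SimpleDuals

/-! ### Boundaries depend only on the class of the asymmetric form. -/

section Boundaries

variable {Λ : Type u} [Ring Λ] [StarRing Λ] {ε : ℤˣ} {Z : AddSubgroup (KTilde Λ)}
variable {M : Type u} [AddCommGroup M] [Module Λ M] {N : Type u} [AddCommGroup N] [Module Λ N]

theorem QuadGroup.mk_sub_dualityInv (ρ φ : M →ₗ[Λ] Dual Λ M) :
    QuadGroup.mk ε (ρ + (φ - dualityInv ε M φ)) = QuadGroup.mk ε ρ := by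
  have h : QuadGroup.mk ε (φ - dualityInv ε M φ) = 0 :=
    (QuotientAddGroup.eq_zero_iff _).2 ⟨φ, rfl⟩
  have h' : QuadGroup.mk ε (ρ + (φ - dualityInv ε M φ))
    = QuadGroup.mk ε ρ + QuadGroup.mk ε (φ - dualityInv ε M φ) := rfl
  rw [h', h, add_zero]

theorem QuadGroup.mk_dualityInv (φ : M →ₗ[Λ] Dual Λ M) :
    QuadGroup.mk ε (dualityInv ε M φ) = QuadGroup.mk ε φ := by
  rw [← QuadGroup.mk_sub_dualityInv (dualityInv ε M φ) φ, add_sub_cancel]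

theorem QuadGroup.mk_eq_mk {ρ ρ' : M →ₗ[Λ] Dual Λ M}
    (h : QuadGroup.mk ε ρ = QuadGroup.mk ε ρ') :
    ∃ φ : M →ₗ[Λ] Dual Λ M, ρ' = ρ + (φ - dualityInv ε M φ) := by
  obtain ⟨φ, hφ⟩ := QuotientAddGroup.eq.1 h
  exact ⟨φ, by rw [← neg_add_eq_iff_eq_add]; exact hφ.symm⟩

theorem QuasiFormation.IsIso.add {x y x' y' : QuasiFormation Λ ε Z} (h : x.IsIso y)
    (h' : x'.IsIso y') : (x + x').IsIso (y + y') := by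
  obtain ⟨f, ⟨h1, h2⟩, ⟨g, hg, mg⟩, ⟨k, hk, mk⟩⟩ := h
  obtain ⟨f', ⟨h1', h2'⟩, ⟨g', hg', mg'⟩, ⟨k', hk', mk'⟩⟩ := h'
  refine ⟨f.prodCongr f', ⟨?_, h2.prodCongr h2'⟩,
    ⟨(prodSub _ _).symm.trans ((g.prodCongr g').trans (prodSub _ _)),
      fun l => Prod.ext (hg _) (hg' _), (isSimple_map _ _).symm.trans
        ((mg.prodCongr mg').trans (isSimple_map _ _))⟩,
    ⟨(prodSub _ _).symm.trans ((k.prodCongr k').trans (prodSub _ _)),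
      fun l => Prod.ext (hk _) (hk' _), (isSimple_map _ _).symm.trans
        ((mk.prodCongr mk').trans (isSimple_map _ _))⟩⟩
  change QuadGroup.pull ε _ (QuadGroup.sum y.form.ψ y'.form.ψ)
    = QuadGroup.sum x.form.ψ x'.form.ψ
  rw [← h1, ← h1', QuadGroup.sum, QuadGroup.sum, map_add]
  simp only [QuadGroup.pull_pull]
  rfl

theorem QuasiFormation.IsIso.cls_eq {x y : QuasiFormation Λ ε Z} (h : x.IsIso y) :
    x.cls = y.cls :=
  QuasiFormation.cls_eq (Rel.stableIso _ _ (BasedModule.zero Λ) (BasedModule.zero Λ)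
    (h.add (StrictIso.refl _).isIso))

variable (ε Z) in
/-- The simple Lagrangian `P*` of `H_ε(P) = P ⊕ P*`. -/
def hypDualLagrangian (b : SBasis Λ M) :
    SimpleLagrangian Z (b.sum b.dual) (QuadGroup.mk ε (hypHom Λ M)) where
  sub := LinearMap.range (LinearMap.inr Λ M (Dual Λ M))
  base := rangeBase b.dual (LinearMap.inr Λ M (Dual Λ M)) LinearMap.inr_injective
  summand := ⟨_, isCompl_inl_inr.symm⟩
  eq_annihilator := by
    ext ⟨x, f⟩
    rw [mem_annihilator]
    constructor
    · rintro ⟨f', hx⟩ _ ⟨g, rfl⟩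
      have hf : x = 0 := (congrArg Prod.fst hx).symm
      rw [symm_hyp, hf]
      simp
    · intro h
      refine ⟨f, Prod.ext (b.eq_zero_of_dual fun g => ?_).symm rfl⟩
      have := h (0, g) ⟨g, rfl⟩
      rw [symm_hyp] at this
      rcases Int.units_eq_one_or ε with rfl | rfl <;> simpa using this
  isotropic := by
    rw [QuadGroup.pull_mk]
    have : pullHom (LinearMap.range (LinearMap.inr Λ M (Dual Λ M))).subtype (hypHom Λ M) = 0 := by
      refine LinearMap.ext fun x => Dual.ext fun y => ?_
      obtain ⟨_, x, rfl⟩ := x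
      obtain ⟨_, y, rfl⟩ := y
      exact map_zero x
    rw [this]
    rfl
  hamiltonian := by
    let e := LinearEquiv.ofInjective (LinearMap.inr Λ M (Dual Λ M)) LinearMap.inr_injective
    have hm : BasisMatches (dualSBasis b.basis) (mapBasis (dualSBasis b.basis) e) e :=
      basisMatches_map _ e
    -- The complement is `P** = P`. The sign compensates the factor `ε` with which the symmetrised
    -- hyperbolic form pairs `P` with `P*`.
    refine ⟨(e.symm.prodCongr (((dualEquiv e).trans (evalEquiv b).symm).trans
      (signEquiv Λ M ε))).trans (LinearEquiv.prodComm Λ _ _), ?_, ?_, ?_⟩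
    · intro x
      obtain ⟨x, rfl⟩ := e.surjective x
      refine Prod.ext ?_ (e.symm_apply_apply x)
      change signEquiv Λ M ε ((evalEquiv b).symm (dualEquiv e 0)) = 0
      simp
    · intro F
      refine Dual.ext fun y => ?_
      obtain ⟨y, rfl⟩ := e.surjective y
      change (e.symm 0 : Dual Λ M) (0 : M) + (ε : ℤ) • star (y (signEquiv Λ M ε
        ((evalEquiv b).symm (dualEquiv e F)))) = F (e y)
      rw [signEquiv_apply, map_zsmul, star_zsmul, evalEquiv_symm_apply, star_star, smul_smul,
        Int.units_coe_mul_self, one_smul, map_zero, zero_add]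
      rfl
    · have t1 : IsSimple Z (rangeBase b.dual (LinearMap.inr Λ M (Dual Λ M))
          LinearMap.inr_injective) b.dual e.symm := (isSimple_map b.dual e).symm
      have t2 : IsSimple Z (rangeBase b.dual (LinearMap.inr Λ M (Dual Λ M))
          LinearMap.inr_injective).dual b.dual.dual (dualEquiv e) := hm.dual.symm.torsionIn
      have t3 := (t2.trans (isSimple_evalEquiv b).symm).trans (isSimple_sign b ε)
      exact (t1.prodCongr t3).trans (isSimple_comm b.dual b)

/-- A quasi-formation with the form of `H_ε(K)`, the Lagrangian `K*` and the graph of `(K, ρ)`. -/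
def QuasiFormation.dualBoundary (ε : ℤˣ) (Z : AddSubgroup (KTilde Λ)) (K : BasedModule.{u} Λ)
    (ρ : K.carrier →ₗ[Λ] Dual Λ K.carrier) : QuasiFormation Λ ε Z where
  form := QForm.hyp ε K
  simple := hyp_isSimple ε Z K
  lag := hypDualLagrangian ε Z K.base
  half := hypGraph K.base ρ

/-- Apply the relation between Lagrangians to `K` and `K*`; the extra summand `(H_ε(K); K, K*)` is
trivial. The gain is that `K*`, unlike `K`, is preserved by all shears that move one graph over `K`
to another. -/
theorem QuasiFormation.cls_boundary_eq_cls_dualBoundary (K : BasedModule.{u} Λ)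
    (ρ : K.carrier →ₗ[Λ] Dual Λ K.carrier) :
    (boundary ε Z K ρ).cls = (dualBoundary ε Z K ρ).cls := by
  have h := cls_eq (Rel.shift (QForm.hyp ε K) (hyp_isSimple ε Z K) (hypLagrangian ε Z K.base)
    (hypDualLagrangian ε Z K.base) (hypGraph K.base ρ))
  have h' : (trivial ε Z K).cls + (dualBoundary ε Z K ρ).cls = (boundary ε Z K ρ).cls := h
  rw [← h', cls_trivial, zero_add]

/-- The shear by `φ - T_ε φ` changes the hyperbolic form by an element of the image of `1 - T_ε`,
hence is an isometry. It fixes `K*` and carries one graph to the other. -/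
theorem QuasiFormation.cls_boundary_congr (K : BasedModule.{u} Λ)
    {ρ ρ' : K.carrier →ₗ[Λ] Dual Λ K.carrier} (h : QuadGroup.mk ε ρ = QuadGroup.mk ε ρ') :
    (boundary ε Z K ρ).cls = (boundary ε Z K ρ').cls := by
  obtain ⟨φ, rfl⟩ := QuadGroup.mk_eq_mk h
  rw [cls_boundary_eq_cls_dualBoundary, cls_boundary_eq_cls_dualBoundary]
  refine IsIso.cls_eq ⟨shearSnd (φ - dualityInv ε _ φ), ⟨?_, isSimple_shearSnd _ _ _⟩,
    (IsSimple.refl K.base.dual).range _ _ _ fun x => ?_,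
    (IsSimple.refl K.base).range _ _ _ fun x => ?_⟩
  · change QuadGroup.mk ε (pullHom _ (hypHom Λ K.carrier)) = QuadGroup.mk ε (hypHom Λ K.carrier)
    rw [← QuadGroup.mk_sub_dualityInv (hypHom Λ K.carrier)
      (pullHom (LinearMap.fst Λ K.carrier (Dual Λ K.carrier)) φ)]
    congr 1
  · refine Prod.ext rfl ?_
    change x + (φ - dualityInv ε _ φ) 0 = x
    rw [map_zero, add_zero]
  · rfl

/-- The graph of zero is `K` itself, so after the change of Lagrangian the quasi-formation is
`(H_ε(K); K*, K)`, which is the trivial formation on `K*` once `K` is identified with `K**`. -/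
theorem QuasiFormation.cls_boundary_zero (K : BasedModule.{u} Λ) :
    (boundary ε Z K 0).cls = 0 := by
  rw [cls_boundary_eq_cls_dualBoundary, ← cls_trivial K.dual]
  -- With this sign the form of `H_ε(K*)` pulls back to `T_ε` of the form of `H_ε(K)`, which has the
  -- same class in `Q_ε`.
  let e := (signEquiv Λ K.carrier ε).trans (evalEquiv K.base)
  have he : IsSimple Z K.base K.base.dual.dual e :=
    (isSimple_sign K.base ε).trans (isSimple_evalEquiv K.base)
  refine IsIso.cls_eq ⟨(LinearEquiv.prodComm Λ _ _).trans
    ((LinearEquiv.refl Λ (Dual Λ K.carrier)).prodCongr e), ⟨?_, (isSimple_comm _ _).trans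
      ((IsSimple.refl _).prodCongr he)⟩,
    (IsSimple.refl K.base.dual).range _ _ _ fun x => ?_, he.range _ _ _ fun x => ?_⟩
  · change QuadGroup.mk ε (pullHom _ (hypHom Λ (Dual Λ K.carrier)))
      = QuadGroup.mk ε (hypHom Λ K.carrier)
    rw [← QuadGroup.mk_dualityInv (hypHom Λ K.carrier)]
    congr 1
    refine LinearMap.ext fun x => Dual.ext fun y => ?_
    change star ((y.2 : Dual Λ K.carrier) (signEquiv Λ K.carrier ε x.1)) = _
    rw [signEquiv_apply, map_zsmul, star_zsmul]
    rfl
  · exact Prod.ext rfl (map_zero e)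
  · rfl

/-- The map `f ⊕ (f*)⁻¹` preserves evaluation, hence the hyperbolic form, and respects Lagrangians
and graphs. Its second summand is simple only because duals of simple isomorphisms are. -/
theorem QuasiFormation.isIso_boundary (hZ : IsStarInvariant Z) {K K' : BasedModule.{u} Λ}
    {f : K.carrier ≃ₗ[Λ] K'.carrier} (hf : IsSimple Z K.base K'.base f)
    (ρ : K'.carrier →ₗ[Λ] Dual Λ K'.carrier) :
    (boundary ε Z K (pullHom f.toLinearMap ρ)).IsIso (boundary ε Z K' ρ) := by
  refine ⟨f.prodCongr (dualEquiv f).symm, ⟨?_, hf.prodCongr (hf.dual hZ).symm⟩,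
    hf.range _ _ _ fun x => Prod.ext rfl (map_zero (dualEquiv f).symm),
    hf.range _ _ _ fun x => Prod.ext rfl ?_⟩
  · change QuadGroup.mk ε (pullHom _ (hypHom Λ K'.carrier)) = QuadGroup.mk ε (hypHom Λ K.carrier)
    congr 1
    refine LinearMap.ext fun x => Dual.ext fun y => ?_
    exact congrArg x.2 (f.symm_apply_apply y.1)
  · change (dualEquiv f).symm (pullHom f.toLinearMap ρ x) = ρ (f x)
    rw [LinearEquiv.symm_apply_eq]
    rfl

end Boundaries

/-! ### Boundary and induced form as mutually inverse maps. -/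

section ElementaryIso

variable {Λ : Type u} [Ring Λ] [StarRing Λ] {ε : ℤˣ} {Z : AddSubgroup (KTilde Λ)}

theorem QuadGroup.pull_zero_sum {M N P : Type u} [AddCommGroup M] [Module Λ M] [AddCommGroup N]
    [Module Λ N] [AddCommGroup P] [Module Λ P] (f : P →ₗ[Λ] M × N) (ψ : QuadGroup Λ ε M) :
    QuadGroup.pull ε f (QuadGroup.sum ψ (0 : QuadGroup Λ ε N))
      = QuadGroup.pull ε ((LinearMap.fst Λ M N).comp f) ψ := by
  rw [QuadGroup.sum, map_zero, add_zero, QuadGroup.pull_pull]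

theorem QForm.IsSimpleIsometry.cls_eq {v w : QForm Λ ε} {f : v.carrier ≃ₗ[Λ] w.carrier}
    (h : QForm.IsSimpleIsometry Z v w f) : v.cls Z = w.cls Z := by
  refine QForm.cls_eq ⟨BasedModule.zero Λ, BasedModule.zero Λ,
    f.prodCongr (LinearEquiv.refl Λ _), ?_, h.2.prodCongr (IsSimple.refl _)⟩
  change QuadGroup.pull ε _ (QuadGroup.sum w.ψ 0) = QuadGroup.sum v.ψ 0
  rw [QuadGroup.pull_zero_sum, QuadGroup.sum, map_zero, add_zero, ← h.1, QuadGroup.pull_pull]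
  rfl

theorem QForm.cls_zero (P : BasedModule.{u} Λ) : (QForm.zero ε P).cls Z = 0 := by
  refine QForm.cls_eq ⟨BasedModule.zero Λ, P, LinearEquiv.prodComm Λ _ _, ?_,
    isSimple_comm _ _⟩
  change QuadGroup.pull ε _ (QuadGroup.sum 0 0) = QuadGroup.sum 0 0
  simp only [QuadGroup.sum, map_zero, add_zero]

/-- The class of the boundary of a form. -/
def QForm.boundaryCls (Z : AddSubgroup (KTilde Λ)) (v : QForm Λ ε) : LMonoid ε Z :=
  (QuasiFormation.boundary ε Z v.mod (Quotient.out v.ψ)).cls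

/-- The representative picked by `Quotient.out` is irrelevant, since the boundary class depends only
on the class in `Q_ε`. -/
theorem QForm.boundaryCls_ofHom (K : BasedModule.{u} Λ)
    (ρ : K.carrier →ₗ[Λ] Dual Λ K.carrier) :
    (QForm.ofHom ε K ρ).boundaryCls Z = (QuasiFormation.boundary ε Z K ρ).cls :=
  QuasiFormation.cls_boundary_congr K (Quotient.out_eq' (QuadGroup.mk ε ρ))

theorem QForm.exists_ofHom (v : QForm Λ ε) : ∃ ρ, v = QForm.ofHom ε v.mod ρ := by
  obtain ⟨K, ψ⟩ := v
  obtain ⟨ρ, rfl⟩ := QuotientAddGroup.mk_surjective ψ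
  exact ⟨ρ, rfl⟩

theorem QForm.boundaryCls_add (v w : QForm Λ ε) :
    (v + w).boundaryCls Z = v.boundaryCls Z + w.boundaryCls Z := by
  obtain ⟨ρ, hv⟩ := v.exists_ofHom
  obtain ⟨σ, hw⟩ := w.exists_ofHom
  rw [hv, hw, boundaryCls_ofHom, boundaryCls_ofHom]
  exact (boundaryCls_ofHom (v.mod.sum w.mod) _).trans
    (QuasiFormation.cls_eq (QuasiFormation.strictIso_boundary _ _ ρ σ).rel).symm

theorem QForm.boundaryCls_zero (P : BasedModule.{u} Λ) :
    (QForm.zero ε P).boundaryCls Z = 0 := by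
  rw [← QuasiFormation.cls_boundary_zero P, ← boundaryCls_ofHom]
  rfl

theorem QForm.IsSimpleIsometry.boundaryCls_eq (hZ : IsStarInvariant Z) {v w : QForm Λ ε}
    {f : v.carrier ≃ₗ[Λ] w.carrier} (h : QForm.IsSimpleIsometry Z v w f) :
    v.boundaryCls Z = w.boundaryCls Z := by
  obtain ⟨K, ψ⟩ := v
  obtain ⟨K', ψ'⟩ := w
  obtain ⟨σ, rfl⟩ := QuotientAddGroup.mk_surjective ψ'
  obtain ⟨h1, h2⟩ := h
  let g : K.carrier ≃ₗ[Λ] K'.carrier := f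
  have h3 := (QuasiFormation.isIso_boundary (ε := ε) (f := g) hZ h2 σ).cls_eq
  rw [← boundaryCls_ofHom, ← boundaryCls_ofHom] at h3
  have h4 : QForm.ofHom ε K (pullHom g.toLinearMap σ) = ⟨K, ψ⟩ := congrArg (QForm.mk K) h1
  rw [h4] at h3
  exact h3

/-- Additivity splits off the boundaries of the zero forms, and those vanish. -/
theorem QForm.ZeroStablyIsometric.boundaryCls_eq (hZ : IsStarInvariant Z) {v w : QForm Λ ε}
    (h : v.ZeroStablyIsometric Z w) : v.boundaryCls Z = w.boundaryCls Z := by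
  obtain ⟨P, Q, f, hf⟩ := h
  have := hf.boundaryCls_eq hZ
  rwa [boundaryCls_add, boundaryCls_add, boundaryCls_zero, boundaryCls_zero, add_zero,
    add_zero] at this

/-- The homomorphism of monoids that sends a form to the class of its boundary. -/
def boundaryHom (ε : ℤˣ) (hZ : IsStarInvariant Z) : ZeroStabForms ε Z →+ LMonoid ε Z where
  toFun x := AddCon.liftOn x (QForm.boundaryCls Z) fun v w h => by
    have hle : addConGen (QForm.ZeroStablyIsometric (ε := ε) Z) ≤
        AddCon.ker (AddHom.mk (QForm.boundaryCls Z) QForm.boundaryCls_add) :=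
      AddCon.addConGen_le.2 fun _ _ h => h.boundaryCls_eq hZ
    exact hle h
  map_zero' := QForm.boundaryCls_zero (BasedModule.zero Λ)
  map_add' x y := by
    induction x using Quotient.inductionOn' with | h v => ?_
    induction y using Quotient.inductionOn' with | h w => ?_
    exact QForm.boundaryCls_add v w

theorem QuadGroup.pull_prodSub {M N : Type u} [AddCommGroup M] [Module Λ M] [AddCommGroup N]
    [Module Λ N] (L : Submodule Λ M) (L' : Submodule Λ N) (ψ : QuadGroup Λ ε M)
    (ψ' : QuadGroup Λ ε N) : QuadGroup.pull ε (prodSub L L').toLinearMap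
      (QuadGroup.pull ε (L.prod L').subtype (QuadGroup.sum ψ ψ'))
      = QuadGroup.sum (QuadGroup.pull ε L.subtype ψ) (QuadGroup.pull ε L'.subtype ψ') := by
  obtain ⟨ρ, rfl⟩ := QuotientAddGroup.mk_surjective ψ
  obtain ⟨σ, rfl⟩ := QuotientAddGroup.mk_surjective ψ'
  rfl

theorem QuasiFormation.induced_add (x y : QuasiFormation Λ ε Z) :
    (x + y).induced.cls Z = x.induced.cls Z + y.induced.cls Z := by
  rw [← QForm.cls_add]
  symm
  refine QForm.IsSimpleIsometry.cls_eq (f := prodSub x.half.sub y.half.sub) ⟨?_, isSimple_map _ _⟩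
  exact QuadGroup.pull_prodSub _ _ _ _

theorem QuasiFormation.IsIso.induced_cls_eq {x y : QuasiFormation Λ ε Z} (h : x.IsIso y) :
    x.induced.cls Z = y.induced.cls Z := by
  obtain ⟨f, ⟨h1, -⟩, -, ⟨g, hg, mg⟩⟩ := h
  refine QForm.IsSimpleIsometry.cls_eq (f := g) ⟨?_, mg⟩
  refine (QuadGroup.pull_pull ε g.toLinearMap y.half.sub.subtype y.form.ψ).trans ?_
  have h2 := QuadGroup.pull_pull ε x.half.sub.subtype f.toLinearMap y.form.ψ
  have h3 : y.half.sub.subtype.comp g.toLinearMap = f.toLinearMap.comp x.half.sub.subtype :=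
    LinearMap.ext hg
  rw [h3, ← h2, h1]
  rfl

theorem QuasiFormation.induced_cls_eq_zero (x : QuasiFormation Λ ε Z)
    (h : QuadGroup.pull ε x.half.sub.subtype x.form.ψ = 0) : x.induced.cls Z = 0 := by
  rw [← QForm.cls_zero ⟨x.half.sub, x.half.base⟩, induced, h]
  rfl

theorem QuasiFormation.induced_trivial (P : BasedModule.{u} Λ) :
    (trivial ε Z P).induced.cls Z = 0 :=
  induced_cls_eq_zero _ (hypDualLagrangian ε Z P.base).isotropic

/-- Trivial formations, and quasi-formations whose half rank summand is a Lagrangian, induce zero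
forms. The latter accounts for the summand `(M, ψ; K, L)`; the other two terms of that relation
share the summand `V` and the ambient form. -/
theorem QuasiFormation.Rel.induced_cls_eq {x y : QuasiFormation Λ ε Z} (h : Rel x y) :
    x.induced.cls Z = y.induced.cls Z := by
  rcases h with ⟨_, _, P, Q, h⟩ | ⟨v, hv, K, L, V⟩
  · have := h.induced_cls_eq
    rwa [induced_add, induced_add, induced_trivial, induced_trivial, add_zero, add_zero] at this
  · rw [induced_add, induced_cls_eq_zero _ L.isotropic, zero_add]
    rfl

/-- The homomorphism of monoids that sends a quasi-formation to its induced form. -/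
def inducedHom (ε : ℤˣ) (Z : AddSubgroup (KTilde Λ)) : LMonoid ε Z →+ ZeroStabForms ε Z where
  toFun x := AddCon.liftOn x (fun y => y.induced.cls Z) fun v w h => by
    have hle : addConGen (QuasiFormation.Rel (Λ := Λ) (ε := ε) (Z := Z)) ≤
        AddCon.ker (AddHom.mk (fun y : QuasiFormation Λ ε Z => y.induced.cls Z)
          QuasiFormation.induced_add) :=
      AddCon.addConGen_le.2 fun _ _ h => h.induced_cls_eq
    exact hle h
  map_zero' := QuasiFormation.induced_trivial (BasedModule.zero Λ)
  map_add' x y := by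
    induction x using Quotient.inductionOn' with | h v => ?_
    induction y using Quotient.inductionOn' with | h w => ?_
    exact QuasiFormation.induced_add v w

/-- Along `x ↦ (x, ρ x)` the hyperbolic form pulls back to `ρ` on the nose, already before passing
to `Q_ε`. -/
theorem QuasiFormation.induced_boundary (K : BasedModule.{u} Λ)
    (ρ : K.carrier →ₗ[Λ] Dual Λ K.carrier) :
    (boundary ε Z K ρ).induced.cls Z = (QForm.ofHom ε K ρ).cls Z := by
  symm
  exact QForm.IsSimpleIsometry.cls_eq (w := (boundary ε Z K ρ).induced)
    (f := LinearEquiv.ofInjective (LinearMap.id.prod ρ) fun _ _ h => congrArg Prod.fst h)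
    ⟨rfl, isSimple_map _ _⟩

theorem boundaryHom_ofHom (hZ : IsStarInvariant Z) (K : BasedModule.{u} Λ)
    (ρ : K.carrier →ₗ[Λ] Dual Λ K.carrier) : boundaryHom ε hZ ((QForm.ofHom ε K ρ).cls Z)
      = (QuasiFormation.boundary ε Z K ρ).cls :=
  QForm.boundaryCls_ofHom K ρ

theorem inducedHom_boundaryHom (hZ : IsStarInvariant Z) (x : ZeroStabForms ε Z) :
    inducedHom ε Z (boundaryHom ε hZ x) = x := by
  induction x using Quotient.inductionOn' with | h v => ?_
  obtain ⟨ρ, hv⟩ := v.exists_ofHom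
  change inducedHom ε Z (boundaryHom ε hZ (v.cls Z)) = v.cls Z
  rw [hv, boundaryHom_ofHom]
  exact QuasiFormation.induced_boundary _ ρ

/-- The isomorphism from the monoid of `0`-stabilised forms to the monoid of elementary elements. -/
def elementaryEquiv (ε : ℤˣ) (hZ : IsStarInvariant Z) :
    ZeroStabForms ε Z ≃+ Elementary (Λ := Λ) ε Z where
  toFun x := ⟨boundaryHom ε hZ x, by
    induction x using Quotient.inductionOn' with | h v => exact ⟨v.mod, _, rfl⟩⟩
  invFun y := inducedHom ε Z y
  left_inv x := inducedHom_boundaryHom hZ x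
  -- An elementary element is a value of `boundaryHom`, and on such values the left inverse is also
  -- a right inverse.
  right_inv := by
    rintro ⟨_, K, ρ, rfl⟩
    refine Subtype.ext ?_
    change boundaryHom ε hZ (inducedHom ε Z (QuasiFormation.boundary ε Z K ρ).cls) = _
    have h := boundaryHom_ofHom (ε := ε) hZ K ρ
    exact (congrArg (fun t => boundaryHom ε hZ (inducedHom ε Z t)) h.symm).trans
      ((congrArg (boundaryHom ε hZ) (inducedHom_boundaryHom hZ _)).trans h)
  map_add' x y := Subtype.ext (map_add _ x y)

end ElementaryIso

/-! ### Grothendieck groups and cofinal submonoids. -/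

section GrothendieckFacts

variable {A B : Type*} [AddCommMonoid A] [AddCommMonoid B]

theorem grMap_of (f : A →+ B) (a : A) : grMap f (Algebra.GrothendieckAddGroup.of a)
    = Algebra.GrothendieckAddGroup.of (f a) := by
  have h := Algebra.GrothendieckAddGroup.lift.symm_apply_apply
    ((Algebra.GrothendieckAddGroup.of (M := B)).comp f)
  exact DFunLike.congr_fun h a

theorem gr_exists_sub (x : Algebra.GrothendieckAddGroup A) : ∃ a b : A,
    x = Algebra.GrothendieckAddGroup.of a - Algebra.GrothendieckAddGroup.of b := by
  obtain ⟨⟨a, b⟩, h⟩ := (AddLocalization.addMonoidOf (⊤ : AddSubmonoid A)).surj x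
  exact ⟨a, b, eq_sub_of_add_eq h⟩

theorem gr_of_eq_iff {a b : A} : Algebra.GrothendieckAddGroup.of a
    = Algebra.GrothendieckAddGroup.of b ↔ ∃ c : A, c + a = c + b := by
  have h := (AddLocalization.addMonoidOf (⊤ : AddSubmonoid A)).eq_iff_exists (x := a) (y := b)
  refine h.trans ⟨fun ⟨c, hc⟩ => ⟨c, hc⟩, fun ⟨c, hc⟩ => ⟨⟨c, trivial⟩, hc⟩⟩

theorem grMap_bijective_of_equiv (e : A ≃+ B) : Function.Bijective (grMap e.toAddMonoidHom) := by
  constructor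
  · rw [injective_iff_map_eq_zero]
    intro x hx
    obtain ⟨a, b, rfl⟩ := gr_exists_sub x
    rw [map_sub, grMap_of, grMap_of, sub_eq_zero, gr_of_eq_iff] at hx
    obtain ⟨c, hc⟩ := hx
    rw [sub_eq_zero, gr_of_eq_iff]
    refine ⟨e.symm c, e.injective ?_⟩
    simpa using hc
  · intro y
    obtain ⟨a, b, rfl⟩ := gr_exists_sub y
    refine ⟨Algebra.GrothendieckAddGroup.of (e.symm a)
      - Algebra.GrothendieckAddGroup.of (e.symm b), ?_⟩
    rw [map_sub, grMap_of, grMap_of]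
    simp

/-- For surjectivity write `a = (a + s) - s`. For injectivity, an element `c` witnessing that two
elements of `S` agree stably may lie outside `S`, but `c + s` is a witness inside it. -/
theorem grMap_subtype_bijective (S : AddSubmonoid A) (h : ∀ a : A, ∃ s ∈ S, a + s ∈ S) :
    Function.Bijective (grMap S.subtype) := by
  constructor
  · rw [injective_iff_map_eq_zero]
    intro x hx
    obtain ⟨a, b, rfl⟩ := gr_exists_sub x
    rw [map_sub, grMap_of, grMap_of, sub_eq_zero, gr_of_eq_iff] at hx
    obtain ⟨c, hc⟩ := hx
    obtain ⟨s, -, hs⟩ := h c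
    rw [sub_eq_zero, gr_of_eq_iff]
    refine ⟨⟨c + s, hs⟩, Subtype.ext ?_⟩
    change c + s + a = c + s + b
    have hc : c + (a : A) = c + b := hc
    rw [add_right_comm c s a, add_right_comm c s b, hc]
  · intro y
    obtain ⟨a, b, rfl⟩ := gr_exists_sub y
    have hof : ∀ a : A, ∃ x, grMap S.subtype x = Algebra.GrothendieckAddGroup.of a := by
      intro a
      obtain ⟨s, hs, has⟩ := h a
      refine ⟨Algebra.GrothendieckAddGroup.of ⟨a + s, has⟩
        - Algebra.GrothendieckAddGroup.of ⟨s, hs⟩, ?_⟩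
      rw [map_sub, grMap_of, grMap_of]
      change Algebra.GrothendieckAddGroup.of (a + s) - Algebra.GrothendieckAddGroup.of s = _
      rw [map_add, add_sub_cancel_right]
    obtain ⟨x, hx⟩ := hof a
    obtain ⟨y, hy⟩ := hof b
    exact ⟨x - y, by rw [map_sub, hx, hy]⟩

end GrothendieckFacts

/-! ### Hyperbolic coordinates along a Lagrangian. -/

section Standardisation

variable {Λ : Type u} [Ring Λ] [StarRing Λ] {ε : ℤˣ} {Z : AddSubgroup (KTilde Λ)}
variable {M : Type u} [AddCommGroup M] [Module Λ M] {N : Type u} [AddCommGroup N] [Module Λ N]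

/-- Any asymmetric form `θ` on `M*` is evaluation against a map `M* → M`, because `M = M**`;
shearing by the negative of that map cancels `θ` exactly. -/
theorem exists_shear_hyp (ε : ℤˣ) (b : SBasis Λ M) (θ : Dual Λ M →ₗ[Λ] Dual Λ (Dual Λ M)) :
    ∃ a : Dual Λ M →ₗ[Λ] M, QuadGroup.pull ε (shear a).toLinearMap (QuadGroup.mk ε (hypHom Λ M
      + pullHom (LinearMap.snd Λ M (Dual Λ M)) θ)) = QuadGroup.mk ε (hypHom Λ M) := by
  let a : Dual Λ M →ₗ[Λ] M := -((evalEquiv b).symm.toLinearMap.comp (dualityInv 1 _ θ))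
  have ha : ∀ f g : Dual Λ M, f (a g) = -θ f g := by
    intro f g
    change f (-((evalEquiv b).symm (dualityInv 1 _ θ g))) = _
    rw [map_neg, evalEquiv_symm_apply]
    simp
  refine ⟨a, ?_⟩
  rw [QuadGroup.pull_mk]
  congr 1
  refine LinearMap.ext fun x => Dual.ext fun y => ?_
  change x.2 (y.1 + a y.2) + θ x.2 y.2 = x.2 y.1
  rw [map_add, ha, neg_add_cancel_right]

/-- Modulo the image of `1 - T_ε`, the block on `M` vanishes by `h1`, and the two mixed blocks
combine into evaluation by `h2`. What survives besides the hyperbolic form is the block on `M*`. -/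
theorem mk_eq_mk_hyp_add (χ : (M × Dual Λ M) →ₗ[Λ] Dual Λ (M × Dual Λ M))
    (φ : M →ₗ[Λ] Dual Λ M) (h1 : ∀ x y, χ (x, 0) (y, 0) = φ x y - (ε : ℤ) • star (φ y x))
    (h2 : ∀ (f : Dual Λ M) (y : M), χ (0, f) (y, 0) + (ε : ℤ) • star (χ (y, 0) (0, f)) = f y) :
    QuadGroup.mk ε χ = QuadGroup.mk ε (hypHom Λ M + pullHom (LinearMap.snd Λ M (Dual Λ M))
      (pullHom (LinearMap.inr Λ M (Dual Λ M)) χ)) := by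
  -- The mixed block pairing `M` with `M*`; subtracting `β - T_ε β` moves it to the opposite corner.
  let β : (M × Dual Λ M) →ₗ[Λ] Dual Λ (M × Dual Λ M) :=
    (dualMap ((LinearMap.inr Λ _ _).comp (LinearMap.snd Λ M (Dual Λ M)))).comp
      (χ.comp ((LinearMap.inl Λ _ _).comp (LinearMap.fst Λ M (Dual Λ M))))
  refine Eq.trans ?_ (QuadGroup.mk_sub_dualityInv _
    (pullHom (LinearMap.fst Λ M (Dual Λ M)) φ + β))
  congr 1
  refine LinearMap.ext fun x => Dual.ext fun y => ?_
  obtain ⟨x, f⟩ := x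
  obtain ⟨y, g⟩ := y
  have e3 : χ (x, f) (y, g) = χ (x, 0) (y, 0) + χ (x, 0) (0, g)
      + (χ (0, f) (y, 0) + χ (0, f) (0, g)) := by
    have hx : ((x, f) : M × Dual Λ M) = (x, 0) + (0, f) := by simp
    have hy : ((y, g) : M × Dual Λ M) = (y, 0) + (0, g) := by simp
    rw [hx, hy, map_add, map_add, Dual.add_apply, Dual.add_apply]
    abel
  change χ (x, f) (y, g) = f y + χ (0, f) (0, g) + (φ x y + χ (x, 0) (0, g)
    - (ε : ℤ) • star (φ y x + χ (y, 0) (0, f)))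
  rw [e3, h1, ← h2 f, star_add, smul_add]
  abel

/-- A Hamiltonian splitting only makes the symmetrisation partly hyperbolic: the form may be nonzero
on the chosen complement `L*`. Isotropy of `L` provides the `φ` that kills the block on `L`, and a
shear fixing `L` replaces the complement by one on which the form vanishes. -/
theorem exists_shear_pull {L : Submodule Λ M} (h : (L × Dual Λ L) ≃ₗ[Λ] M) (b : SBasis Λ L)
    {ψ : QuadGroup Λ ε M} (h1 : ∀ x : L, h (x, 0) = x)
    (h0 : QuadGroup.pull ε L.subtype ψ = 0)
    (h2 : ∀ f : Dual Λ L, dualMap L.subtype (QuadGroup.symm ε M ψ (h (0, f))) = f) :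
    ∃ a : Dual Λ L →ₗ[Λ] L, QuadGroup.pull ε ((shear a).trans h).toLinearMap ψ
      = QuadGroup.mk ε (hypHom Λ L) := by
  obtain ⟨ρ, rfl⟩ := QuotientAddGroup.mk_surjective ψ
  have h0' : QuadGroup.mk ε (0 : L →ₗ[Λ] Dual Λ L) = QuadGroup.mk ε (pullHom L.subtype ρ) :=
    h0.symm
  obtain ⟨φ, hφ⟩ := QuadGroup.mk_eq_mk h0'
  rw [zero_add] at hφ
  have hm := mk_eq_mk_hyp_add (ε := ε) (pullHom h.toLinearMap ρ) φ
    (fun x y => by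
      have := congrArg (fun t : L →ₗ[Λ] Dual Λ L => t x y) hφ
      change ρ (h (x, 0)) (h (y, 0)) = _
      rw [h1, h1]
      exact this)
    (fun f y => by
      have := congrArg (fun t : Dual Λ L => t y) (h2 f)
      change ρ (h (0, f)) (h (y, 0)) + (ε : ℤ) • star (ρ (h (y, 0)) (h (0, f))) = f y
      rw [h1]
      exact this)
  obtain ⟨a, ha⟩ := exists_shear_hyp ε b
    (pullHom (LinearMap.inr Λ L (Dual Λ L)) (pullHom h.toLinearMap ρ))
  rw [← hm] at ha
  exact ⟨a, ha⟩

theorem SimpleLagrangian.exists_hyp_isometry {b : SBasis Λ M} {ψ : QuadGroup Λ ε M}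
    (L : SimpleLagrangian Z b ψ) : ∃ h : (L.sub × Dual Λ L.sub) ≃ₗ[Λ] M,
      (∀ x : L.sub, h (x, 0) = x) ∧
      QuadGroup.pull ε h.toLinearMap ψ = QuadGroup.mk ε (hypHom Λ L.sub) ∧
      IsSimple Z (L.base.sum L.base.dual) b h := by
  obtain ⟨h, h1, h2, h3⟩ := L.hamiltonian
  obtain ⟨a, ha⟩ := exists_shear_pull h L.base h1 L.isotropic h2
  refine ⟨(shear a).trans h, fun x => ?_, ha, (isSimple_shear _ _ a).trans h3⟩
  rw [LinearEquiv.trans_apply, shear_apply, map_zero, add_zero]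
  exact h1 x

/-- A submodule that projects isomorphically to `K` is a graph: `ρ` lifts through the inverse of the
projection and takes the second coordinate. -/
theorem QuasiFormation.isIso_boundary_of_graph (y : QuasiFormation Λ ε Z) (K : BasedModule.{u} Λ)
    (Φ : y.form.carrier ≃ₗ[Λ] (QForm.hyp ε K).carrier)
    (hΦ : QForm.IsSimpleIsometry Z y.form (QForm.hyp ε K) Φ)
    (g : y.lag.sub ≃ₗ[Λ] K.carrier) (hg : IsSimple Z y.lag.base K.base g)
    (hgΦ : ∀ l : y.lag.sub, Φ l = (g l, 0))
    (k : y.half.sub ≃ₗ[Λ] K.carrier) (hk : IsSimple Z y.half.base K.base k)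
    (hkΦ : ∀ v : y.half.sub, (Φ v).1 = k v) :
    ∃ ρ : K.carrier →ₗ[Λ] Dual Λ K.carrier, y.IsIso (boundary ε Z K ρ) := by
  let ρ : K.carrier →ₗ[Λ] Dual Λ K.carrier :=
    (LinearMap.snd Λ K.carrier (Dual Λ K.carrier)).comp
      (Φ.toLinearMap.comp (y.half.sub.subtype.comp k.symm.toLinearMap))
  refine ⟨ρ, Φ, hΦ, ⟨g.trans (LinearEquiv.ofInjective _ LinearMap.inl_injective),
    fun l => (hgΦ l).symm, hg.trans (isSimple_rangeBase _ _ _)⟩,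
    ⟨k.trans (LinearEquiv.ofInjective (LinearMap.id.prod ρ) fun _ _ h => congrArg Prod.fst h),
      fun v => ?_, hk.trans (isSimple_rangeBase _ _ _)⟩⟩
  refine Prod.ext (hkΦ v).symm ?_
  change (Φ (k.symm (k v) : y.half.sub)).2 = (Φ v).2
  rw [LinearEquiv.symm_apply_apply]

/-- Shearing by `s` changes the hyperbolic form by the form `(f, g) ↦ f (s g)` on `M*`. Subtracting
the `ε`-dual `t` of `s` turns this change into an element of the image of `1 - T_ε`. -/
theorem exists_hyp_shear (ε : ℤˣ) (b : SBasis Λ M) (s : Dual Λ M →ₗ[Λ] M) :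
    ∃ t : Dual Λ M →ₗ[Λ] M, (∀ f g : Dual Λ M, f (t g) = (ε : ℤ) • star (g (s f))) ∧
      QuadGroup.pull ε (shear (s - t)).toLinearMap (QuadGroup.mk ε (hypHom Λ M))
        = QuadGroup.mk ε (hypHom Λ M) := by
  let η := (evalEquiv b).toLinearMap.comp s
  let η' := dualityInv 1 _ η
  have hη' : ∀ f g : Dual Λ M, η' f g = f (s g) := by
    intro f g
    change ((1 : ℤˣ) : ℤ) • star (star (f (s g))) = f (s g)
    simp
  let t := (evalEquiv b).symm.toLinearMap.comp (dualityInv ε _ η)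
  have ht : ∀ f g : Dual Λ M, f (t g) = (ε : ℤ) • star (g (s f)) := by
    intro f g
    change f ((evalEquiv b).symm (dualityInv ε _ η g)) = _
    rw [evalEquiv_symm_apply, dualityInv_apply, star_zsmul]
    change (ε : ℤ) • star (star (star (g (s f)))) = _
    rw [star_star]
  refine ⟨t, ht, ?_⟩
  refine Eq.trans ?_ (QuadGroup.mk_sub_dualityInv (hypHom Λ M)
    (pullHom (LinearMap.snd Λ M (Dual Λ M)) η'))
  rw [QuadGroup.pull_mk]
  congr 1
  refine LinearMap.ext fun x => Dual.ext fun y => ?_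
  change x.2 (y.1 + (s y.2 - t y.2)) = x.2 y.1 + (η' x.2 y.2 - (ε : ℤ) • star (η' y.2 x.2))
  rw [map_add, map_sub, ht, hη', hη']

end Standardisation

/-! ### Turning the half rank summand into a graph. -/

section Stabilisation

variable {Λ : Type u} [Ring Λ] [StarRing Λ] {ε : ℤˣ} {Z : AddSubgroup (KTilde Λ)}
variable {M : Type u} [AddCommGroup M] [Module Λ M] {L : Type u} [AddCommGroup L] [Module Λ L]
variable {V : Type u} [AddCommGroup V] [Module Λ V] {F : Type u} [AddCommGroup F] [Module Λ F]
variable {H : Type u} [AddCommGroup H] [Module Λ H] {E : Type u} [AddCommGroup E] [Module Λ E]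

/-- The isomorphism `(v, x, f) ↦ (l, x + Y v, f')`, where `(l, f') = G (v, f)`. -/
def insertMiddle (G : (V × E) ≃ₗ[Λ] (L × E)) (Y : V →ₗ[Λ] F) :
    (V × (F × E)) ≃ₗ[Λ] (L × (F × E)) :=
  (((LinearEquiv.refl Λ V).prodCongr (LinearEquiv.prodComm Λ F E)).trans
    (LinearEquiv.prodAssoc Λ V E F).symm).trans
    (((shearSnd (Y.comp (LinearMap.fst Λ V E))).trans (G.prodCongr (LinearEquiv.refl Λ F))).trans
      ((LinearEquiv.prodAssoc Λ L E F).trans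
        ((LinearEquiv.refl Λ L).prodCongr (LinearEquiv.prodComm Λ E F))))

theorem insertMiddle_apply (G : (V × E) ≃ₗ[Λ] (L × E)) (Y : V →ₗ[Λ] F) (v : V) (x : F) (f : E) :
    insertMiddle G Y (v, (x, f)) = ((G (v, f)).1, (x + Y v, (G (v, f)).2)) := rfl

theorem isSimple_insertMiddle {bV : SBasis Λ V} {bL : SBasis Λ L} (bF : SBasis Λ F)
    {bE : SBasis Λ E} {G : (V × E) ≃ₗ[Λ] (L × E)} (hG : IsSimple Z (bV.sum bE) (bL.sum bE) G)
    (Y : V →ₗ[Λ] F) :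
    IsSimple Z (bV.sum (bF.sum bE)) (bL.sum (bF.sum bE)) (insertMiddle G Y) :=
  (((IsSimple.refl _).prodCongr (isSimple_comm _ _)).trans (isSimple_assoc _ _ _).symm).trans
    (((isSimple_shearSnd _ _ _).trans (hG.prodCongr (IsSimple.refl _))).trans
      ((isSimple_assoc _ _ _).trans ((IsSimple.refl _).prodCongr (isSimple_comm _ _))))

/-- The isomorphism `M ⊕ (H ⊕ H*) = (L ⊕ H) ⊕ (L ⊕ H)*` for a module `M = L ⊕ L*`. -/
def hypMerge (h : (L × Dual Λ L) ≃ₗ[Λ] M) (H : Type u) [AddCommGroup H] [Module Λ H] :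
    (M × (H × Dual Λ H)) ≃ₗ[Λ] ((L × H) × Dual Λ (L × H)) :=
  (h.symm.prodCongr (LinearEquiv.refl Λ (H × Dual Λ H))).trans
    ((LinearEquiv.prodProdProdComm Λ L (Dual Λ L) H (Dual Λ H)).trans
      ((LinearEquiv.refl Λ (L × H)).prodCongr (dualProd L H)))

theorem hypMerge_apply (h : (L × Dual Λ L) ≃ₗ[Λ] M) (m : M) (x : H) (f : Dual Λ H) :
    hypMerge h H (m, (x, f))
      = (((h.symm m).1, x), dualProd L H ((h.symm m).2, f)) := rfl

theorem isSimple_hypMerge {b : SBasis Λ M} {bL : SBasis Λ L} {h : (L × Dual Λ L) ≃ₗ[Λ] M}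
    (hs : IsSimple Z (bL.sum bL.dual) b h) (bH : SBasis Λ H) :
    IsSimple Z (b.sum (bH.sum bH.dual)) ((bL.sum bH).sum (bL.sum bH).dual) (hypMerge h H) :=
  (hs.symm.prodCongr (IsSimple.refl _)).trans ((isSimple_comm4 _ _ _ _).trans
    ((IsSimple.refl _).prodCongr (isSimple_dualProd _ _)))

theorem pull_hypMerge {h : (L × Dual Λ L) ≃ₗ[Λ] M} {ψ : QuadGroup Λ ε M}
    (hψ : QuadGroup.pull ε h.toLinearMap ψ = QuadGroup.mk ε (hypHom Λ L)) :
    QuadGroup.pull ε (hypMerge h H).toLinearMap (QuadGroup.mk ε (hypHom Λ (L × H)))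
      = QuadGroup.sum ψ (QuadGroup.mk ε (hypHom Λ H)) := by
  have h1 : ψ = QuadGroup.pull ε h.symm.toLinearMap (QuadGroup.mk ε (hypHom Λ L)) := by
    rw [← hψ, QuadGroup.pull_pull]
    have : h.toLinearMap.comp h.symm.toLinearMap = LinearMap.id := by ext; simp
    rw [this]
    obtain ⟨ρ, rfl⟩ := QuotientAddGroup.mk_surjective ψ
    rfl
  rw [h1]
  rfl

/-- Before shearing, the projection of `V ⊕ graph` to `L ⊕ F ⊕ F*` is `(v, x, f) ↦ (αv, x, f)` with
`(αv, βv) = h⁻¹(j v)`. The functional coordinates are `βv` on `L`, `f` on `F` and zero on `F*`. A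
shear may use `βv` and `f`, which is enough to rewrite the projection in terms of `G(v, f) = (αv,
t₀*βv) + G(0, f)`. -/
theorem exists_stable_hyp_iso {b : SBasis Λ M} {ψ : QuadGroup Λ ε M} {bL : SBasis Λ L}
    {h : (L × Dual Λ L) ≃ₗ[Λ] M}
    (hψ : QuadGroup.pull ε h.toLinearMap ψ = QuadGroup.mk ε (hypHom Λ L))
    (hs : IsSimple Z (bL.sum bL.dual) b h) {bV : SBasis Λ V} (j : V →ₗ[Λ] M) (bF : SBasis Λ F)
    (t₀ : F →ₗ[Λ] L) {G : (V × Dual Λ F) ≃ₗ[Λ] (L × Dual Λ F)}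
    (hGs : IsSimple Z (bV.sum bF.dual) (bL.sum bF.dual) G)
    (hG : ∀ v, G (v, 0) = ((h.symm (j v)).1, dualMap t₀ (h.symm (j v)).2)) :
    ∃ (Φ : (M × ((F × Dual Λ F) × Dual Λ (F × Dual Λ F))) ≃ₗ[Λ]
        ((L × (F × Dual Λ F)) × Dual Λ (L × (F × Dual Λ F))))
      (k : (V × (F × Dual Λ F)) ≃ₗ[Λ] (L × (F × Dual Λ F))),
      QuadGroup.pull ε Φ.toLinearMap (QuadGroup.mk ε (hypHom Λ (L × (F × Dual Λ F))))
        = QuadGroup.sum ψ (QuadGroup.mk ε (hypHom Λ (F × Dual Λ F))) ∧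
      IsSimple Z (b.sum ((bF.sum bF.dual).sum (bF.sum bF.dual).dual))
        ((bL.sum (bF.sum bF.dual)).sum (bL.sum (bF.sum bF.dual)).dual) Φ ∧
      IsSimple Z (bV.sum (bF.sum bF.dual)) (bL.sum (bF.sum bF.dual)) k ∧
      (∀ l x, Φ (h (l, 0), (x, 0)) = ((l, x), 0)) ∧
      (∀ v z, (Φ (j v, (z, hypHom Λ F z))).1 = k (v, z)) := by
  let i₁ := LinearMap.inl Λ L (F × Dual Λ F)
  let i₂ := (LinearMap.inr Λ L (F × Dual Λ F)).comp (LinearMap.inl Λ F (Dual Λ F))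
  let c := (G.toLinearMap.comp (LinearMap.inr Λ V (Dual Λ F))).comp (dualMap i₂)
  -- Designed to add `G(0, f)` and `t₀*βv` while the last term removes the coordinate `f` already
  -- present. The component in `F` is zero, so that the correction `t` stays harmless.
  let s : Dual Λ (L × (F × Dual Λ F)) →ₗ[Λ] (L × (F × Dual Λ F)) :=
    ((LinearMap.fst Λ L (Dual Λ F)).comp c).prod (LinearMap.prod 0
      ((dualMap t₀).comp (dualMap i₁) + (LinearMap.snd Λ L (Dual Λ F)).comp c - dualMap i₂))
  have hs₁ : ∀ φ, (s φ).1 = (G (0, dualMap i₂ φ)).1 := fun φ => rfl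
  have hs₂ : ∀ φ, (s φ).2 = (0, dualMap t₀ (dualMap i₁ φ) + (G (0, dualMap i₂ φ)).2
    - dualMap i₂ φ) := fun φ => rfl
  obtain ⟨t, ht, hpull⟩ := exists_hyp_shear ε (bL.sum (bF.sum bF.dual)) s
  let β : V →ₗ[Λ] Dual Λ L := (LinearMap.snd Λ L (Dual Λ L)).comp (h.symm.toLinearMap.comp j)
  let φ₀ : V →ₗ[Λ] Dual Λ (L × (F × Dual Λ F)) :=
    (dualProd L (F × Dual Λ F)).toLinearMap.comp ((LinearMap.inl Λ _ _).comp β)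
  let Y : V →ₗ[Λ] F := (LinearMap.fst Λ F (Dual Λ F)).comp
    ((LinearMap.snd Λ L (F × Dual Λ F)).comp (t.comp φ₀))
  -- By duality `t` is tested through `s φ`. Since `s φ` has no component in `F` and the functional
  -- vanishes on `F*`, only its component in `L` contributes.
  have hφ : ∀ v z φ, φ (t (dualProd L (F × Dual Λ F) (β v, hypHom Λ F z)))
      = (ε : ℤ) • star (β v (G (0, dualMap i₂ φ)).1) := by
    intro v z φ
    rw [ht, dualProd_apply, hs₁, hs₂, hypHom_apply, map_zero, add_zero]
  have hG₀ : G (0, (0 : Dual Λ F)) = 0 := map_zero G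
  -- The value in `hφ` depends only on `v` and on the restriction of `φ` to `F`. Testing with
  -- functionals from each factor shows that `t` lands in `F` and is independent of `z`.
  have hkey : ∀ v z, t (dualProd L (F × Dual Λ F) (β v, hypHom Λ F z)) = (0, (Y v, 0)) := by
    intro v z
    refine Prod.ext (bL.eq_zero_of_dual fun g => ?_) (Prod.ext ?_
      (bF.dual.eq_zero_of_dual fun g => ?_))
    · have h1 := hφ v z (dualMap (LinearMap.fst Λ L (F × Dual Λ F)) g)
      have h2 : dualMap i₂ (dualMap (LinearMap.fst Λ L (F × Dual Λ F)) g) = 0 :=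
        Dual.ext fun y => map_zero g
      rw [h2, hG₀, Prod.fst_zero, map_zero, star_zero, smul_zero] at h1
      exact h1
    · refine sub_eq_zero.1 (bF.eq_zero_of_dual fun g => ?_)
      have h1 := hφ v z (dualMap ((LinearMap.fst Λ F (Dual Λ F)).comp
        (LinearMap.snd Λ L (F × Dual Λ F))) g)
      have h2 := hφ v 0 (dualMap ((LinearMap.fst Λ F (Dual Λ F)).comp
        (LinearMap.snd Λ L (F × Dual Λ F))) g)
      rw [← h2, map_zero] at h1
      rw [map_sub, sub_eq_zero]
      exact h1
    · have h1 := hφ v z (dualMap ((LinearMap.snd Λ F (Dual Λ F)).comp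
        (LinearMap.snd Λ L (F × Dual Λ F))) g)
      have h2 : dualMap i₂ (dualMap ((LinearMap.snd Λ F (Dual Λ F)).comp
          (LinearMap.snd Λ L (F × Dual Λ F))) g) = 0 :=
        Dual.ext fun y => map_zero g
      rw [h2, hG₀, Prod.fst_zero, map_zero, star_zero, smul_zero] at h1
      exact h1
  -- The sign of `Y` comes from the `-t` in the isometric shear.
  refine ⟨(hypMerge h (F × Dual Λ F)).trans (shear (s - t)), insertMiddle G (-Y), ?_,
    (isSimple_hypMerge hs _).trans (isSimple_shear _ _ _), isSimple_insertMiddle _ hGs _, ?_, ?_⟩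
  · exact (QuadGroup.pull_pull ε (hypMerge h (F × Dual Λ F)).toLinearMap _ _).symm.trans
      ((congrArg _ hpull).trans (pull_hypMerge hψ))
  · intro l x
    rw [LinearEquiv.trans_apply, hypMerge_apply, LinearEquiv.symm_apply_apply, shear_apply,
      Prod.mk_zero_zero, map_zero, map_zero, add_zero]
  · intro v z
    obtain ⟨x, f⟩ := z
    rw [LinearEquiv.trans_apply, hypMerge_apply, insertMiddle_apply, shear_apply,
      LinearMap.sub_apply]
    have h1 : (h.symm (j v)).2 = β v := rfl
    have h2 : dualMap i₂ (dualProd L (F × Dual Λ F) (β v, hypHom Λ F (x, f))) = f := by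
      refine Dual.ext fun y => ?_
      change β v 0 + f y = f y
      rw [map_zero, zero_add]
    have h3 : dualMap i₁ (dualProd L (F × Dual Λ F) (β v, hypHom Λ F (x, f))) = β v := by
      refine Dual.ext fun y => ?_
      change β v y + f 0 = β v y
      rw [map_zero, add_zero]
    have h4 : G (v, f) = G (v, 0) + G (0, f) := by
      rw [← map_add, Prod.mk_add_mk, add_zero, zero_add]
    rw [h1, hkey, h4, hG, h1]
    refine Prod.ext ?_ (Prod.ext ?_ ?_)
    · change (h.symm (j v)).1 + ((s _).1 - 0) = (h.symm (j v)).1 + (G (0, f)).1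
      rw [hs₁, h2, sub_zero]
    · change x + ((s _).2.1 - Y v) = x + -Y v
      rw [hs₂, zero_sub]
    · change f + ((s _).2.2 - 0) = dualMap t₀ (β v) + (G (0, f)).2
      rw [hs₂, h2, h3, sub_zero]
      exact add_sub_cancel _ _

/-- Adding the boundary of `H_ε(F)` enlarges the Lagrangian to `L ⊕ F ⊕ F*` and the summand to `V ⊕
graph`. The isometry of `exists_stable_hyp_iso` standardises the former and makes the latter a graph
over it. -/
theorem QuasiFormation.isElementary_add_boundary_hyp (x : QuasiFormation Λ ε Z)
    {h : (x.lag.sub × Dual Λ x.lag.sub) ≃ₗ[Λ] x.form.carrier}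
    (h₀ : ∀ l : x.lag.sub, h (l, 0) = l)
    (hψ : QuadGroup.pull ε h.toLinearMap x.form.ψ = QuadGroup.mk ε (hypHom Λ x.lag.sub))
    (hs : IsSimple Z (x.lag.base.sum x.lag.base.dual) x.form.mod.base h) (F : BasedModule.{u} Λ)
    (t₀ : F.carrier →ₗ[Λ] x.lag.sub)
    {G : (x.half.sub × Dual Λ F.carrier) ≃ₗ[Λ] (x.lag.sub × Dual Λ F.carrier)}
    (hGs : IsSimple Z (x.half.base.sum F.base.dual) (x.lag.base.sum F.base.dual) G)
    (hG : ∀ v : x.half.sub, G (v, 0) = ((h.symm v).1, dualMap t₀ (h.symm v).2)) :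
    x.cls + (QForm.hyp ε F).boundaryCls Z ∈ Elementary (Λ := Λ) ε Z := by
  obtain ⟨Φ, k, h1, h2, h3, h4, h5⟩ := exists_stable_hyp_iso hψ hs x.half.sub.subtype F.base t₀
    hGs hG
  let H : BasedModule.{u} Λ := F.sum F.dual
  let K : BasedModule.{u} Λ := BasedModule.sum ⟨x.lag.sub, x.lag.base⟩ H
  let eL := LinearEquiv.ofInjective (LinearMap.inl Λ H.carrier (Dual Λ H.carrier))
    LinearMap.inl_injective
  let eV := LinearEquiv.ofInjective (LinearMap.id.prod (hypHom Λ F.carrier))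
    fun _ _ h => congrArg Prod.fst h
  let y := x + boundary ε Z H (hypHom Λ F.carrier)
  let g : y.lag.sub ≃ₗ[Λ] K.carrier := (prodSub x.lag.sub _).symm.trans
    ((LinearEquiv.refl Λ x.lag.sub).prodCongr eL.symm)
  let k' : y.half.sub ≃ₗ[Λ] K.carrier := ((prodSub x.half.sub _).symm.trans
    ((LinearEquiv.refl Λ x.half.sub).prodCongr eV.symm)).trans k
  have hg : IsSimple Z y.lag.base K.base g := (isSimple_map _ _).symm.trans
    ((IsSimple.refl x.lag.base).prodCongr (isSimple_rangeBase _ _ _).symm)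
  have hk : IsSimple Z y.half.base K.base k' := ((isSimple_map _ _).symm.trans
    ((IsSimple.refl x.half.base).prodCongr (isSimple_rangeBase _ _ _).symm)).trans h3
  obtain ⟨ρ, hρ⟩ := isIso_boundary_of_graph y K Φ ⟨h1, h2⟩ g hg (fun l => by
      obtain ⟨⟨l, w⟩, rfl⟩ := (prodSub x.lag.sub (LinearMap.range (LinearMap.inl Λ H.carrier
        (Dual Λ H.carrier)))).surjective l
      obtain ⟨z, rfl⟩ := eL.surjective w
      refine Eq.trans ?_ ((h4 l z).trans
        (congrArg (fun t => ((l, t), 0)) (eL.symm_apply_apply z).symm))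
      exact congrArg (fun t => Φ (t, (z, 0))) (h₀ l).symm) k' hk (fun v => by
      obtain ⟨⟨v, w⟩, rfl⟩ := (prodSub x.half.sub (LinearMap.range (LinearMap.id.prod
        (hypHom Λ F.carrier)))).surjective v
      obtain ⟨z, rfl⟩ := eV.surjective w
      exact (h5 v z).trans (congrArg (fun t => k (v, t)) (eV.symm_apply_apply z).symm))
  refine ⟨K, ρ, ?_⟩
  rw [← hρ.cls_eq]
  exact congrArg (x.cls + ·) (QForm.boundaryCls_ofHom H (hypHom Λ F.carrier))

end Stabilisation

/-! ### Based modules become free after stabilisation. -/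

section FreeModules

variable {Λ : Type u} [Ring Λ] {Z : AddSubgroup (KTilde Λ)}
variable {M : Type u} [AddCommGroup M] [Module Λ M]

/-- Two based modules are simply isomorphic. -/
def SimplyIso (Z : AddSubgroup (KTilde Λ)) (P Q : BasedModule.{u} Λ) : Prop :=
  ∃ f : P.carrier ≃ₗ[Λ] Q.carrier, IsSimple Z P.base Q.base f

theorem SimplyIso.refl (P : BasedModule.{u} Λ) : SimplyIso Z P P := ⟨_, IsSimple.refl _⟩

theorem SimplyIso.symm {P Q : BasedModule.{u} Λ} (h : SimplyIso Z P Q) : SimplyIso Z Q P :=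
  ⟨_, h.choose_spec.symm⟩

theorem SimplyIso.trans {P Q R : BasedModule.{u} Λ} (h : SimplyIso Z P Q) (h' : SimplyIso Z Q R) :
    SimplyIso Z P R :=
  ⟨_, h.choose_spec.trans h'.choose_spec⟩

theorem SimplyIso.sum {P Q P' Q' : BasedModule.{u} Λ} (h : SimplyIso Z P Q)
    (h' : SimplyIso Z P' Q') : SimplyIso Z (P.sum P') (Q.sum Q') :=
  ⟨_, h.choose_spec.prodCongr h'.choose_spec⟩

theorem simplyIso_assoc (P Q R : BasedModule.{u} Λ) :
    SimplyIso Z ((P.sum Q).sum R) (P.sum (Q.sum R)) :=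
  ⟨_, isSimple_assoc _ _ _⟩

variable {ι κ : Type} [Fintype ι] [DecidableEq ι] [Fintype κ] [DecidableEq κ]

/-- A finite basis of `M` as a basis of `M ⊕ Λ^∅`. -/
def unstabBasis (b : Basis ι Λ M) : Basis ι Λ (M × (Empty → Λ)) :=
  b.map (LinearEquiv.prodUnique (R := Λ) (M := M) (M₂ := Empty → Λ)).symm

theorem unstabBasis_apply (b : Basis ι Λ M) (i : ι) :
    unstabBasis b i = (b i, (0 : Empty → Λ)) := by
  rw [unstabBasis, Basis.map_apply]
  exact Prod.ext rfl (funext fun k => k.elim)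

theorem unstabBasis_matches {N : Type u} [AddCommGroup N] [Module Λ N] (b : Basis ι Λ M)
    (c : Basis κ Λ N) (e : ι ≃ κ) (f : M ≃ₗ[Λ] N) (h : ∀ i, f (b i) = c (e i)) :
    BasisMatches (unstabBasis b) (unstabBasis c) f := by
  refine ⟨e, Equiv.refl _, fun i => ?_⟩
  rw [unstabBasis_apply, unstabBasis_apply, stabMap_apply]
  exact Prod.ext (h i).symm rfl

theorem unstabBasis_sum {N : Type u} [AddCommGroup N] [Module Λ N] (b : Basis ι Λ M)
    (c : Basis κ Λ N) : BasisMatches (sumBasis (unstabBasis b) (unstabBasis c))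
      (unstabBasis (b.prod c)) (LinearEquiv.refl Λ (M × N)) := by
  refine ⟨Equiv.refl _, Equiv.sumEmpty Empty Empty, fun i => ?_⟩
  rw [Equiv.refl_apply, unstabBasis_apply, stabMap_apply]
  rcases i with i | i
  · rw [sumBasis_inl, unstabBasis_apply]
    exact Prod.ext (by simp) (funext fun k => k.elim)
  · rw [sumBasis_inr, unstabBasis_apply]
    exact Prod.ext (by simp) (funext fun k => k.elim)

theorem isoMatrix_refl {X : Type u} [AddCommGroup X] [Module Λ X] (B : Basis ι Λ X)
    (g : X ≃ₗ[Λ] X) : isoMatrix B B (Equiv.refl ι) g = glOf B g := by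
  ext i j
  rw [isoMatrix_apply, glOf_apply, Equiv.refl_apply]

/-- Conjugating by the exchange of factors, which matches the two product bases, gives the other
kind of shear. -/
theorem cls_glOf_shearSnd {X Y : Type u} [AddCommGroup X] [Module Λ X] [AddCommGroup Y]
    [Module Λ Y] (B : Basis ι Λ X) (C : Basis κ Λ Y) (a : X →ₗ[Λ] Y) :
    KTilde.cls (glOf (B.prod C) (shearSnd a)) = 0 := by
  have e : Equiv.refl (ι ⊕ κ) = (Equiv.sumComm ι κ).trans ((Equiv.refl (κ ⊕ ι)).trans
      (Equiv.sumComm κ ι)) := by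
    ext i
    rcases i with i | i <;> rfl
  rw [← isoMatrix_refl, e, shearSnd, cls_isoMatrix_trans _ (C.prod B),
    cls_isoMatrix_trans _ (C.prod B), isoMatrix_refl, cls_glOf_shear,
    cls_isoMatrix_of_matching, cls_isoMatrix_of_matching, add_zero, add_zero]
  · rintro (i | i) <;> simp
  · rintro (i | i) <;> simp

theorem cls_glOf_sign (B : Basis ι Λ M) (ε : ℤˣ) :
    KTilde.cls (glOf B (signEquiv Λ M ε)) = 0 := by
  have : glOf B (signEquiv Λ M ε) = glMap (Int.castRingHom Λ) (glSign ε ι) := by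
    ext i j
    rw [glOf_apply, signEquiv_apply, map_zsmul, Basis.repr_self]
    simp [glMap, Finsupp.single_apply, Matrix.diagonal_apply, glSign]
  rw [this, KTilde.cls_int]

/-- The interchange of the last two summands of `(M ⊕ N) ⊕ N`. -/
def swapLast (M N : Type u) [AddCommGroup M] [Module Λ M] [AddCommGroup N] [Module Λ N] :
    ((M × N) × N) ≃ₗ[Λ] ((M × N) × N) :=
  ((LinearEquiv.prodAssoc Λ M N N).trans
    ((LinearEquiv.refl Λ M).prodCongr (LinearEquiv.prodComm Λ N N))).trans
      (LinearEquiv.prodAssoc Λ M N N).symm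

theorem swapLast_apply {N : Type u} [AddCommGroup N] [Module Λ N] (x : (M × N) × N) :
    swapLast (Λ := Λ) M N x = ((x.1.1, x.2), x.1.2) := rfl

/-- The basis `B` need not respect the splitting `M ⊕ N`, so the interchange is not a permutation
matrix. It is instead a sign followed by three shears, as in the factorisation of `(0 1; 1 0)` into
elementary matrices and a sign. -/
theorem cls_glOf_swapLast {N : Type u} [AddCommGroup N] [Module Λ N] (B : Basis ι Λ (M × N))
    (C : Basis κ Λ N) : KTilde.cls (glOf (B.prod C) (swapLast M N)) = 0 := by
  have : swapLast M N = ((LinearEquiv.refl Λ (M × N)).prodCongr (signEquiv Λ N (-1))).trans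
      ((shearSnd (LinearMap.snd Λ M N)).trans ((shear (-LinearMap.inr Λ M N)).trans
        (shearSnd (LinearMap.snd Λ M N)))) := by
    ext1 ⟨⟨m, z⟩, y⟩
    change ((m, y), z) = _
    simp [signEquiv_apply]
  rw [this, cls_glOf_trans, cls_glOf_trans, cls_glOf_trans, cls_glOf_shearSnd, cls_glOf_shear,
    cls_glOf_prodCongr, cls_glOf_refl, cls_glOf_sign]
  simp

/-- There are two copies of `Λ^κ`: the summand of the module and the stabilising coordinates of `B`.
The two `s`-bases use them in opposite roles, so the comparison is the interchange of the copies,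
which has no torsion. -/
theorem torsionIn_unstab (B : Basis ι Λ (M × (κ → Λ))) :
    TorsionIn Z (sumBasis B (unstabBasis (Pi.basisFun Λ κ))) (unstabBasis B)
      (LinearEquiv.refl Λ (M × (κ → Λ))) := by
  let θ : (κ ⊕ Empty) ⊕ Empty ≃ Empty ⊕ κ :=
    ((Equiv.sumEmpty _ _).trans (Equiv.sumEmpty _ _)).trans (Equiv.emptySum Empty κ).symm
  refine torsionIn_iff.2 ⟨Empty, κ, inferInstance, inferInstance, inferInstance, inferInstance,
    θ, ((Equiv.sumEmpty (ι ⊕ κ) Empty).trans (Equiv.refl _)).trans (Equiv.refl _), ?_⟩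
  let u : ((M × (κ → Λ)) × ((κ ⊕ Empty) ⊕ Empty → Λ)) ≃ₗ[Λ] ((M × (κ → Λ)) × (κ → Λ)) :=
    ((LinearEquiv.refl Λ (M × (κ → Λ))).prodCongr (LinearEquiv.funCongrLeft Λ Λ
      ((Equiv.sumEmpty _ _).trans (Equiv.sumEmpty _ _)).symm)).trans (swapLast M (κ → Λ))
  let v : ((M × (κ → Λ)) × (κ → Λ)) ≃ₗ[Λ] ((M × (κ → Λ)) × (Empty ⊕ κ → Λ)) :=
    (LinearEquiv.refl Λ (M × (κ → Λ))).prodCongr (LinearEquiv.funCongrLeft Λ Λ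
      (Equiv.emptySum Empty κ))
  have h : stabIso (LinearEquiv.refl Λ (M × (κ → Λ))) θ
      = (u.trans (swapLast M (κ → Λ))).trans v := by
    ext1 x
    rfl
  rw [h, cls_isoMatrix_trans _ (B.prod (Pi.basisFun Λ κ)),
    cls_isoMatrix_trans _ (B.prod (Pi.basisFun Λ κ)), isoMatrix_refl, cls_glOf_swapLast,
    cls_isoMatrix_of_matching, cls_isoMatrix_of_matching, add_zero, add_zero]
  · exact Z.zero_mem
  · rintro (i | i)
    · rw [Equiv.refl_apply, stabBasis_inl, unstabBasis_apply]
      refine Prod.ext (by simp [v]) (funext fun k => ?_)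
      rcases k with k | k
      · exact k.elim
      · simp [v, LinearEquiv.funCongrLeft_apply]
    · rw [Equiv.refl_apply, stabBasis_inr]
      refine Prod.ext (by simp [v]) (funext fun k => ?_)
      rcases k with k | k
      · exact k.elim
      · simp [v, LinearEquiv.funCongrLeft_apply]
  · rintro ((i | i) | i)
    · rw [stabBasis_inl, sumBasis_inl]
      refine Prod.ext (Prod.ext ?_ (funext fun k => ?_)) (funext fun k => ?_) <;>
        simp [u, swapLast_apply, LinearEquiv.funCongrLeft_apply]
    · rw [stabBasis_inl, sumBasis_inr, unstabBasis_apply]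
      refine Prod.ext (Prod.ext ?_ (funext fun k => ?_)) (funext fun k => ?_) <;>
        simp [u, swapLast_apply, LinearEquiv.funCongrLeft_apply]
    · exact i.elim

/-- The free based module on a finite set. -/
def BasedModule.free (Λ : Type u) [Ring Λ] (ι : Type) [Fintype ι] [DecidableEq ι] :
    BasedModule.{u} Λ where
  carrier := ι → Λ
  base := SBasis.ofBasis (Pi.basisFun Λ ι)

theorem simplyIso_free_equiv (e : ι ≃ κ) :
    SimplyIso Z (BasedModule.free Λ ι) (BasedModule.free Λ κ) := by
  refine ⟨LinearEquiv.funCongrLeft Λ Λ e.symm, BasisMatches.torsionIn (unstabBasis_matches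
    (Pi.basisFun Λ ι) (Pi.basisFun Λ κ) e _ fun i => ?_)⟩
  ext k
  simp [LinearEquiv.funCongrLeft_apply, Pi.single_apply, Equiv.symm_apply_eq]

theorem simplyIso_free_sum :
    SimplyIso Z ((BasedModule.free Λ ι).sum (BasedModule.free Λ κ))
      (BasedModule.free Λ (ι ⊕ κ)) := by
  refine ⟨(LinearEquiv.refl Λ ((ι → Λ) × (κ → Λ))).trans
    (LinearEquiv.sumArrowLequivProdArrow ι κ Λ Λ).symm, BasisMatches.torsionIn
    (BasisMatches.trans (unstabBasis_sum (Pi.basisFun Λ ι) (Pi.basisFun Λ κ))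
      (unstabBasis_matches _ (Pi.basisFun Λ (ι ⊕ κ)) (Equiv.refl _) _ fun i => ?_))⟩
  ext k
  rcases i with i | i <;> rcases k with k | k <;> simp [Pi.single_apply]

/-- An `s`-basis of `P` is an honest basis of `P ⊕ Λ^m`; by `torsionIn_unstab` it is also equivalent
to the direct sum basis. -/
theorem simplyIso_stab_free (P : BasedModule.{u} Λ) :
    SimplyIso Z (P.sum (BasedModule.free Λ P.base.stab)) (BasedModule.free Λ P.base.idx) := by
  refine ⟨(LinearEquiv.refl Λ (P.carrier × (P.base.stab → Λ))).trans P.base.basis.equivFun,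
    TorsionIn.trans (torsionIn_unstab P.base.basis) (BasisMatches.torsionIn (unstabBasis_matches
      P.base.basis (Pi.basisFun Λ P.base.idx) (Equiv.refl _) _ fun i => ?_))⟩
  ext k
  simp [Pi.single_apply, eq_comm]

/-- `P ⊕ Λ^κ ≅ Λ^ι` if the `s`-basis of `P` allows it. -/
theorem simplyIso_sum_free (P : BasedModule.{u} Λ)
    (e : κ ≃ P.base.stab ⊕ ι) :
    SimplyIso Z (P.sum (BasedModule.free Λ κ)) (BasedModule.free Λ (P.base.idx ⊕ ι)) :=
  ((SimplyIso.refl P).sum ((simplyIso_free_equiv e).trans simplyIso_free_sum.symm)).trans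
    ((simplyIso_assoc _ _ _).symm.trans
      (((simplyIso_stab_free P).sum (SimplyIso.refl _)).trans simplyIso_free_sum))

end FreeModules

/-! ### Duals of free based modules. -/

section FreeDuals

variable {Λ : Type u} [Ring Λ] [StarRing Λ] {Z : AddSubgroup (KTilde Λ)}
variable {ι : Type} [Fintype ι] [DecidableEq ι]

theorem dualSBasis_unstabBasis {M : Type u} [AddCommGroup M] [Module Λ M] (b : Basis ι Λ M) :
    BasisMatches (dualSBasis (unstabBasis b)) (unstabBasis (dualBasis b))
      (LinearEquiv.refl Λ (Dual Λ M)) := by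
  refine ⟨Equiv.refl _, Equiv.refl _, fun i => ?_⟩
  rw [Equiv.refl_apply, unstabBasis_apply, dualSBasis_apply, stabMap_apply]
  refine Prod.ext (Dual.ext fun x => ?_) (funext fun k => k.elim)
  rw [dualBasis_apply]
  exact (congrArg (fun y => b.repr y i) rfl)

theorem simplyIso_free_dual :
    SimplyIso Z (BasedModule.free Λ ι).dual (BasedModule.free Λ ι) := by
  refine ⟨(LinearEquiv.refl Λ (Dual Λ (ι → Λ))).trans (dualFree (Pi.basisFun Λ ι)),
    BasisMatches.torsionIn (BasisMatches.trans (dualSBasis_unstabBasis (Pi.basisFun Λ ι))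
      (unstabBasis_matches _ (Pi.basisFun Λ ι) (Equiv.refl _) _ fun i => ?_))⟩
  ext k
  change star (dualBasis (Pi.basisFun Λ ι) i (Pi.basisFun Λ ι k)) = _
  rw [dualBasis_apply, Basis.repr_self]
  simp [Pi.single_apply, Finsupp.single_apply, apply_ite star, eq_comm]

end FreeDuals

/-! ### Extending a split inclusion to a simple isomorphism. -/

section Completion

variable {Λ : Type u} [Ring Λ] [StarRing Λ] {Z : AddSubgroup (KTilde Λ)}
variable {N : Type u} [AddCommGroup N] [Module Λ N] {L : Type u} [AddCommGroup L] [Module Λ L]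
variable {V : Type u} [AddCommGroup V] [Module Λ V] {C : Type u} [AddCommGroup C] [Module Λ C]
variable {Y : Type u} [AddCommGroup Y] [Module Λ Y]

/-- Swapping and then shearing by `j`, `-p` and `j` sends `(v, 0)` through `(0, v)` and `(j v, v)`
to `(j v, 0)`, as `p` splits `j`. All factors are simple. -/
theorem exists_swap_extending {bN : SBasis Λ N} {bV : SBasis Λ V} (j : V →ₗ[Λ] N) (p : N →ₗ[Λ] V)
    (hpj : ∀ v, p (j v) = v) : ∃ T : (V × N) ≃ₗ[Λ] (N × V),
      IsSimple Z (bV.sum bN) (bN.sum bV) T ∧ ∀ v, T (v, 0) = (j v, 0) := by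
  refine ⟨(LinearEquiv.prodComm Λ V N).trans ((shear j).trans ((shearSnd (-p)).trans (shear j))),
    (isSimple_comm _ _).trans ((isSimple_shear _ _ _).trans ((isSimple_shearSnd _ _ _).trans
      (isSimple_shear _ _ _))), fun v => ?_⟩
  simp [hpj]

/-- With `F = L ⊕ C` and `t₀` the projection to `L`, the target map `v ↦ (αv, t₀*βv)` is the
inclusion `j` into `L ⊕ L*` followed by that into `L ⊕ F*`. Since `V ⊕ (L ⊕ L*)` can be exchanged
with `(L ⊕ L*) ⊕ V` by a map extending `j`, it remains to find `L ⊕ L*` inside `F*` and to absorb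
the leftover `V`; both are done by `C`. -/
theorem exists_completion {bL : SBasis Λ L} {bV : SBasis Λ V} {bC : SBasis Λ C} {bY : SBasis Λ Y}
    (j : V →ₗ[Λ] (L × Dual Λ L)) (p : (L × Dual Λ L) →ₗ[Λ] V) (hpj : ∀ v, p (j v) = v)
    {c : Dual Λ C ≃ₗ[Λ] (V × Y)} (hc : IsSimple Z bC.dual (bV.sum bY) c)
    {w : (V × Y) ≃ₗ[Λ] (L × Y)} (hw : IsSimple Z (bV.sum bY) (bL.sum bY) w) :
    ∃ G : (V × Dual Λ (L × C)) ≃ₗ[Λ] (L × Dual Λ (L × C)),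
      IsSimple Z (bV.sum (bL.sum bC).dual) (bL.sum (bL.sum bC).dual) G ∧
      ∀ v, G (v, 0) = ((j v).1, dualMap (LinearMap.fst Λ L C) (j v).2) := by
  obtain ⟨T, hT, hTj⟩ := exists_swap_extending (Z := Z) (bN := bL.sum bL.dual) (bV := bV) j p hpj
  -- Here `C* ≅ V ⊕ Y ≅ L ⊕ Y` supplies the copy of `L` that joins `L*` on the source side.
  let A : Dual Λ (L × C) ≃ₗ[Λ] ((L × Dual Λ L) × Y) :=
    ((dualProd L C).symm.trans ((LinearEquiv.refl Λ (Dual Λ L)).prodCongr (c.trans w))).trans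
      ((LinearEquiv.prodAssoc Λ (Dual Λ L) L Y).symm.trans
        ((LinearEquiv.prodComm Λ (Dual Λ L) L).prodCongr (LinearEquiv.refl Λ Y)))
  have hA : IsSimple Z (bL.sum bC).dual ((bL.sum bL.dual).sum bY) A :=
    ((isSimple_dualProd _ _).symm.trans ((IsSimple.refl _).prodCongr (hc.trans hw))).trans
      ((isSimple_assoc _ _ _).symm.trans ((isSimple_comm _ _).prodCongr (IsSimple.refl _)))
  -- On the target side `V ⊕ Y` is folded back into `C*`, leaving the factor `L` of `L ⊕ L*` outside
  -- the dual.
  let B : ((L × Dual Λ L) × (V × Y)) ≃ₗ[Λ] (L × Dual Λ (L × C)) :=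
    ((LinearEquiv.refl Λ (L × Dual Λ L)).prodCongr c.symm).trans
      ((LinearEquiv.prodAssoc Λ L (Dual Λ L) (Dual Λ C)).trans
        ((LinearEquiv.refl Λ L).prodCongr (dualProd L C)))
  have hB : IsSimple Z ((bL.sum bL.dual).sum (bV.sum bY)) (bL.sum (bL.sum bC).dual) B :=
    ((IsSimple.refl _).prodCongr hc.symm).trans ((isSimple_assoc _ _ _).trans
      ((IsSimple.refl _).prodCongr (isSimple_dualProd _ _)))
  refine ⟨((LinearEquiv.refl Λ V).prodCongr A).trans ((LinearEquiv.prodAssoc Λ V _ Y).symm.trans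
    ((T.prodCongr (LinearEquiv.refl Λ Y)).trans ((LinearEquiv.prodAssoc Λ _ V Y).trans B))),
    ((IsSimple.refl _).prodCongr hA).trans ((isSimple_assoc _ _ _).symm.trans
      ((hT.prodCongr (IsSimple.refl _)).trans ((isSimple_assoc _ _ _).trans hB))), fun v => ?_⟩
  have h1 : ((LinearEquiv.refl Λ V).prodCongr A) (v, 0) = (v, 0) := Prod.ext rfl (map_zero A)
  have h2 : (LinearEquiv.prodAssoc Λ V (L × Dual Λ L) Y).symm (v, 0) = ((v, 0), 0) := rfl
  have h3 : (T.prodCongr (LinearEquiv.refl Λ Y)) ((v, 0), 0) = ((j v, 0), 0) :=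
    Prod.ext (hTj v) rfl
  rw [LinearEquiv.trans_apply, LinearEquiv.trans_apply, LinearEquiv.trans_apply,
    LinearEquiv.trans_apply, h1, h2, h3]
  refine Prod.ext rfl ?_
  change dualProd L C ((j v).2, c.symm (0, 0)) = _
  rw [Prod.mk_zero_zero, map_zero]
  exact Dual.ext fun y => add_zero _

end Completion

/-! ### Every class is stably elementary. -/

section StablyElementary

variable {Λ : Type u} [Ring Λ] [StarRing Λ] {ε : ℤˣ} {Z : AddSubgroup (KTilde Λ)}

/-- The isomorphism between boundaries of zero forms already contains the needed isometry `H_ε(P) ≅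
H_ε(Q)`. -/
theorem boundaryCls_hyp_eq (hZ : IsStarInvariant Z) {P Q : BasedModule.{u} Λ}
    (h : SimplyIso Z P Q) :
    (QForm.hyp ε P).boundaryCls Z = (QForm.hyp ε Q).boundaryCls Z := by
  obtain ⟨f, hf⟩ := h
  obtain ⟨g, hg, -⟩ := QuasiFormation.isIso_boundary (ε := ε) hZ hf 0
  exact hg.boundaryCls_eq hZ

/-- Both summands have half the rank of the form; the equality of ranks is written without
subtraction. -/
theorem QuasiFormation.card_half_add_card_lag (x : QuasiFormation Λ ε Z) :
    Fintype.card x.half.base.idx + Fintype.card x.lag.base.stab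
      = Fintype.card x.lag.base.idx + Fintype.card x.half.base.stab := by
  have h1 := x.half.half_rank
  have h2 := x.lag.toHalf.half_rank
  change 2 * x.lag.base.rank = _ at h2
  simp only [SBasis.rank] at h1 h2
  omega

theorem QuasiFormation.exists_isElementary_add (hZ : IsStarInvariant Z)
    (x : QuasiFormation Λ ε Z) : ∃ k : ℕ, 0 < k ∧
      x.cls + (QForm.hyp ε (BasedModule.std Λ k)).boundaryCls Z ∈ Elementary (Λ := Λ) ε Z := by
  obtain ⟨h, h₀, hψ, hs⟩ := x.lag.exists_hyp_isometry
  obtain ⟨W, hW⟩ := x.half.summand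
  let V : BasedModule.{u} Λ := ⟨x.half.sub, x.half.base⟩
  let L : BasedModule.{u} Λ := ⟨x.lag.sub, x.lag.base⟩
  have hcard : Fintype.card V.base.idx + Fintype.card L.base.stab
      = Fintype.card L.base.idx + Fintype.card V.base.stab := x.card_half_add_card_lag
  -- Large enough to make both `V ⊕ Y` and `L ⊕ Y` free, and of equal rank by `hcard`. The extra
  -- `Unit` makes `k` positive.
  let Y := BasedModule.free Λ (V.base.stab ⊕ (L.base.stab ⊕ Unit))
  let C := BasedModule.free Λ (V.base.idx ⊕ (L.base.stab ⊕ Unit))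
  let k := Fintype.card (L.base.idx ⊕ (V.base.idx ⊕ Unit))
  have hVY : SimplyIso Z (V.sum Y) C := simplyIso_sum_free V (Equiv.refl _)
  have hLY : SimplyIso Z (L.sum Y) C :=
    (simplyIso_sum_free L (ι := V.base.stab ⊕ Unit) (Fintype.equivOfCardEq (by
      simp only [Fintype.card_sum]; omega))).trans (simplyIso_free_equiv (Fintype.equivOfCardEq (by
      simp only [Fintype.card_sum]; omega)))
  have hF : SimplyIso Z (L.sum C) (BasedModule.std Λ k) :=
    (simplyIso_sum_free L (ι := V.base.idx ⊕ Unit) (Fintype.equivOfCardEq (by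
      simp only [Fintype.card_sum]; omega))).trans (simplyIso_free_equiv (Fintype.equivFin _))
  obtain ⟨c, hc⟩ : SimplyIso Z C.dual (V.sum Y) := simplyIso_free_dual.trans hVY.symm
  obtain ⟨w, hw⟩ := hVY.trans hLY.symm
  -- The complement `W` of `V` gives the retraction that splits the inclusion of `V` into `L ⊕ L*`.
  obtain ⟨G, hGs, hG⟩ := exists_completion (bL := x.lag.base) (bV := x.half.base) (bC := C.base)
    (bY := Y.base) (h.symm.toLinearMap ∘ₗ x.half.sub.subtype)
    (x.half.sub.projectionOnto W hW ∘ₗ h.toLinearMap) (fun v => by simp) hc hw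
  refine ⟨k, Fintype.card_pos, ?_⟩
  rw [← boundaryCls_hyp_eq hZ hF]
  exact x.isElementary_add_boundary_hyp h₀ hψ hs (L.sum C) _ hGs hG

end StablyElementary

end SurgeryMonoid

end

/-! ### Assembly of the isomorphism and its consequences. -/

theorem mainTheorem8 {Λ : Type u} [Ring Λ] [StarRing Λ] [InvariantBasisNumber Λ]
    (q : ℕ) (hq : 0 < q)
    (Z : AddSubgroup (SurgeryMonoid.KTilde Λ)) (hZ : SurgeryMonoid.IsStarInvariant Z) :
    ∃ e : SurgeryMonoid.ZeroStabForms ((-1 : ℤˣ) ^ q) Z ≃+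
        SurgeryMonoid.Elementary ((-1 : ℤˣ) ^ q) Z,
      -- `e` sends the class of the form `(K, [ρ])` to the class of the boundary of `(K, ρ)`
      (∀ (K : SurgeryMonoid.BasedModule.{u} Λ)
          (ρ : K.carrier →ₗ[Λ] SurgeryMonoid.Dual Λ K.carrier),
        (e ((SurgeryMonoid.QForm.ofHom ((-1 : ℤˣ) ^ q) K ρ).cls Z) :
            SurgeryMonoid.LMonoid ((-1 : ℤˣ) ^ q) Z) =
          (SurgeryMonoid.QuasiFormation.boundary ((-1 : ℤˣ) ^ q) Z K ρ).cls) ∧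
      -- the inverse of `e` sends an elementary class `[M, ψ; L, V]` to the class of `(V, j* ψ j)`
      (∀ (x : SurgeryMonoid.QuasiFormation Λ ((-1 : ℤˣ) ^ q) Z)
          (hx : x.cls ∈ SurgeryMonoid.Elementary ((-1 : ℤˣ) ^ q) Z),
        e.symm ⟨x.cls, hx⟩ = x.induced.cls Z) ∧
      -- every element becomes elementary after addition of some `e[H_ε(Λ^k)]`
      (∀ x : SurgeryMonoid.LMonoid (Λ := Λ) ((-1 : ℤˣ) ^ q) Z, ∃ k : ℕ, 0 < k ∧
        x + e ((SurgeryMonoid.QForm.hyp ((-1 : ℤˣ) ^ q)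
            (SurgeryMonoid.BasedModule.std Λ k)).cls Z) ∈
          SurgeryMonoid.Elementary ((-1 : ℤˣ) ^ q) Z) ∧
      -- the induced homomorphisms of Grothendieck groups are isomorphisms
      Function.Bijective (SurgeryMonoid.grMap e.toAddMonoidHom) ∧
      Function.Bijective
        (SurgeryMonoid.grMap (SurgeryMonoid.Elementary (Λ := Λ) ((-1 : ℤˣ) ^ q) Z).subtype) := by
  have h₃ : ∀ x : SurgeryMonoid.LMonoid (Λ := Λ) ((-1 : ℤˣ) ^ q) Z, ∃ k : ℕ, 0 < k ∧
      x + SurgeryMonoid.elementaryEquiv _ hZ ((SurgeryMonoid.QForm.hyp ((-1 : ℤˣ) ^ q)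
        (SurgeryMonoid.BasedModule.std Λ k)).cls Z) ∈
          SurgeryMonoid.Elementary ((-1 : ℤˣ) ^ q) Z := by
    intro x
    induction x using Quotient.inductionOn' with | h x => ?_
    exact x.exists_isElementary_add hZ
  -- The inverse was constructed as the induced form map, so its formula holds by definition.
  refine ⟨SurgeryMonoid.elementaryEquiv _ hZ, SurgeryMonoid.boundaryHom_ofHom hZ,
    fun _ _ => rfl, h₃, SurgeryMonoid.grMap_bijective_of_equiv _,
    SurgeryMonoid.grMap_subtype_bijective _ fun x => ?_⟩
  -- The summand `e[H_ε(Λ^k)]` is itself elementary, which gives the cofinality.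
  obtain ⟨k, -, hk⟩ := h₃ x
  exact ⟨_, Subtype.property _, hk⟩
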